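/- **Theorem.** Let $q$ be a prime power and $n\ge 1$; write $\mathrm{Tr}=\mathrm{Tr}_{q^n/q}$. The weight $w(v)$ of $v\in\mathbb F_{q^n}^{n+1}$ is the $\mathbb F_q$-dimension of the span of its entries. Let $\mathcal C\subseteq \mathbb F_{q^n}^{n+1}$ be a linear $[n+1,3,1]_{q^n/q}$ rank metric code, i.e. an $\mathbb F_{q^n}$-subspace of dimension $3$ with minimum rank distance $1$. A *system associated with* $\mathcal C$ is the $\mathbb F_q$-span $U\subseteq\mathbb F_{q^n}^3$ of the columns of a generator matrix of $\mathcal C$. Assume that $\mathcal C$ is *$q$-non-degenerate*: the columns of any generator matrix are $\mathbb F_q$-linearly independent and, for an associated system $U$, there is a $2$-dimensional $\mathbb F_{q^n}$-subspace $\overline W$ of $\mathbb F_{q^n}^3$ with $\dim_{\mathbb F_q}(U\cap \overline W)=2$ and $\dim_{\mathbb F_{q^n}}\langle U\cap \overline W\rangle_{\mathbb F_{q^n}}=2$ (this does not depend on $U$). Two codes $\mathcal C,\mathcal C'$ are *semilinearly equivalent* if $\mathcal C'=\mathcal C^\rho A$ for some $\rho\in\mathrm{Aut}(\mathbb F_{q^n})$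 and $A\in\mathrm{GL}(n+1,q)$. For an $\mathbb F_q$-linear map $f:\mathbb F_{q^n}\to\mathbb F_{q^n}$ (that is, a $q$-polynomial) and an $\mathbb F_q$-basis $\xi_1,\dots,\xi_n$ of $\mathbb F_{q^n}$, let $\mathcal C_f$ be the code generated by the rows of $$\begin{pmatrix}\xi_1&\cdots&\xi_n&0\\ f(\xi_1)&\cdots&f(\xi_n)&0\\ 0&\cdots&0&1\end{pmatrix}.$$ Statements on $\mathcal C_f$ below hold for every choice of the basis. Let $L_f$ be the set of points $\langle (x,f(x))\rangle_{\mathbb F_{q^n}}$, $x\ne0$, of $\mathrm{PG}(1,q^n)$; the weight of a point is the $\mathbb F_q$-dimension of its intersection with $\{(x,f(x)) : x\in\mathbb F_{q^n}\}$; $f$ is an *$i$-club polynomial* if one point of $L_f$ has weight $i$ and all its other points have weight $1$. Then: 0. Every system $U$ associated with $\mathcal C$ defines an $\mathbb F_q$-linear blocking set of Rédei type in $\mathrm{PG}(2,q^n)$: $\dim_{\mathbb F_q}U=n+1$, the set $L_U=\{\langle u\rangle_{\mathbb F_{q^n}} : u\in U\setminus\{0\}\}$ meets every line, and there is a line $\ell=\mathrm{PG}(W,\mathbb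 F_{q^n})$ such that $|L_U|=q^n+t$ with $t=|L_U\cap\ell|<q^n$, $\dim_{\mathbb F_q}(U\cap W)=n$ and $U=(U\cap W)\oplus\langle v\rangle_{\mathbb F_q}$ for some $v\notin W$. 1. If $\mathcal C$ has more than $q^n-1$ codewords of weight one, then $\mathcal C$ is semilinearly equivalent to $\mathcal C_{f}$ with $f=\mathrm{Tr}$. 2. If $n=4$, then $\mathcal C$ is semilinearly equivalent to $\mathcal C_f$ for one of the following polynomials $f$: - $x^q+\delta x^{q^3}$ with $\delta\in\mathbb F_{q^4}$, $\mathrm N_{q^4/q}(\delta)\neq1$; - $\mathrm{Tr}(x)$; - $x^q-x^{q^3}$; - $\mathrm{Tr}(\xi_2x)+b\,\mathrm{Tr}(\xi_3x)$, where $\mathbb F_q(b)=\mathbb F_{q^4}$ and $(\xi_0,\xi_1,\xi_2,\xi_3)$ is the trace-dual basis of an $\mathbb F_q$-basis of the form $(1,b,b^2+\omega,\omega b)$; - $\mathrm{Tr}(\xi_2x)+b\,\mathrm{Tr}(\xi_3x)$, where $(\xi_0,\xi_1,\xi_2,\xi_3)$ is the trace-dual basis of an $\mathbb F_q$-basis of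 the form $(1,a,\omega,\omega b)$ and $a,b$ do not both lie in $\mathbb F_{q^2}$. 3. If $\mathcal C$ has exactly $q^n-1$ codewords of weight one, exactly $(q^n-1)q^2$ codewords of weight two, and all the remaining nonzero codewords, with at most $(q^n-1)(q^n-q^2)$ exceptions, have weight at least $n-1$, then $\mathcal C$ is semilinearly equivalent to $\mathcal C_f$ for an $(n-2)$-club polynomial $$f(x)=\mathrm{Tr}(\xi x)+b\,\mathrm{Tr}(\eta x),\qquad b\in\mathbb F_{q^n}\setminus\mathbb F_q,\ \xi,\eta\in\mathbb F_{q^n}^*,$$ such that, with $t=[\mathbb F_q(b):\mathbb F_q]$, the orthogonal of $\langle\xi,\eta\rangle_{\mathbb F_q}$ under $(x,y)\mapsto\mathrm{Tr}(xy)$ is $\overline S\oplus c\langle 1,b,\dots,b^{t-3}\rangle_{\mathbb F_q}$ for some $c\in\mathbb F_{q^n}^*$ and some $\mathbb F_{q^t}$-subspace $\overline S$ of $\mathbb F_{q^n}$ of dimension $n/t-1$ (the second summand is $0$ if $t=2$). -/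

import Mathlib

open Module IntermediateField
open scoped LinearAlgebra.Projectivization

noncomputable section

namespace RankMetric

/-! ### Rank metric codes

Throughout, `F` is the field with `q` elements and `K` is its extension of degree `n`. -/

section Codes

variable (F : Type*) {K : Type*} [Field F] [Field K] [Algebra F K] {N k : ℕ}

/-- The rank weight of a vector: the `F`-dimension of the span of its entries. -/
def rankWeight (v : Fin N → K) : ℕ :=
  finrank F (Submodule.span F (Set.range v))

/-- The rank distance. -/
def rankDist (x y : Fin N → K) : ℕ :=
  rankWeight F (x - y)

/-- `C` is an `[N, k, d]` rank metric code: it has dimension `k` and minimum distance `d`. -/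
def IsCode (C : Submodule K (Fin N → K)) (k d : ℕ) : Prop :=
  finrank K C = k ∧
    IsLeast {r : ℕ | ∃ x ∈ C, ∃ y ∈ C, x ≠ y ∧ r = rankDist F x y} d

/-- The number of codewords of `C` whose weight satisfies `P`. -/
def numCodewords (C : Submodule K (Fin N → K)) (P : ℕ → Prop) : ℕ :=
  {c : Fin N → K | c ∈ C ∧ P (rankWeight F c)}.ncard

/-- `G` is a generator matrix of `C`: its rows form a basis of `C`. -/
def IsGeneratorMatrix (C : Submodule K (Fin N → K)) (G : Matrix (Fin k) (Fin N) K) : Prop :=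
  LinearIndependent K G.row ∧ Submodule.span K (Set.range G.row) = C

/-- The columns of any generator matrix are linearly independent over `F`. -/
def IsNondegenerate (C : Submodule K (Fin N → K)) : Prop :=
  ∀ (k : ℕ) (G : Matrix (Fin k) (Fin N) K), IsGeneratorMatrix C G → LinearIndependent F G.col

/-- `U` is a system associated with `C`: the `F`-span of the columns of a generator matrix. -/
def IsAssociatedSystem (C : Submodule K (Fin N → K)) (U : Submodule F (Fin k → K)) : Prop :=
  ∃ G : Matrix (Fin k) (Fin N) K,
    IsGeneratorMatrix C G ∧ U = Submodule.span F (Set.range G.col)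

/-- A code of dimension 3 is `q`-non-degenerate if it is non-degenerate and, for an associated
system `U`, there is a 2-dimensional `K`-subspace `W` such that `U ∩ W` has `F`-dimension 2 and
spans a `K`-subspace of dimension 2. (Associated systems of a code differ by a `K`-linear
automorphism, so the choice of `U` does not matter.) -/
def IsQNondegenerate (C : Submodule K (Fin N → K)) : Prop :=
  IsNondegenerate F C ∧
    ∃ U : Submodule F (Fin 3 → K), IsAssociatedSystem F C U ∧
      ∃ W : Submodule K (Fin 3 → K), finrank K W = 2 ∧
        finrank F (U ⊓ W.restrictScalars F : Submodule F (Fin 3 → K)) = 2 ∧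
        finrank K (Submodule.span K
          ((U ⊓ W.restrictScalars F : Submodule F (Fin 3 → K)) : Set (Fin 3 → K))) = 2

/-- `C' = C ^ ρ A` for an automorphism `ρ` of `K` and an invertible matrix `A` over `F`. -/
def SemilinearlyEquivalent (C C' : Submodule K (Fin N → K)) : Prop :=
  ∃ (ρ : K ≃+* K) (A : GL (Fin N) F),
    (C' : Set (Fin N → K)) =
      (fun v : Fin N → K =>
        Matrix.vecMul (fun i => ρ (v i)) ((A : Matrix (Fin N) (Fin N) F).map (algebraMap F K))) '' C

end Codes

/-! ### Linear sets and blocking sets -/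

section Geometry

variable (F : Type*) {K V : Type*} [Field F] [Field K] [Algebra F K]
  [AddCommGroup V] [Module K V] [Module F V] [IsScalarTower F K V]

variable {F} in
/-- The linear set `L_U` of the points spanned by the nonzero vectors of `U`. -/
def linearSet (K : Type*) [Field K] [Module K V] (U : Submodule F V) : Set (ℙ K V) :=
  {p | ∃ (u : V) (hu : u ≠ 0), u ∈ U ∧ p = Projectivization.mk K u hu}

variable {F} in
/-- The weight of the projective subspace of `W` in `L_U`. -/
def setWeight (U : Submodule F V) (W : Submodule K V) : ℕ :=
  finrank F (U ⊓ W.restrictScalars F : Submodule F V)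

/-- The points of the projective subspace of `W`. -/
def pointsOf (W : Submodule K V) : Set (ℙ K V) :=
  {p | p.submodule ≤ W}

/-- A set of points of a projective plane that meets every line. -/
def IsBlockingSet (B : Set (ℙ K V)) : Prop :=
  ∀ W : Submodule K V, finrank K W = 2 → (B ∩ pointsOf W).Nonempty

/-- The line of `W` meets `B` in exactly `t` points, where `|B| = |K| + t` and `t < |K|`. -/
def IsRedeiLine (B : Set (ℙ K V)) (W : Submodule K V) : Prop :=
  finrank K W = 2 ∧
    ∃ t : ℕ, t < Nat.card K ∧ B.ncard = Nat.card K + t ∧ (B ∩ pointsOf W).ncard = t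

variable {F} in
/-- `U` defines an `F`-linear blocking set of Rédei type: `L_U` has rank `n + 1`, it is a blocking
set, and it has a Rédei line meeting it in a linear set of rank `n`, so that `U` is the sum of an
`n`-dimensional subspace inside that line and of one further vector. -/
def IsLinearRedeiBlockingSet (U : Submodule F (Fin 3 → K)) : Prop :=
  finrank F U = finrank F K + 1 ∧ IsBlockingSet (linearSet K U) ∧
    ∃ W : Submodule K (Fin 3 → K), IsRedeiLine (linearSet K U) W ∧
      setWeight U W = finrank F K ∧
      ∃ v : Fin 3 → K, v ∉ W ∧ U = (U ⊓ W.restrictScalars F) ⊔ Submodule.span F {v}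

variable {F} in
/-- `f` is an `i`-club polynomial: all points but one of the linear set `L_f` of the points
`⟨(x, f x)⟩` have weight one and the remaining point has weight `i`. -/
def IsClubPolynomial (i : ℕ) (f : K →ₗ[F] K) : Prop :=
  ∃ P ∈ linearSet K f.graph, setWeight f.graph P.submodule = i ∧
    ∀ Q ∈ linearSet K f.graph, Q ≠ P → setWeight f.graph Q.submodule = 1

end Geometry

/-! ### The polynomials and the codes they define

The `q`-polynomials over `K`, modulo `x ^ (q ^ n) - x`, are the `F`-linear maps `K → K`. -/

section Polynomials

variable {F K : Type*} [Field F] [Field K] [Algebra F K]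

/-- The trace from `K` to `F`, as a map with values in `K`. -/
def Tr (F : Type*) {K : Type*} [Field F] [Field K] [Algebra F K] (x : K) : K :=
  algebraMap F K (Algebra.trace F K x)

/-- `f x = Tr (ξ x) + b Tr (η x)` with `b ∉ F` and `ξ, η ≠ 0`, such that the orthogonal of `⟨ξ, η⟩`
under the trace form is `S ⊕ c ⟨1, b, …, b ^ (t - 3)⟩`, where `t = [F(b) : F]`, `c ≠ 0` and `S` is
an `F(b)`-subspace of dimension `n / t - 1` (the second summand is zero for `t = 2`). -/
def IsTraceClubForm (f : K →ₗ[F] K) : Prop :=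
  ∃ b ξ η c : K, b ∉ Set.range (algebraMap F K) ∧ ξ ≠ 0 ∧ η ≠ 0 ∧ c ≠ 0 ∧
    (∀ x, f x = Tr F (ξ * x) + b * Tr F (η * x)) ∧
    ∃ S : Submodule F⟮b⟯ K,
      finrank F F⟮b⟯ * (finrank F⟮b⟯ S + 1) = finrank F K ∧
      Disjoint (S.restrictScalars F)
        (Submodule.span F ((fun i : ℕ => c * b ^ i) '' Set.Iio (finrank F F⟮b⟯ - 2))) ∧
      ∀ x : K, (∀ y ∈ Submodule.span F {ξ, η}, Algebra.trace F K (y * x) = 0) ↔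
        x ∈ S.restrictScalars F ⊔
          Submodule.span F ((fun i : ℕ => c * b ^ i) '' Set.Iio (finrank F F⟮b⟯ - 2))

/-- `f x = Tr (ξ₂ x) + b Tr (ξ₃ x)`, where `(ξ₀, ξ₁, ξ₂, ξ₃)` is the basis dual to
`(e₀, e₁, e₂, e₃)` under the trace form. -/
def IsDualBasisForm (e : Fin 4 → K) (b : K) (f : K →ₗ[F] K) : Prop :=
  LinearIndependent F e ∧
    ∃ ξ : Fin 4 → K, (∀ i j, Algebra.trace F K (e i * ξ j) = if i = j then 1 else 0) ∧
      ∀ x, f x = Tr F (ξ 2 * x) + b * Tr F (ξ 3 * x)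

/-- The list of polynomials for `n = 4`:
* `x ^ q + δ x ^ (q ^ 3)` with `N(δ) ≠ 1` (all points of `L_f` have weight one);
* the trace (one point of weight three, the others of weight one);
* `x ^ q - x ^ (q ^ 3)` (one point of weight two, the others of weight one);
* `Tr (ξ₂ x) + b Tr (ξ₃ x)` for the dual of a basis `(1, b, b ^ 2 + ω, ω b)` with `F(b) = K`
  (one point of weight two, the others of weight one);
* `Tr (ξ₂ x) + b Tr (ξ₃ x)` for the dual of a basis `(1, a, ω, ω b)`, where `a` and `b` do not
  both lie in the subfield of order `q ^ 2` (two or `q + 1` points of weight two, the others of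
  weight one). -/
def IsRankFourForm (f : K →ₗ[F] K) : Prop :=
  (∃ δ : K, Algebra.norm F δ ≠ 1 ∧
    ∀ x, f x = x ^ Nat.card F + δ * x ^ (Nat.card F ^ 3)) ∨
  (∀ x, f x = Tr F x) ∨
  (∀ x, f x = x ^ Nat.card F - x ^ (Nat.card F ^ 3)) ∨
  (∃ b ω : K, F⟮b⟯ = ⊤ ∧ IsDualBasisForm ![1, b, b ^ 2 + ω, ω * b] b f) ∨
  (∃ a b ω : K, ¬ (a ^ (Nat.card F ^ 2) = a ∧ b ^ (Nat.card F ^ 2) = b) ∧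
    IsDualBasisForm ![1, a, ω, ω * b] b f)

/-- The matrix with rows `(ξ₁, …, ξₙ, 0)`, `(f ξ₁, …, f ξₙ, 0)` and `(0, …, 0, 1)`. -/
def genMatrix {n : ℕ} (ξ : Fin n → K) (f : K → K) : Matrix (Fin 3) (Fin (n + 1)) K :=
  Matrix.of ![Fin.snoc ξ 0, Fin.snoc (fun i => f (ξ i)) 0, Fin.snoc (fun _ => 0) 1]

/-- The code generated by the rows of `genMatrix ξ f`. -/
def genCode {n : ℕ} (ξ : Fin n → K) (f : K → K) : Submodule K (Fin (n + 1) → K) :=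
  Submodule.span K (Set.range (genMatrix ξ f).row)

end Polynomials

end RankMetric

end

namespace RankMetric

section Equivalence

variable {F K : Type*} [Field F] [Field K] [Algebra F K] {N n : ℕ}

/-- The linear map `a x + b f x`. -/
def comb (f : K →ₗ[F] K) (a b : K) : K →ₗ[F] K :=
  a • LinearMap.id + b • f

@[simp]
lemma comb_apply (f : K →ₗ[F] K) (a b x : K) : comb f a b x = a * x + b * f x := by
  simp [comb]

lemma mem_genCode {ξ : Fin n → K} {f : K → K} {v : Fin (n + 1) → K} :
    v ∈ genCode ξ f ↔
      ∃ a b z : K, v = (Fin.snoc (fun i => a * ξ i + b * f (ξ i)) z : Fin (n + 1) → K) := by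
  have key : ∀ c : Fin 3 → K, ∑ i, c i • (genMatrix ξ f).row i =
      (Fin.snoc (fun i => c 0 * ξ i + c 1 * f (ξ i)) (c 2) : Fin (n + 1) → K) := by
    intro c
    ext j
    refine Fin.lastCases ?_ (fun j => ?_) j
    · simp [Fin.sum_univ_three, genMatrix, Matrix.row]
    · simp [Fin.sum_univ_three, genMatrix, Matrix.row]
  rw [genCode, Submodule.mem_span_range_iff_exists_fun]
  constructor
  · rintro ⟨c, rfl⟩
    exact ⟨c 0, c 1, c 2, key c⟩
  · rintro ⟨a, b, z, rfl⟩
    exact ⟨![a, b, z], by rw [key]; rfl⟩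

/-- `C' = C A` for an invertible matrix `A` over `F`. -/
def LinearlyEquivalent (F : Type*) [Field F] [Algebra F K] (C C' : Submodule K (Fin N → K)) :
    Prop :=
  ∃ A : GL (Fin N) F, (C' : Set (Fin N → K)) =
    (fun v : Fin N → K =>
      Matrix.vecMul v ((A : Matrix (Fin N) (Fin N) F).map (algebraMap F K))) '' C

lemma LinearlyEquivalent.semilinearlyEquivalent {C C' : Submodule K (Fin N → K)}
    (h : LinearlyEquivalent F C C') : SemilinearlyEquivalent F C C' := by
  obtain ⟨A, hA⟩ := h
  exact ⟨RingEquiv.refl K, A, hA⟩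

lemma vecMul_map_apply (v : Fin N → K) (A : Matrix (Fin N) (Fin N) F) (j : Fin N) :
    Matrix.vecMul v (A.map (algebraMap F K)) j = Fintype.linearCombination F v (A.col j) := by
  simp [Matrix.vecMul, dotProduct, Fintype.linearCombination_apply, Algebra.smul_def, mul_comm]

lemma rankWeight_eq_finrank_range (v : Fin N → K) :
    rankWeight F v = finrank F (LinearMap.range (Fintype.linearCombination F v)) := by
  rw [rankWeight, Fintype.range_linearCombination]

lemma vecMul_map_injective (A : GL (Fin N) F) :
    Function.Injective (fun v : Fin N → K =>
      Matrix.vecMul v ((A : Matrix (Fin N) (Fin N) F).map (algebraMap F K))) := by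
  intro v w h
  have h' := congrArg (fun u => Matrix.vecMul u
    (((A⁻¹ : GL (Fin N) F) : Matrix (Fin N) (Fin N) F).map (algebraMap F K))) h
  simpa [Matrix.vecMul_vecMul, ← Matrix.map_mul, ← Units.val_mul] using h'

lemma rankWeight_vecMul_le (v : Fin N → K) (A : Matrix (Fin N) (Fin N) F) :
    rankWeight F (Matrix.vecMul v (A.map (algebraMap F K))) ≤ rankWeight F v := by
  have := FiniteDimensional.span_of_finite F (Set.finite_range v)
  refine Submodule.finrank_mono (Submodule.span_le.2 ?_)
  rintro _ ⟨j, rfl⟩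
  rw [SetLike.mem_coe, vecMul_map_apply, ← Fintype.range_linearCombination]
  exact LinearMap.mem_range_self _ _

lemma rankWeight_vecMul (v : Fin N → K) (A : GL (Fin N) F) :
    rankWeight F (Matrix.vecMul v ((A : Matrix (Fin N) (Fin N) F).map (algebraMap F K))) =
      rankWeight F v := by
  refine le_antisymm (rankWeight_vecMul_le _ _) ?_
  have := rankWeight_vecMul_le (Matrix.vecMul v
    ((A : Matrix (Fin N) (Fin N) F).map (algebraMap F K)))
    ((A⁻¹ : GL (Fin N) F) : Matrix (Fin N) (Fin N) F)
  simpa [Matrix.vecMul_vecMul, ← Matrix.map_mul, ← Units.val_mul] using this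

lemma LinearlyEquivalent.numCodewords_eq {C C' : Submodule K (Fin N → K)}
    (h : LinearlyEquivalent F C C') (P : ℕ → Prop) :
    numCodewords F C' P = numCodewords F C P := by
  obtain ⟨A, hA⟩ := h
  rw [numCodewords, numCodewords, ← Set.ncard_image_of_injective
    {c : Fin N → K | c ∈ C ∧ P (rankWeight F c)} (vecMul_map_injective A)]
  congr 1
  ext c
  have hc : c ∈ C' ↔ ∃ v ∈ C, Matrix.vecMul v
      ((A : Matrix (Fin N) (Fin N) F).map (algebraMap F K)) = c := by
    rw [← SetLike.mem_coe, hA]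
    rfl
  simp only [Set.mem_ofPred_eq, hc, Set.mem_image]
  constructor
  · rintro ⟨⟨v, hv, rfl⟩, hP⟩
    exact ⟨v, ⟨hv, by rwa [rankWeight_vecMul] at hP⟩, rfl⟩
  · rintro ⟨v, ⟨hv, hP⟩, rfl⟩
    exact ⟨⟨v, hv, rfl⟩, by rwa [rankWeight_vecMul]⟩

lemma LinearlyEquivalent.isAssociatedSystem {C C' : Submodule K (Fin N → K)} {k : ℕ}
    (h : LinearlyEquivalent F C C') {U : Submodule F (Fin k → K)}
    (hU : IsAssociatedSystem F C U) : IsAssociatedSystem F C' U := by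
  obtain ⟨A, hA⟩ := h
  obtain ⟨G, ⟨hG, hGC⟩, rfl⟩ := hU
  set B := (A : Matrix (Fin N) (Fin N) F).map (algebraMap F K) with hB
  have hrow : (G * B).row = Matrix.vecMulLinear B ∘ G.row := by
    ext i j
    rfl
  have hspan : ∀ (G : Matrix (Fin k) (Fin N) K) (A : Matrix (Fin N) (Fin N) F),
      Submodule.span F (Set.range (G * A.map (algebraMap F K)).col) ≤
        Submodule.span F (Set.range G.col) := by
    intro G A
    rw [Submodule.span_le]
    rintro _ ⟨j, rfl⟩
    have : (G * A.map (algebraMap F K)).col j = ∑ i, A i j • G.col i := by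
      ext l
      simp [Matrix.mul_apply, Finset.sum_apply, Algebra.smul_def, mul_comm]
    rw [this]
    exact Submodule.sum_mem _ fun i _ => Submodule.smul_mem _ _ (Submodule.subset_span ⟨i, rfl⟩)
  refine ⟨G * B, ⟨?_, ?_⟩, le_antisymm ?_ (hspan G A)⟩
  · rw [hrow]
    exact hG.map' _ (LinearMap.ker_eq_bot.2 (vecMul_map_injective A))
  · rw [hrow, Set.range_comp, ← Submodule.map_span, hGC]
    exact SetLike.coe_injective (by rw [hA]; rfl)
  · have := hspan (G * B) ((A⁻¹ : GL (Fin N) F) : Matrix (Fin N) (Fin N) F)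
    rwa [Matrix.mul_assoc, hB, ← Matrix.map_mul, ← Units.val_mul, mul_inv_cancel, Units.val_one,
      Matrix.map_one _ (map_zero _) (map_one _), Matrix.mul_one] at this

end Equivalence

section NormalForm

variable {F K : Type*} [Field F] [Field K] [Algebra F K] {n : ℕ}

/-- `C` is linearly equivalent to the code of `f` in every basis. -/
def IsRepresentedBy (C : Submodule K (Fin (n + 1) → K)) (f : K →ₗ[F] K) : Prop :=
  ∀ ξ : Basis (Fin n) F K, LinearlyEquivalent F C (genCode ξ f)

lemma IsRepresentedBy.of_comb {C : Submodule K (Fin (n + 1) → K)} [FiniteDimensional F K]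
    {f f' : K →ₗ[F] K}
    (hf : IsRepresentedBy C f) {a b c d : K} (hdet : a * d - b * c ≠ 0)
    (hinj : Function.Injective (comb f a b)) (hf' : ∀ x, f' (comb f a b x) = comb f c d x) :
    IsRepresentedBy C f' := by
  intro ξ
  let φ : K ≃ₗ[F] K := LinearEquiv.ofInjectiveEndo (comb f a b) hinj
  have hφ : ∀ x, φ x = a * x + b * f x := fun x => by
    rw [LinearEquiv.coe_ofInjectiveEndo, comb_apply]
  have key : genCode ξ f' = genCode (ξ.map φ.symm) f := by
    have h1 : ∀ i, ξ i = a * φ.symm (ξ i) + b * f (φ.symm (ξ i)) := fun i => by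
      rw [← hφ, LinearEquiv.apply_symm_apply]
    have h2 : ∀ i, f' (ξ i) = c * φ.symm (ξ i) + d * f (φ.symm (ξ i)) := fun i => by
      have := hf' (φ.symm (ξ i))
      rwa [comb_apply, comb_apply, ← h1] at this
    ext v
    rw [mem_genCode, mem_genCode]
    constructor
    · rintro ⟨s, t, z, rfl⟩
      refine ⟨s * a + t * c, s * b + t * d, z, ?_⟩
      congr 1
      ext i
      rw [h2, Basis.map_apply]
      nth_rewrite 1 [h1 i]
      ring
    · rintro ⟨s, t, z, rfl⟩
      refine ⟨(s * d - t * c) / (a * d - b * c), (t * a - s * b) / (a * d - b * c), z, ?_⟩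
      congr 1
      ext i
      rw [h2, Basis.map_apply]
      rw [eq_comm, div_mul_eq_mul_div, div_mul_eq_mul_div, ← add_div, div_eq_iff hdet]
      linear_combination (s * d - t * c) * h1 i
  rw [key]
  exact hf _

/-- A vector of weight one becomes a multiple of the last coordinate vector in suitable
coordinates. -/
lemma exists_equiv_of_rankWeight_eq_one [FiniteDimensional F K] (hn : finrank F K = n)
    {v : Fin (n + 1) → K} (hv : rankWeight F v = 1) :
    ∃ (Φ : (K × F) ≃ₗ[F] (Fin (n + 1) → F)) (k : K), k ≠ 0 ∧
      ∀ x s, Fintype.linearCombination F v (Φ (x, s)) = s • k := by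
  rw [rankWeight_eq_finrank_range] at hv
  set L := Fintype.linearCombination F v
  have hker : finrank F (LinearMap.ker L) = n := by
    have := L.finrank_range_add_finrank_ker
    rw [hv, finrank_fin_fun] at this
    omega
  have hL : L ≠ 0 := by
    rintro h
    rw [h, LinearMap.range_zero, finrank_bot] at hv
    omega
  obtain ⟨a, ha⟩ : ∃ a, L a ≠ 0 := by
    by_contra! h
    exact hL (LinearMap.ext h)
  let e : K ≃ₗ[F] LinearMap.ker L := LinearEquiv.ofFinrankEq _ _ (by rw [hn, hker])
  let Ψ : (K × F) →ₗ[F] (Fin (n + 1) → F) :=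
    LinearMap.coprod ((LinearMap.ker L).subtype ∘ₗ e.toLinearMap) (LinearMap.toSpanSingleton F _ a)
  have hΨ : ∀ x s, Ψ (x, s) = e x + s • a := fun x s => by simp [Ψ]
  have hLΨ : ∀ x s, L (Ψ (x, s)) = s • L a := fun x s => by
    rw [hΨ, map_add, map_smul, LinearMap.mem_ker.1 (e x).2, zero_add]
  have hinj : Function.Injective Ψ := by
    rw [← LinearMap.ker_eq_bot, LinearMap.ker_eq_bot']
    rintro ⟨x, s⟩ h
    have hs : s = 0 := by
      have := hLΨ x s
      rw [h, map_zero] at this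
      exact (smul_eq_zero.1 this.symm).resolve_right ha
    subst hs
    rw [hΨ, zero_smul, add_zero] at h
    have : x = 0 := by simpa using h
    rw [this]
    rfl
  refine ⟨LinearEquiv.ofInjectiveOfFinrankEq Ψ hinj ?_, L a, ha, ?_⟩
  · rw [finrank_prod, hn, finrank_self, finrank_fin_fun]
  · intro x s
    rw [← hLΨ]
    congr 1

lemma exists_gl_of_equiv [FiniteDimensional F K]
    (Φ : (K × F) ≃ₗ[F] (Fin (n + 1) → F)) (ξ : Basis (Fin n) F K) :
    ∃ A : GL (Fin (n + 1)) F, ∀ v : Fin (n + 1) → K,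
      Matrix.vecMul v ((A : Matrix (Fin (n + 1)) (Fin (n + 1)) F).map (algebraMap F K)) =
        (Fin.snoc (fun i => Fintype.linearCombination F v (Φ (ξ i, 0)))
          (Fintype.linearCombination F v (Φ (0, 1))) : Fin (n + 1) → K) := by
  let w : Fin (n + 1) → (Fin (n + 1) → F) := Fin.snoc (fun i => Φ (ξ i, 0)) (Φ (0, 1))
  have hw : LinearIndependent F w := by
    rw [linearIndependent_finSnoc]
    constructor
    · exact ξ.linearIndependent.map' (Φ.toLinearMap ∘ₗ LinearMap.inl F K F)
        (LinearMap.ker_eq_bot.2 (Φ.injective.comp LinearMap.inl_injective))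
    · intro h
      have hle : Submodule.span F (Set.range fun i => Φ (ξ i, 0)) ≤
          LinearMap.ker (LinearMap.snd F K F ∘ₗ Φ.symm.toLinearMap) := by
        rw [Submodule.span_le]
        rintro _ ⟨i, rfl⟩
        simp
      have := hle h
      simp at this
  let M : Matrix (Fin (n + 1)) (Fin (n + 1)) F := (Matrix.of w).transpose
  have hM : IsUnit M := Matrix.linearIndependent_cols_iff_isUnit.1 hw
  refine ⟨hM.unit, fun v => ?_⟩
  ext j
  rw [IsUnit.unit_spec, vecMul_map_apply]
  have hcol : M.col j = w j := rfl
  rw [hcol]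
  refine Fin.lastCases ?_ (fun j => ?_) j
  · simp [w]
  · simp [w]

lemma exists_basis_of_form {V : Type*} [AddCommGroup V] [Module K V] {C : Submodule K V}
    (hC : finrank K C = 3) (l : V →ₗ[K] K) {v : V} (hvC : v ∈ C) (hv : l v ≠ 0) :
    ∃ c₀ ∈ C, ∃ c₁ ∈ C, l c₀ = 0 ∧ l c₁ = 0 ∧ (∀ a b : K, a • c₀ + b • c₁ = 0 → a = 0 ∧ b = 0) ∧
      ∀ c ∈ C, ∃ a b z : K, c = a • c₀ + b • c₁ + z • v := by
  have : FiniteDimensional K C := finite_of_finrank_eq_succ hC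
  have hsurj : LinearMap.range (l.domRestrict C) = ⊤ := by
    rw [LinearMap.range_eq_top]
    intro y
    refine ⟨(y / l v) • ⟨v, hvC⟩, ?_⟩
    simp [hv]
  have hker : finrank K (LinearMap.ker (l.domRestrict C)) = 2 := by
    have := (l.domRestrict C).finrank_range_add_finrank_ker
    rw [hsurj, finrank_top, finrank_self, hC] at this
    omega
  have B : Basis (Fin 2) K (LinearMap.ker (l.domRestrict C)) := finBasisOfFinrankEq K _ hker
  refine ⟨((B 0 : C) : V), (B 0 : C).2, ((B 1 : C) : V), (B 1 : C).2, (B 0).2, (B 1).2, ?_, ?_⟩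
  · intro a b hab
    have h := Fintype.linearIndependent_iff.1 B.linearIndependent ![a, b] (by
      rw [Fin.sum_univ_two]
      exact Subtype.ext (Subtype.ext hab))
    exact ⟨h 0, h 1⟩
  · intro c hc
    have hmem : (⟨c, hc⟩ - (l c / l v) • ⟨v, hvC⟩ : C) ∈ LinearMap.ker (l.domRestrict C) := by
      rw [LinearMap.mem_ker, map_sub, map_smul]
      simp [hv]
    have hs := B.sum_repr ⟨_, hmem⟩
    rw [Fin.sum_univ_two] at hs
    have hs' : (B.repr ⟨_, hmem⟩ 0) • ((B 0 : C) : V) + (B.repr ⟨_, hmem⟩ 1) • ((B 1 : C) : V) =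
        c - (l c / l v) • v :=
      congrArg (fun y : LinearMap.ker (l.domRestrict C) => ((y : C) : V)) hs
    exact ⟨_, _, l c / l v, by rw [hs', sub_add_cancel]⟩

lemma exists_injective_add_smul [Finite K] (g h : K →ₗ[F] K)
    (hgh : ∀ x, g x = 0 → h x = 0 → x = 0) : ∃ m : K, Function.Injective (g + m • h) := by
  by_contra! hcon
  have h' : ∀ m : K, ∃ x : K, x ≠ 0 ∧ g x + m * h x = 0 := by
    intro m
    have := hcon m
    rw [← LinearMap.ker_eq_bot, LinearMap.ker_eq_bot'.not] at this
    push Not at this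
    obtain ⟨x, hx, hx0⟩ := this
    exact ⟨x, hx0, by simpa using hx⟩
  choose X hX0 hX using h'
  have hXinj : Function.Injective X := by
    intro m m' hmm
    have e1 := hX m
    have e2 := hX m'
    rw [← hmm] at e2
    have e3 : (m - m') * h (X m) = 0 := by linear_combination e1 - e2
    rcases mul_eq_zero.1 e3 with e4 | e4
    · exact sub_eq_zero.1 e4
    · rw [e4] at e1
      exact absurd (hgh _ (by simpa using e1) e4) (hX0 m)
  obtain ⟨m, hm⟩ := (Finite.injective_iff_surjective.1 hXinj) 0
  exact hX0 m hm

/-- A nondegenerate three-dimensional code with a codeword of weight one is linearly equivalent to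
the code of a linear map. -/
lemma exists_isRepresentedBy [Finite K] (hn : finrank F K = n)
    {C : Submodule K (Fin (n + 1) → K)} [FiniteDimensional F K]
    (hC : finrank K C = 3) (hnd : IsNondegenerate F C)
    {v : Fin (n + 1) → K} (hvC : v ∈ C) (hv : rankWeight F v = 1) :
    ∃ f : K →ₗ[F] K, (∀ a b : K, comb f a b = 0 → a = 0 ∧ b = 0) ∧ IsRepresentedBy C f := by
  obtain ⟨Φ, k, hk, hΦ⟩ := exists_equiv_of_rankWeight_eq_one hn hv
  -- the last coordinate and the remaining coordinates of a codeword
  let last : (Fin (n + 1) → K) →ₗ[K] K :=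
    { toFun := fun c => Fintype.linearCombination F c (Φ (0, 1))
      map_add' := fun c d => by simp [Fintype.linearCombination_apply, Finset.sum_add_distrib]
      map_smul' := fun a c => by
        simp [Fintype.linearCombination_apply, Finset.mul_sum] }
  let init : (Fin (n + 1) → K) →ₗ[K] (K →ₗ[F] K) :=
    { toFun := fun c => Fintype.linearCombination F c ∘ₗ Φ.toLinearMap ∘ₗ LinearMap.inl F K F
      map_add' := fun c d => by
        ext x
        simp [Fintype.linearCombination_apply, Finset.sum_add_distrib]
      map_smul' := fun a c => by
        ext x
        simp [Fintype.linearCombination_apply, Finset.mul_sum] }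
  have hlast : ∀ c, last c = Fintype.linearCombination F c (Φ (0, 1)) := fun _ => rfl
  have hinit : ∀ c x, init c x = Fintype.linearCombination F c (Φ (x, 0)) := fun _ _ => rfl
  have hlv : last v = k := by rw [hlast, hΦ, one_smul]
  have hiv : init v = 0 := by
    ext x
    rw [hinit, hΦ, zero_smul, LinearMap.zero_apply]
  have hΦc : ∀ c x s, Fintype.linearCombination F c (Φ (x, s)) = init c x + s • last c := by
    intro c x s
    rw [hinit, hlast, ← map_smul, ← map_smul, ← map_add, ← map_add]
    simp
  have hsep : ∀ c, last c = 0 → init c = 0 → c = 0 := by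
    intro c h1 h2
    have h0 : Fintype.linearCombination F c = 0 := by
      ext1 i
      refine LinearMap.ext fun s => ?_
      obtain ⟨⟨x, s'⟩, hx⟩ := Φ.surjective (LinearMap.single F (fun _ => F) i s)
      rw [LinearMap.comp_apply, ← hx, hΦc, h1, h2]
      simp
    ext i
    have := LinearMap.congr_fun h0 (Pi.single i 1)
    simpa [Fintype.linearCombination_apply_single] using this
  obtain ⟨c₀, hc₀, c₁, hc₁, hl₀, hl₁, hB, hgen⟩ :=
    exists_basis_of_form hC last hvC (by rwa [hlv])
  have hind : ∀ a b : K, a • init c₀ + b • init c₁ = 0 → a = 0 ∧ b = 0 := by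
    intro a b hab
    have h0 : a • c₀ + b • c₁ = 0 :=
      hsep _ (by rw [map_add, map_smul, map_smul, hl₀, hl₁]; simp)
        (by rw [map_add, map_smul, map_smul, hab])
    exact hB a b h0
  have hjoint : ∀ x, init c₀ x = 0 → init c₁ x = 0 → x = 0 := by
    intro x h0 h1
    have hall : ∀ c ∈ C, Fintype.linearCombination F c (Φ (x, 0)) = 0 := by
      intro c hc
      obtain ⟨a, b, z, rfl⟩ := hgen c hc
      rw [hΦc, map_add, map_add, map_smul, map_smul, map_smul, hiv]
      simp [h0, h1]
    let B' := finBasisOfFinrankEq K C hC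
    let G : Matrix (Fin 3) (Fin (n + 1)) K := Matrix.of fun i => (B' i : Fin (n + 1) → K)
    have hG : IsGeneratorMatrix C G := by
      constructor
      · exact B'.linearIndependent.map' C.subtype (Submodule.ker_subtype _)
      · have : Set.range G.row = C.subtype '' Set.range B' := by
          rw [← Set.range_comp]
          rfl
        rw [this, ← Submodule.map_span, B'.span_eq, Submodule.map_top, Submodule.range_subtype]
    have hli := Fintype.linearIndependent_iff.1 (hnd 3 G hG) (Φ (x, 0)) (by
      ext i
      have := hall (B' i) (B' i).2
      rw [Fintype.linearCombination_apply] at this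
      simpa [Finset.sum_apply, G] using this)
    have h00 : Φ (x, 0) = 0 := funext hli
    simpa using h00
  obtain ⟨m, hm⟩ := exists_injective_add_smul _ _ hjoint
  let φ : K ≃ₗ[F] K := LinearEquiv.ofInjectiveEndo _ hm
  have hφ : ∀ x, φ x = init c₀ x + m * init c₁ x := fun x => by
    simp [φ, LinearEquiv.coe_ofInjectiveEndo]
  refine ⟨init c₁ ∘ₗ φ.symm.toLinearMap, ?_, ?_⟩
  · intro a b hab
    have := hind a (a * m + b) (by
      ext x
      have := LinearMap.congr_fun hab (φ x)
      rw [comb_apply, hφ] at this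
      simp only [LinearMap.comp_apply, LinearEquiv.coe_coe, ← hφ,
        LinearEquiv.symm_apply_apply] at this
      simp only [LinearMap.add_apply, LinearMap.smul_apply, smul_eq_mul]
      rw [LinearMap.zero_apply] at this ⊢
      rw [hφ] at this
      linear_combination this)
    obtain ⟨rfl, h⟩ := this
    simpa using h
  · intro ξ
    obtain ⟨A, hA⟩ := exists_gl_of_equiv Φ (ξ.map φ.symm)
    refine ⟨A, ?_⟩
    have hrep : ∀ a b z : K, Matrix.vecMul (a • c₀ + b • c₁ + z • v)
        ((A : Matrix (Fin (n + 1)) (Fin (n + 1)) F).map (algebraMap F K)) =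
        (Fin.snoc (fun i => a * ξ i + (b - a * m) * (init c₁ ∘ₗ φ.symm.toLinearMap) (ξ i))
          (z * k) : Fin (n + 1) → K) := by
      intro a b z
      rw [hA]
      congr 1
      · ext i
        have h1 : ξ i = init c₀ (φ.symm (ξ i)) + m * init c₁ (φ.symm (ξ i)) := by
          rw [← hφ, LinearEquiv.apply_symm_apply]
        rw [← hinit, map_add, map_add, map_smul, map_smul, map_smul, hiv]
        simp only [Basis.map_apply, LinearMap.add_apply, LinearMap.smul_apply, smul_eq_mul,
          smul_zero, LinearMap.zero_apply, LinearMap.comp_apply, LinearEquiv.coe_coe]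
        linear_combination -a * h1
      · rw [← hlast, map_add, map_add, map_smul, map_smul, map_smul, hl₀, hl₁, hlv]
        simp
    ext c
    rw [SetLike.mem_coe, mem_genCode]
    constructor
    · rintro ⟨a, b, z, rfl⟩
      refine ⟨a • c₀ + (b + a * m) • c₁ + (z / k) • v, ?_, ?_⟩
      · exact C.add_mem (C.add_mem (C.smul_mem _ hc₀) (C.smul_mem _ hc₁))
          (C.smul_mem _ hvC)
      · refine (hrep _ _ _).trans ?_
        rw [div_mul_cancel₀ _ hk, add_sub_cancel_right]
    · rintro ⟨c, hc, rfl⟩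
      obtain ⟨a, b, z, rfl⟩ := hgen c hc
      exact ⟨_, _, _, hrep a b z⟩

end NormalForm

section BlockingSet

variable {F K : Type*} [Field F] [Field K] [Algebra F K] {n : ℕ}

lemma finrank_inf_ker_add {V V' : Type*} [AddCommGroup V] [Module F V] [AddCommGroup V']
    [Module F V'] (U : Submodule F V) [FiniteDimensional F U] (g : V →ₗ[F] V') :
    finrank F (U.map g) + finrank F (U ⊓ LinearMap.ker g : Submodule F V) = finrank F U := by
  have h := (g.domRestrict U).finrank_range_add_finrank_ker
  rw [LinearMap.range_domRestrict] at h
  rw [← h, ← Submodule.map_comap_subtype, Submodule.finrank_map_subtype_eq]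
  rfl

lemma isBlockingSet_linearSet [FiniteDimensional F K] {U : Submodule F (Fin 3 → K)}
    (hU : finrank F U = finrank F K + 1) : IsBlockingSet (linearSet K U) := by
  intro W hW
  have hWF : finrank F (W.restrictScalars F) = finrank F K * 2 := by
    rw [← hW]
    exact (finrank_mul_finrank F K W).symm
  have hV : finrank F (Fin 3 → K) = finrank F K * 3 := by
    rw [← finrank_mul_finrank F K (Fin 3 → K), finrank_fin_fun]
  have hne : U ⊓ W.restrictScalars F ≠ ⊥ := by
    intro h
    have h1 := Submodule.finrank_sup_add_finrank_inf_eq U (W.restrictScalars F)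
    have h2 := Submodule.finrank_le (U ⊔ W.restrictScalars F)
    rw [h, finrank_bot] at h1
    omega
  obtain ⟨u, ⟨huU, huW⟩, hu⟩ := Submodule.exists_mem_ne_zero_of_ne_bot hne
  refine ⟨Projectivization.mk K u hu, ⟨u, hu, huU, rfl⟩, ?_⟩
  show (Projectivization.mk K u hu).submodule ≤ W
  rw [Projectivization.submodule_mk, Submodule.span_singleton_le_iff_mem]
  exact huW

lemma mk_mem_pointsOf {V : Type*} [AddCommGroup V] [Module K V] {W : Submodule K V} {u : V}
    (hu : u ≠ 0) : Projectivization.mk K u hu ∈ pointsOf W ↔ u ∈ W := by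
  show (Projectivization.mk K u hu).submodule ≤ W ↔ _
  rw [Projectivization.submodule_mk, Submodule.span_singleton_le_iff_mem]

/-- A subspace of dimension `n + 1` whose image under a linear form has dimension one defines a
linear blocking set of Rédei type. -/
lemma isLinearRedeiBlockingSet_of_form [Finite K] [FiniteDimensional F K]
    {U : Submodule F (Fin 3 → K)}
    (hU : finrank F U = finrank F K + 1) (l : (Fin 3 → K) →ₗ[K] K)
    (hl : finrank F (U.map (l.restrictScalars F)) = 1) : IsLinearRedeiBlockingSet U := by
  refine ⟨hU, isBlockingSet_linearSet hU, ?_⟩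
  set W := LinearMap.ker l with hW
  have hinf : U ⊓ W.restrictScalars F = U ⊓ LinearMap.ker (l.restrictScalars F) := rfl
  have hrank : finrank F (U ⊓ W.restrictScalars F : Submodule F (Fin 3 → K)) = finrank F K := by
    have := finrank_inf_ker_add U (l.restrictScalars F)
    rw [hinf]
    omega
  obtain ⟨v, hvU, hv⟩ : ∃ v ∈ U, l v ≠ 0 := by
    by_contra! h
    have : U.map (l.restrictScalars F) = ⊥ := by
      rw [eq_bot_iff]
      rintro _ ⟨u, hu, rfl⟩
      exact h u hu
    rw [this, finrank_bot] at hl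
    omega
  have hspan : Submodule.span F {l v} = U.map (l.restrictScalars F) := by
    refine Submodule.eq_of_le_of_finrank_eq ?_ ?_
    · rw [Submodule.span_singleton_le_iff_mem]
      exact ⟨v, hvU, rfl⟩
    · rw [hl, finrank_span_singleton hv]
  have hdec : ∀ u ∈ U, ∃ s : F, l u = s • l v := by
    intro u hu
    have : l u ∈ Submodule.span F {l v} := by
      rw [hspan]
      exact ⟨u, hu, rfl⟩
    obtain ⟨s, hs⟩ := Submodule.mem_span_singleton.1 this
    exact ⟨s, hs.symm⟩
  have hlsmul : ∀ (s : F) (u : Fin 3 → K), l (s • u) = s • l u := fun s u =>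
    (l.restrictScalars F).map_smul s u
  have hvW : v ∉ W := hv
  have hW2 : finrank K W = 2 := by
    have h := l.finrank_range_add_finrank_ker
    have hs : LinearMap.range l = ⊤ := by
      rw [LinearMap.range_eq_top]
      exact fun y => ⟨(y / l v) • v, by simp [hv]⟩
    rw [hs, finrank_top, finrank_self, finrank_fin_fun, ← hW] at h
    omega
  have hne : ∀ w ∈ U ⊓ W.restrictScalars F, w + v ≠ 0 := by
    rintro w ⟨-, hw⟩ h
    have : l (w + v) = l v := by rw [map_add, LinearMap.mem_ker.1 hw, zero_add]
    rw [h, map_zero] at this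
    exact hv this.symm
  refine ⟨W, ⟨hW2, (linearSet K U ∩ pointsOf W).ncard, ?_, ?_, rfl⟩, hrank, v, hvW, ?_⟩
  · have hr : linearSet K U ∩ pointsOf W = Set.range
        (fun w : {w : (U ⊓ W.restrictScalars F : Submodule F (Fin 3 → K)) // w ≠ 0} =>
          Projectivization.mk K (w.1 : Fin 3 → K) (by simpa using w.2)) := by
      ext p
      constructor
      · rintro ⟨⟨u, hu, huU, rfl⟩, hp⟩
        rw [mk_mem_pointsOf] at hp
        exact ⟨⟨⟨u, huU, hp⟩, fun h => hu (congrArg Subtype.val h)⟩, rfl⟩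
      · rintro ⟨w, rfl⟩
        exact ⟨⟨_, _, w.1.2.1, rfl⟩, (mk_mem_pointsOf _).2 w.1.2.2⟩
    rw [hr, ← Nat.card_coe_set_eq, ← Nat.card_congr (LinearEquiv.ofFinrankEq _ _ hrank).toEquiv]
    refine lt_of_le_of_lt (Finite.card_range_le _) (Finite.card_subtype_lt (x := 0) (by simp))
  · rw [← Set.ncard_inter_add_ncard_sdiff_eq_ncard _ (pointsOf W) (Set.toFinite _), add_comm]
    congr 1
    have hr : linearSet K U \ pointsOf W = Set.range
        (fun w : (U ⊓ W.restrictScalars F : Submodule F (Fin 3 → K)) =>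
          Projectivization.mk K (w.1 + v) (hne _ w.2)) := by
      ext p
      constructor
      · rintro ⟨⟨u, hu, huU, rfl⟩, hp⟩
        rw [mk_mem_pointsOf] at hp
        obtain ⟨s, hs⟩ := hdec u huU
        have hs0 : s ≠ 0 := by
          rintro rfl
          rw [zero_smul] at hs
          exact hp hs
        refine ⟨⟨s⁻¹ • u - v, U.sub_mem (U.smul_mem _ huU) hvU, ?_⟩, ?_⟩
        · show l (s⁻¹ • u - v) = 0
          rw [map_sub, hlsmul, hs, smul_smul, inv_mul_cancel₀ hs0, one_smul, sub_self]
        · refine (Projectivization.mk_eq_mk_iff' _ _ _ _ _).2 ⟨algebraMap F K s⁻¹, ?_⟩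
          rw [algebraMap_smul, sub_add_cancel]
      · rintro ⟨w, rfl⟩
        refine ⟨⟨_, _, U.add_mem w.2.1 hvU, rfl⟩, ?_⟩
        rw [mk_mem_pointsOf]
        intro h
        exact hvW ((Submodule.add_mem_iff_right W w.2.2).1 h)
    have hinj : Function.Injective
        (fun w : (U ⊓ W.restrictScalars F : Submodule F (Fin 3 → K)) =>
          Projectivization.mk K (w.1 + v) (hne _ w.2)) := by
      intro w w' h
      obtain ⟨a, ha⟩ := (Projectivization.mk_eq_mk_iff' _ _ _ _ _).1 h
      have ha' := congrArg l ha
      have e1 : l w.1 = 0 := w.2.2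
      have e2 : l w'.1 = 0 := w'.2.2
      rw [map_smul, map_add, map_add, e1, e2, zero_add, smul_eq_mul] at ha'
      have : a = 1 := mul_right_cancel₀ hv (by rw [ha', one_mul])
      rw [this, one_smul] at ha
      exact Subtype.ext (add_right_cancel ha).symm
    rw [hr, ← Nat.card_coe_set_eq, Nat.card_range_of_injective hinj]
    exact Nat.card_congr (LinearEquiv.ofFinrankEq _ _ hrank).toEquiv
  · refine le_antisymm ?_ (sup_le inf_le_left ?_)
    · intro u hu
      obtain ⟨s, hs⟩ := hdec u hu
      rw [← sub_add_cancel u (s • v)]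
      refine Submodule.add_mem_sup ⟨U.sub_mem hu (U.smul_mem _ hvU), ?_⟩
        (Submodule.smul_mem _ _ (Submodule.mem_span_singleton_self v))
      show l (u - s • v) = 0
      rw [map_sub, hlsmul, hs, sub_self]
    · rwa [Submodule.span_singleton_le_iff_mem]

/-- The systems of a nondegenerate code with a codeword of weight one define linear blocking sets
of Rédei type. -/
lemma isLinearRedeiBlockingSet [Finite K] [FiniteDimensional F K] (hn : finrank F K = n)
    {C : Submodule K (Fin (n + 1) → K)} (hnd : IsNondegenerate F C)
    {v : Fin (n + 1) → K} (hvC : v ∈ C) (hv : rankWeight F v = 1)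
    {U : Submodule F (Fin 3 → K)} (hU : IsAssociatedSystem F C U) :
    IsLinearRedeiBlockingSet U := by
  obtain ⟨G, hG, rfl⟩ := hU
  have hli := hnd 3 G hG
  rw [← hG.2, Submodule.mem_span_range_iff_exists_fun] at hvC
  obtain ⟨c, rfl⟩ := hvC
  refine isLinearRedeiBlockingSet_of_form ?_ (Fintype.linearCombination K c) ?_
  · rw [finrank_span_eq_card hli, Fintype.card_fin, hn]
  · refine Eq.trans ?_ hv
    have hcomp : (Fintype.linearCombination K c).restrictScalars F ∘ G.col =
        ∑ i, c i • G.row i := by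
      ext j
      simp [Fintype.linearCombination_apply, Finset.sum_apply, mul_comm]
    rw [rankWeight, Submodule.map_span, ← Set.range_comp, hcomp]

end BlockingSet

section Counting

variable {F K : Type*} [Field F] [Field K] [Algebra F K] {n : ℕ}

lemma rankWeight_snoc (ξ : Basis (Fin n) F K) (g : K →ₗ[F] K) (z : K) :
    rankWeight F (Fin.snoc (fun i => g (ξ i)) z : Fin (n + 1) → K) =
      finrank F (LinearMap.range g ⊔ Submodule.span F {z} : Submodule F K) := by
  have h1 : Set.range (Fin.snoc (fun i => g (ξ i)) z : Fin (n + 1) → K) =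
      g '' Set.range ξ ∪ {z} := by
    ext y
    constructor
    · rintro ⟨j, rfl⟩
      refine Fin.lastCases ?_ (fun j => ?_) j
      · simp
      · simp
    · rintro (⟨_, ⟨i, rfl⟩, rfl⟩ | rfl)
      · exact ⟨i.castSucc, by simp⟩
      · exact ⟨Fin.last n, by simp⟩
  rw [rankWeight, h1, Submodule.span_union, ← Submodule.map_span, ξ.span_eq, Submodule.map_top]

lemma comb_mul (f : K →ₗ[F] K) (k a b : K) :
    comb f (k * a) (k * b) = LinearMap.mulLeft F k ∘ₗ comb f a b := by
  ext x
  simp only [comb_apply, LinearMap.comp_apply, LinearMap.mulLeft_apply]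
  ring

lemma finrank_sup_span_singleton_of_mem {R : Submodule F K} {z : K} (hz : z ∈ R) :
    finrank F (R ⊔ Submodule.span F {z} : Submodule F K) = finrank F R := by
  rw [sup_eq_left.2 (by rwa [Submodule.span_singleton_le_iff_mem])]

lemma comb_zero_zero (f : K →ₗ[F] K) : comb f 0 0 = 0 := by simp [comb]

lemma finrank_range_comb_mul_sup (f : K →ₗ[F] K) {k : K} (hk : k ≠ 0) (a b w : K) :
    finrank F (LinearMap.range (comb f (k * a) (k * b)) ⊔
      Submodule.span F {k * w} : Submodule F K) =
    finrank F (LinearMap.range (comb f a b) ⊔ Submodule.span F {w} : Submodule F K) := by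
  have hinj : Function.Injective (LinearMap.mulLeft F k) := mul_right_injective₀ hk
  have hmap : (LinearMap.range (comb f (k * a) (k * b)) ⊔ Submodule.span F {k * w}) =
      (LinearMap.range (comb f a b) ⊔ Submodule.span F {w}).map (LinearMap.mulLeft F k) := by
    rw [Submodule.map_sup, Submodule.map_span, Set.image_singleton, comb_mul, LinearMap.range_comp]
    rfl
  rw [hmap]
  exact (Submodule.equivMapOfInjective _ hinj _).finrank_eq.symm

variable [FiniteDimensional F K]

/-- The weight distribution of a code in terms of the ranks of the maps `a x + b f x`. -/
lemma IsRepresentedBy.numCodewords_eq {C : Submodule K (Fin (n + 1) → K)} {f : K →ₗ[F] K}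
    (hC : IsRepresentedBy C f) (hn : finrank F K = n)
    (hf : ∀ a b : K, comb f a b = 0 → a = 0 ∧ b = 0) (P : ℕ → Prop) :
    numCodewords F C P = {t : K × K × K | P (finrank F (LinearMap.range (comb f t.1 t.2.1) ⊔
      Submodule.span F {t.2.2} : Submodule F K))}.ncard := by
  have ξ : Basis (Fin n) F K := finBasisOfFinrankEq F K hn
  rw [← (hC ξ).numCodewords_eq, numCodewords]
  let Ψ : K × K × K → (Fin (n + 1) → K) := fun t =>
    Fin.snoc (fun i => comb f t.1 t.2.1 (ξ i)) t.2.2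
  have hΨ : Function.Injective Ψ := by
    rintro ⟨a, b, z⟩ ⟨a', b', z'⟩ h
    obtain ⟨h1, h2⟩ := Fin.snoc_injective2 h
    have h3 : comb f (a - a') (b - b') = 0 := by
      refine ξ.ext fun i => ?_
      have := congrFun h1 i
      simp only [comb_apply] at this
      rw [comb_apply, LinearMap.zero_apply]
      linear_combination this
    obtain ⟨h4, h5⟩ := hf _ _ h3
    rw [sub_eq_zero.1 h4, sub_eq_zero.1 h5]
    exact congrArg (fun z => (a', b', z)) h2
  rw [← Set.ncard_image_of_injective _ hΨ]
  congr 1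
  ext c
  constructor
  · rintro ⟨hc, hP⟩
    obtain ⟨a, b, z, rfl⟩ := mem_genCode.1 hc
    have h : (Fin.snoc (fun i => a * ξ i + b * f (ξ i)) z : Fin (n + 1) → K) =
        Fin.snoc (fun i => comb f a b (ξ i)) z := by simp
    rw [h, rankWeight_snoc] at hP
    exact ⟨(a, b, z), hP, h.symm⟩
  · rintro ⟨⟨a, b, z⟩, hP, rfl⟩
    refine ⟨mem_genCode.2 ⟨a, b, z, by simp [Ψ]⟩, ?_⟩
    simp only [Ψ, rankWeight_snoc]
    exact hP

lemma ncard_lower_bound [Finite K] {T : Set (K × K × K)} {S : Set K} {a b c d z : K}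
    (hdet : a * d - b * c ≠ 0)
    (hS : ∀ k : K, k ≠ 0 → ∀ w ∈ S, (k * a, k * b, k * w) ∈ T) (hT : (c, d, z) ∈ T) :
    (Nat.card K - 1) * S.ncard + 1 ≤ T.ncard := by
  let Ψ : K × K → K × K × K := fun p => (p.1 * a, p.1 * b, p.1 * p.2)
  have hinj : Set.InjOn Ψ (({0}ᶜ : Set K) ×ˢ S) := by
    rintro ⟨k, w⟩ ⟨hk, -⟩ ⟨k', w'⟩ - h
    simp only [Ψ, Prod.mk.injEq] at h
    obtain ⟨h1, h2, h3⟩ := h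
    have hkk : k = k' := by
      have : (k - k') * (a * d - b * c) = 0 := by linear_combination d * h1 - c * h2
      exact sub_eq_zero.1 ((mul_eq_zero.1 this).resolve_right hdet)
    subst hkk
    rw [mul_left_cancel₀ hk h3]
  have hnot : (c, d, z) ∉ Ψ '' (({0}ᶜ : Set K) ×ˢ S) := by
    rintro ⟨⟨k, w⟩, -, h⟩
    simp only [Ψ, Prod.mk.injEq] at h
    apply hdet
    rw [← h.1, ← h.2.1]
    ring
  have hsub : insert (c, d, z) (Ψ '' (({0}ᶜ : Set K) ×ˢ S)) ⊆ T := by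
    rw [Set.insert_subset_iff]
    refine ⟨hT, ?_⟩
    rintro _ ⟨⟨k, w⟩, ⟨hk, hw⟩, rfl⟩
    exact hS k hk w hw
  have := Set.ncard_le_ncard hsub (Set.toFinite _)
  rwa [Set.ncard_insert_of_notMem hnot (Set.toFinite _), hinj.ncard_image,
    Set.ncard_prod, Set.ncard_compl, Set.ncard_singleton] at this

/-- The rank of the map `a x + b f x`. -/
noncomputable def combRank (f : K →ₗ[F] K) (a b : K) : ℕ :=
  finrank F (LinearMap.range (comb f a b))

lemma combRank_eq_zero {f : K →ₗ[F] K} {a b : K} (h : combRank f a b = 0) : comb f a b = 0 := by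
  rwa [combRank, Submodule.finrank_eq_zero, LinearMap.range_eq_bot] at h

lemma combRank_add_finrank_ker (f : K →ₗ[F] K) (a b : K) :
    combRank f a b + finrank F (LinearMap.ker (comb f a b)) = finrank F K :=
  LinearMap.finrank_range_add_finrank_ker _

lemma combRank_le_finrank_sup (f : K →ₗ[F] K) (a b z : K) :
    combRank f a b ≤
      finrank F (LinearMap.range (comb f a b) ⊔ Submodule.span F {z} : Submodule F K) :=
  Submodule.finrank_mono le_sup_left

variable [Finite K] {C : Submodule K (Fin (n + 1) → K)} {f : K →ₗ[F] K}

lemma exists_combRank_eq_one (hC : IsRepresentedBy C f) (hn : finrank F K = n)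
    (hf : ∀ a b : K, comb f a b = 0 → a = 0 ∧ b = 0)
    (h : Nat.card K - 1 < numCodewords F C (fun w => w = 1)) :
    ∃ a b : K, combRank f a b = 1 := by
  by_contra! hcon
  rw [hC.numCodewords_eq hn hf] at h
  refine absurd h (not_lt.2 ?_)
  have hsub : {t : K × K × K | finrank F (LinearMap.range (comb f t.1 t.2.1) ⊔
      Submodule.span F {t.2.2} : Submodule F K) = 1} ⊆
      (fun z : K => ((0 : K), (0 : K), z)) '' {0}ᶜ := by
    rintro ⟨a, b, z⟩ ht
    have ht' : finrank F (LinearMap.range (comb f a b) ⊔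
      Submodule.span F {z} : Submodule F K) = 1 := ht
    have hle := combRank_le_finrank_sup f a b z
    have hne := hcon a b
    obtain ⟨rfl, rfl⟩ := hf a b (combRank_eq_zero (by omega))
    refine ⟨z, ?_, rfl⟩
    rintro rfl
    rw [comb_zero_zero, LinearMap.range_zero, bot_sup_eq, Submodule.span_zero_singleton,
      finrank_bot] at ht'
    omega
  refine (Set.ncard_le_ncard hsub (Set.toFinite _)).trans ((Set.ncard_image_le).trans ?_)
  rw [Set.ncard_compl, Set.ncard_singleton]

lemma combRank_ne_one (hC : IsRepresentedBy C f) (hn : finrank F K = n)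
    (hf : ∀ a b : K, comb f a b = 0 → a = 0 ∧ b = 0)
    (h : numCodewords F C (fun w => w = 1) = Nat.card K - 1) (a b : K) :
    combRank f a b ≠ 1 := by
  intro hab
  rw [hC.numCodewords_eq hn hf] at h
  have hsub : insert (a, b, (0 : K)) ((fun z : K => ((0 : K), (0 : K), z)) '' {0}ᶜ) ⊆
      {t : K × K × K | finrank F (LinearMap.range (comb f t.1 t.2.1) ⊔
      Submodule.span F {t.2.2} : Submodule F K) = 1} := by
    rw [Set.insert_subset_iff]
    refine ⟨?_, ?_⟩
    · exact (finrank_sup_span_singleton_of_mem (Submodule.zero_mem _)).trans hab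
    · rintro _ ⟨z, hz, rfl⟩
      show finrank F (LinearMap.range (comb f 0 0) ⊔ Submodule.span F {z} : Submodule F K) = 1
      rw [comb_zero_zero, LinearMap.range_zero, bot_sup_eq, finrank_span_singleton hz]
  have hnot : (a, b, (0 : K)) ∉ (fun z : K => ((0 : K), (0 : K), z)) '' {0}ᶜ := by
    rintro ⟨z, hz, hh⟩
    simp only [Prod.mk.injEq] at hh
    exact hz hh.2.2
  have := Set.ncard_le_ncard hsub (Set.toFinite _)
  rw [h, Set.ncard_insert_of_notMem hnot (Set.toFinite _), Set.ncard_image_of_injective _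
    (fun z z' hz => by simpa using hz), Set.ncard_compl, Set.ncard_singleton] at this
  omega

lemma exists_combRank_eq_two [Finite F] (hC : IsRepresentedBy C f) (hn : finrank F K = n)
    (hf : ∀ a b : K, comb f a b = 0 → a = 0 ∧ b = 0)
    (h1 : numCodewords F C (fun w => w = 1) = Nat.card K - 1)
    (h2 : numCodewords F C (fun w => w = 2) = (Nat.card K - 1) * Nat.card F ^ 2)
    (h3 : numCodewords F C (fun w => 3 ≤ w ∧ w < n - 1) ≤
      (Nat.card K - 1) * (Nat.card K - Nat.card F ^ 2)) :
    ∃ a b : K, combRank f a b = 2 ∧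
      ∀ c d : K, a * d - b * c ≠ 0 → n - 1 ≤ combRank f c d := by
  have hone := combRank_ne_one hC hn hf h1
  rw [hC.numCodewords_eq hn hf] at h2 h3
  have hK : 1 < Nat.card K := Finite.one_lt_card
  have hF : 0 < Nat.card F := Nat.card_pos
  obtain ⟨⟨a, b, z⟩, ht⟩ := Set.nonempty_of_ncard_ne_zero (by
    rw [h2]
    exact (Nat.mul_pos (by omega) (pow_pos hF 2)).ne')
  replace ht : finrank F (LinearMap.range (comb f a b) ⊔
      Submodule.span F {z} : Submodule F K) = 2 := ht
  have hab : combRank f a b = 2 := by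
    have hle := combRank_le_finrank_sup f a b z
    have hne := hone a b
    have h0 : combRank f a b ≠ 0 := by
      intro h
      rw [combRank_eq_zero h, LinearMap.range_zero, bot_sup_eq] at ht
      have := finrank_span_le_card (R := F) ({z} : Set K)
      simp only [Set.toFinset_singleton, Finset.card_singleton] at this
      omega
    omega
  have hcard : Nat.card (LinearMap.range (comb f a b)) = Nat.card F ^ 2 := by
    rw [Module.natCard_eq_pow_finrank (K := F)]
    exact congrArg _ hab
  have hncard : ((LinearMap.range (comb f a b) : Submodule F K) : Set K).ncard =
      Nat.card F ^ 2 := hcard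
  refine ⟨a, b, hab, fun c d hdet => ?_⟩
  have hc0 : combRank f c d ≠ 0 := by
    intro h
    obtain ⟨rfl, rfl⟩ := hf _ _ (combRank_eq_zero h)
    simp at hdet
  have hc1 := hone c d
  have hc2 : combRank f c d ≠ 2 := by
    intro h
    have := ncard_lower_bound (T := {t : K × K × K | finrank F (LinearMap.range
      (comb f t.1 t.2.1) ⊔ Submodule.span F {t.2.2} : Submodule F K) = 2})
      (S := (LinearMap.range (comb f a b) : Submodule F K)) (z := 0) hdet ?_ ?_
    · rw [h2, hncard] at this
      omega
    · intro k hk w hw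
      exact (finrank_range_comb_mul_sup f hk a b w).trans
        ((finrank_sup_span_singleton_of_mem hw).trans hab)
    · exact (finrank_sup_span_singleton_of_mem (Submodule.zero_mem _)).trans h
  by_contra! hlt
  have := ncard_lower_bound (T := {t : K × K × K | 3 ≤ finrank F (LinearMap.range
      (comb f t.1 t.2.1) ⊔ Submodule.span F {t.2.2} : Submodule F K) ∧
      finrank F (LinearMap.range (comb f t.1 t.2.1) ⊔
      Submodule.span F {t.2.2} : Submodule F K) < n - 1})
      (S := ((LinearMap.range (comb f a b) : Submodule F K) : Set K)ᶜ) (z := 0) hdet ?_ ?_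
  · rw [Set.ncard_compl, hncard] at this
    omega
  · intro k hk w hw
    have : finrank F (LinearMap.range (comb f (k * a) (k * b)) ⊔
        Submodule.span F {k * w} : Submodule F K) = 3 :=
      (finrank_range_comb_mul_sup f hk a b w).trans
        ((Submodule.finrank_sup_span_singleton hw).trans (congrArg (· + 1) hab))
    exact ⟨this.ge, by show _ < _; rw [this]; omega⟩
  · have : finrank F (LinearMap.range (comb f c d) ⊔
        Submodule.span F {(0 : K)} : Submodule F K) = combRank f c d :=
      finrank_sup_span_singleton_of_mem (Submodule.zero_mem _)
    exact ⟨by show 3 ≤ _; rw [this]; omega, by show _ < _; rw [this]; exact hlt⟩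

end Counting

section TraceForms

variable {F K : Type*} [Field F] [Field K] [Algebra F K]

/-- The trace as a linear map with values in `K`. -/
noncomputable def traceMap (F K : Type*) [Field F] [Field K] [Algebra F K] : K →ₗ[F] K :=
  Algebra.linearMap F K ∘ₗ Algebra.trace F K

lemma traceMap_apply (x : K) : traceMap F K x = Tr F x := rfl

lemma Tr_mul (x y : K) : Tr F x * y = Algebra.trace F K x • y := (Algebra.smul_def _ _).symm

lemma combRank_zero_right {f : K →ₗ[F] K} {a : K} (ha : a ≠ 0) : combRank f a 0 = finrank F K := by
  have hinj : Function.Injective (comb f a 0) := by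
    intro x y h
    simpa [ha] using h
  rw [combRank, LinearMap.finrank_range_of_inj hinj]

/-- A code with a map `a x + b f x` of rank two is represented by that map, with its image scaled
so as to contain `1`. -/
lemma exists_normalized_of_combRank_eq_two [FiniteDimensional F K]
    {n : ℕ} {C : Submodule K (Fin (n + 1) → K)} {f : K →ₗ[F] K}
    (hC : IsRepresentedBy C f) (hn : 3 ≤ finrank F K) {a b : K} (hab : combRank f a b = 2) :
    ∃ (g : K →ₗ[F] K) (β : K), IsRepresentedBy C g ∧ LinearIndependent F ![1, β] ∧
      LinearMap.range g = Submodule.span F (Set.range ![1, β]) ∧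
      ∀ c d : K, c ≠ 0 → ∃ c' d' : K, a * d' - b * c' ≠ 0 ∧ comb g c d = comb f c' d' := by
  have hb : b ≠ 0 := by
    rintro rfl
    by_cases ha : a = 0
    · rw [ha, combRank, comb_zero_zero, LinearMap.range_zero, finrank_bot] at hab
      omega
    · rw [combRank_zero_right ha] at hab
      omega
  have B : Basis (Fin 2) F (LinearMap.range (comb f a b)) := finBasisOfFinrankEq F _ hab
  set α : K := (B 0).1
  have hα0 : α ≠ 0 := fun h => B.ne_zero 0 (Subtype.ext h)
  set γ : K := (B 1).1
  have hB : ![α, γ] = (LinearMap.range (comb f a b)).subtype ∘ B := by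
    ext i
    fin_cases i <;> rfl
  have hspan : LinearMap.range (comb f a b) = Submodule.span F (Set.range ![α, γ]) := by
    rw [hB, Set.range_comp, ← Submodule.map_span, B.span_eq, Submodule.map_top,
      Submodule.range_subtype]
  have hli : LinearIndependent F ![α, γ] := by
    rw [hB]
    exact B.linearIndependent.map' _ (Submodule.ker_subtype _)
  have hvec : ![1, γ / α] = LinearMap.mulLeft F α⁻¹ ∘ ![α, γ] := by
    ext i
    fin_cases i
    · simp [hα0]
    · simp [div_eq_inv_mul]
  have hcomb : comb f (a / α) (b / α) = LinearMap.mulLeft F α⁻¹ ∘ₗ comb f a b := by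
    rw [← comb_mul, div_eq_inv_mul, div_eq_inv_mul]
  refine ⟨comb f (a / α) (b / α), γ / α, ?_, ?_, ?_, ?_⟩
  · refine hC.of_comb (a := 1) (b := 0) (c := a / α) (d := b / α) ?_ ?_ ?_
    · rw [zero_mul, sub_zero, one_mul]
      exact div_ne_zero hb hα0
    · intro x y h
      simpa using h
    · intro x
      simp
  · rw [hvec]
    exact hli.map' _ (LinearMap.ker_eq_bot.2 (mul_right_injective₀ (inv_ne_zero hα0)))
  · rw [hcomb, LinearMap.range_comp, hspan, Submodule.map_span, ← Set.range_comp, hvec]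
  · intro c d hc
    refine ⟨c + d * (a / α), d * (b / α), ?_, ?_⟩
    · have : a * (d * (b / α)) - b * (c + d * (a / α)) = -(b * c) := by
        field_simp
        ring
      rw [this]
      exact neg_ne_zero.2 (mul_ne_zero hb hc)
    · ext x
      simp only [comb_apply]
      ring

variable [FiniteDimensional F K] [Algebra.IsSeparable F K]

lemma exists_eq_trace_mul (g : K →ₗ[F] F) : ∃ ξ : K, ∀ x, g x = Algebra.trace F K (ξ * x) := by
  refine ⟨((Algebra.traceForm F K).toDual (traceForm_nondegenerate F K)).symm g, fun x => ?_⟩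
  rw [← Algebra.traceForm_apply, LinearMap.BilinForm.apply_toDual_symm_apply]

lemma exists_eq_sum_Tr_mul {ι : Type*} [Fintype ι] {v : ι → K} (hv : LinearIndependent F v)
    (g : K →ₗ[F] K) (hg : ∀ x, g x ∈ Submodule.span F (Set.range v)) :
    ∃ ξ : ι → K, ∀ x, g x = ∑ i, Tr F (ξ i * x) * v i := by
  have h : ∀ i, ∃ ξ : K, ∀ x, (Basis.span hv).coord i (g.codRestrict _ hg x) =
      Algebra.trace F K (ξ * x) := fun i =>
    exists_eq_trace_mul ((Basis.span hv).coord i ∘ₗ g.codRestrict _ hg)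
  choose ξ hξ using h
  refine ⟨ξ, fun x => ?_⟩
  have h1 := congrArg Subtype.val ((Basis.span hv).sum_repr (g.codRestrict _ hg x))
  rw [LinearMap.codRestrict_apply] at h1
  rw [← h1]
  simp only [AddSubmonoidClass.coe_finsetSum, Submodule.coe_smul, Basis.span_apply]
  refine Finset.sum_congr rfl fun i _ => ?_
  rw [Tr_mul, ← hξ]
  rfl

variable {n : ℕ} {C : Submodule K (Fin (n + 1) → K)} {f : K →ₗ[F] K}

lemma isRepresentedBy_traceMap (hC : IsRepresentedBy C f) (hn : 2 ≤ finrank F K) {a b : K}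
    (hab : combRank f a b = 1) : IsRepresentedBy C (traceMap F K) := by
  have hb : b ≠ 0 := by
    rintro rfl
    by_cases ha : a = 0
    · rw [ha, combRank, comb_zero_zero, LinearMap.range_zero, finrank_bot] at hab
      omega
    · rw [combRank_zero_right ha] at hab
      omega
  obtain ⟨⟨α, hαr⟩, hα0, hα⟩ := finrank_eq_one_iff'.1 hab
  replace hα0 : α ≠ 0 := fun h => hα0 (Subtype.ext h)
  have hli : LinearIndependent F (fun _ : Fin 1 => α) := by
    rw [linearIndependent_unique_iff]
    exact hα0
  obtain ⟨ξ, hξ⟩ := exists_eq_sum_Tr_mul hli (comb f a b) (by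
    intro x
    obtain ⟨s, hs⟩ := hα ⟨_, LinearMap.mem_range_self _ x⟩
    have hs' : s • α = comb f a b x := congrArg Subtype.val hs
    rw [← hs']
    exact Submodule.smul_mem _ _ (Submodule.subset_span ⟨0, rfl⟩))
  simp only [Finset.univ_unique, Fin.default_eq_zero, Finset.sum_singleton] at hξ
  have hξ0 : ξ 0 ≠ 0 := by
    intro h
    obtain ⟨x, hx⟩ := hαr
    rw [hξ, h, zero_mul, Tr, map_zero, map_zero, zero_mul] at hx
    exact hα0 hx.symm
  refine hC.of_comb (a := ξ 0) (b := 0) (c := a / α) (d := b / α) ?_ ?_ ?_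
  · rw [zero_mul, sub_zero]
    exact mul_ne_zero hξ0 (div_ne_zero hb hα0)
  · intro x y h
    simpa [hξ0] using h
  · intro x
    have h1 := hξ x
    rw [comb_apply] at h1
    rw [comb_apply, zero_mul, add_zero, traceMap_apply, comb_apply, div_mul_eq_mul_div,
      div_mul_eq_mul_div, ← add_div, h1, mul_div_cancel_right₀ _ hα0]

end TraceForms

section Clubs

variable {F K : Type*} [Field F] [Field K] [Algebra F K]

lemma notMem_range_of_linearIndependent {b : K} (hb : LinearIndependent F ![1, b]) :
    b ∉ Set.range (algebraMap F K) := by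
  rintro ⟨s, rfl⟩
  have := LinearIndependent.pair_iff.1 hb (-s) 1 (by simp [Algebra.smul_def])
  exact one_ne_zero this.2

lemma forall_mem_span_pair_trace_mul {ξ η x : K} :
    (∀ y ∈ Submodule.span F {ξ, η}, Algebra.trace F K (y * x) = 0) ↔
      Algebra.trace F K (ξ * x) = 0 ∧ Algebra.trace F K (η * x) = 0 := by
  constructor
  · intro h
    exact ⟨h _ (Submodule.subset_span (by simp)), h _ (Submodule.subset_span (by simp))⟩
  · rintro ⟨h1, h2⟩ y hy
    obtain ⟨s, t, rfl⟩ := Submodule.mem_span_pair.1 hy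
    rw [add_mul, smul_mul_assoc, smul_mul_assoc, map_add, map_smul, map_smul, h1, h2, smul_zero,
      smul_zero, add_zero]

lemma Tr_add_mul_Tr_eq_zero_iff {b : K} (hb : LinearIndependent F ![1, b]) {ξ η x : K} :
    Tr F (ξ * x) + b * Tr F (η * x) = 0 ↔
      Algebra.trace F K (ξ * x) = 0 ∧ Algebra.trace F K (η * x) = 0 := by
  constructor
  · intro h
    refine LinearIndependent.pair_iff.1 hb _ _ ?_
    rw [← h, ← Tr_mul, ← Tr_mul, mul_one, mul_comm b]
  · rintro ⟨h1, h2⟩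
    simp [Tr, h1, h2]

/-- All points of `L_f` other than `⟨(1, 0)⟩` have weight one. -/
def IsThinOutsideKer (f : K →ₗ[F] K) : Prop :=
  ∀ x y : K, f x ≠ 0 → x * f y = y * f x → ∃ s : F, y = s • x

lemma IsThinOutsideKer.sub_mul_ne {f : K →ₗ[F] K} {b : K}
    (hf : IsThinOutsideKer f) (hb : LinearIndependent F ![1, b])
    {x₁ x₂ s s' : K} (hx₁ : f x₁ = 1) (hx₂ : f x₂ = b) (hs : f s = 0) (hs' : f s' = 0) :
    x₂ - b * x₁ ≠ s + b * s' := by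
  intro hss
  have e1 : f (x₁ + s') = 1 := by rw [map_add, hx₁, hs', add_zero]
  have e2 : f (x₂ - s) = b := by rw [map_sub, hx₂, hs, sub_zero]
  obtain ⟨k, hk⟩ := hf (x₁ + s') (x₂ - s) (by rw [e1]; exact one_ne_zero) (by
    rw [e1, e2]
    linear_combination -hss)
  refine notMem_range_of_linearIndependent hb ⟨k, ?_⟩
  rw [← e2, hk, map_smul, e1, Algebra.algebraMap_eq_smul_one]

lemma isClubPolynomial_of_isThinOutsideKer {f : K →ₗ[F] K} (hf : IsThinOutsideKer f)
    (hker : LinearMap.ker f ≠ ⊥) : IsClubPolynomial (finrank F (LinearMap.ker f)) f := by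
  obtain ⟨x₀, hx₀, hx₀0⟩ := Submodule.exists_mem_ne_zero_of_ne_bot hker
  rw [LinearMap.mem_ker] at hx₀
  have hne : (x₀, (0 : K)) ≠ 0 := fun h => hx₀0 (congrArg Prod.fst h)
  refine ⟨Projectivization.mk K (x₀, 0) hne, ⟨_, _, ?_, rfl⟩, ?_, ?_⟩
  · rw [LinearMap.mem_graph_iff]
    exact hx₀.symm
  · rw [setWeight, Projectivization.submodule_mk]
    have : f.graph ⊓ (Submodule.span K {(x₀, (0 : K))}).restrictScalars F =
        (LinearMap.ker f).map (LinearMap.inl F K K) := by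
      ext ⟨x, y⟩
      constructor
      · rintro ⟨h1, h2⟩
        obtain ⟨k, hk⟩ := Submodule.mem_span_singleton.1 h2
        have hy : y = 0 := by
          have := congrArg Prod.snd hk
          simpa using this.symm
        subst hy
        exact ⟨x, ((LinearMap.mem_graph_iff f _).1 h1).symm, rfl⟩
      · rintro ⟨z, hz, hzx⟩
        obtain ⟨rfl, rfl⟩ := Prod.mk.inj hzx
        refine ⟨(LinearMap.mem_graph_iff f _).2 (LinearMap.mem_ker.1 hz).symm, ?_⟩
        exact Submodule.mem_span_singleton.2 ⟨z / x₀, by simp [hx₀0]⟩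
    rw [this]
    exact (Submodule.equivMapOfInjective _ LinearMap.inl_injective _).finrank_eq.symm
  · rintro _ ⟨⟨x, y⟩, hxy, hmem, rfl⟩ hQ
    have hy : y = f x := (LinearMap.mem_graph_iff f _).1 hmem
    subst hy
    have hfx : f x ≠ 0 := by
      intro h
      apply hQ
      rw [Projectivization.mk_eq_mk_iff']
      exact ⟨x / x₀, by simp [hx₀0, h]⟩
    rw [setWeight, Projectivization.submodule_mk]
    have : f.graph ⊓ (Submodule.span K {(x, f x)}).restrictScalars F =
        Submodule.span F {(x, f x)} := by
      refine le_antisymm ?_ ?_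
      · rintro ⟨z, w⟩ ⟨h1, h2⟩
        have hw : w = f z := (LinearMap.mem_graph_iff f _).1 h1
        subst hw
        obtain ⟨k, hk⟩ := Submodule.mem_span_singleton.1 h2
        obtain ⟨e1, e2⟩ := Prod.mk.inj hk
        replace e1 : k * x = z := e1
        replace e2 : k * f x = f z := e2
        obtain ⟨s, rfl⟩ := hf x z hfx (by
          linear_combination f x * e1 - x * e2)
        exact Submodule.mem_span_singleton.2 ⟨s, by simp⟩
      · rw [Submodule.span_singleton_le_iff_mem]
        exact ⟨hmem, Submodule.mem_span_singleton_self _⟩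
    rw [this, finrank_span_singleton hxy]

variable [FiniteDimensional F K]

/-- The subspace of dimension `n - 2` orthogonal to `θ` and `θ b` is the sum of an `F(b)`-subspace
and of the span of a geometric progression. -/
lemma exists_decomposition [Algebra.IsSeparable F K] {b θ : K} (hθ : θ ≠ 0)
    {S₀ : Submodule F K} (hS₀ : finrank F S₀ + 2 = finrank F K)
    (hb : 2 ≤ finrank F F⟮b⟯)
    (hle : ∀ x, x ∈ S₀ ↔ Algebra.trace F K (θ * x) = 0 ∧ Algebra.trace F K (θ * (b * x)) = 0) :
    ∃ (c : K) (S : Submodule F⟮b⟯ K), c ≠ 0 ∧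
      finrank F F⟮b⟯ * (finrank F⟮b⟯ S + 1) = finrank F K ∧
      Disjoint (S.restrictScalars F)
        (Submodule.span F ((fun i : ℕ => c * b ^ i) '' Set.Iio (finrank F F⟮b⟯ - 2))) ∧
      S₀ = S.restrictScalars F ⊔
        Submodule.span F ((fun i : ℕ => c * b ^ i) '' Set.Iio (finrank F F⟮b⟯ - 2)) := by
  set t := finrank F F⟮b⟯ with ht
  have : Algebra.IsSeparable F⟮b⟯ K := Algebra.isSeparable_tower_top_of_isSeparable F F⟮b⟯ K
  let g : K →ₗ[F⟮b⟯] F⟮b⟯ := Algebra.trace F⟮b⟯ K ∘ₗ LinearMap.mulLeft F⟮b⟯ θ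
  have hg : ∀ x, g x = Algebra.trace F⟮b⟯ K (θ * x) := fun _ => rfl
  have hgt : ∀ x, Algebra.trace F F⟮b⟯ (g x) = Algebra.trace F K (θ * x) := fun x => by
    rw [hg, Algebra.trace_trace]
  let b' : F⟮b⟯ := AdjoinSimple.gen F b
  have hb' : ∀ (i : ℕ) (x : K), b ^ i * x = (b' ^ i) • x := fun i x => by
    rw [Algebra.smul_def, map_pow, AdjoinSimple.algebraMap_gen]
  have hgsurj : Function.Surjective g :=
    (Algebra.trace_surjective F⟮b⟯ K).comp (mul_left_surjective₀ hθ)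
  set S : Submodule F⟮b⟯ K := LinearMap.ker g with hS
  have hSrank : finrank F⟮b⟯ S + 1 = finrank F⟮b⟯ K := by
    have := g.finrank_range_add_finrank_ker
    rw [LinearMap.range_eq_top.2 hgsurj, finrank_top, finrank_self, ← hS] at this
    omega
  have hdim : t * (finrank F⟮b⟯ S + 1) = finrank F K := by
    rw [hSrank, ht, finrank_mul_finrank]
  obtain ⟨l, hl0, hl⟩ : ∃ l : F⟮b⟯, l ≠ 0 ∧ ∀ i < t - 1, Algebra.trace F F⟮b⟯ (b' ^ i * l) = 0 := by
    let h : F⟮b⟯ →ₗ[F] (Fin (t - 1) → F) :=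
      LinearMap.pi fun i => Algebra.trace F F⟮b⟯ ∘ₗ LinearMap.mulLeft F (b' ^ (i : ℕ))
    have hker : LinearMap.ker h ≠ ⊥ := by
      intro hbot
      have := LinearMap.finrank_le_finrank_of_injective (LinearMap.ker_eq_bot.1 hbot)
      rw [finrank_fin_fun] at this
      omega
    obtain ⟨l, hl, hl0⟩ := Submodule.exists_mem_ne_zero_of_ne_bot hker
    exact ⟨l, hl0, fun i hi => congrFun (LinearMap.mem_ker.1 hl) ⟨i, hi⟩⟩
  obtain ⟨c, hc⟩ := hgsurj l
  have hcS : c ∉ S := by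
    intro h
    rw [LinearMap.mem_ker.1 h] at hc
    exact hl0 hc.symm
  have hc0 : c ≠ 0 := fun h => hcS (h ▸ S.zero_mem)
  set T := Submodule.span F ((fun i : ℕ => c * b ^ i) '' Set.Iio (t - 2)) with hT
  have hTmem : ∀ x ∈ T, ∃ y : F⟮b⟯, x = y • c := by
    intro x hx
    have hle : T ≤ LinearMap.range ((LinearMap.toSpanSingleton F⟮b⟯ K c).restrictScalars F) := by
      rw [hT, Submodule.span_le]
      rintro _ ⟨i, -, rfl⟩
      exact ⟨b' ^ i, by simp [← hb', mul_comm]⟩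
    obtain ⟨y, hy⟩ := hle hx
    exact ⟨y, hy.symm⟩
  have hdis : Disjoint (S.restrictScalars F) T := by
    rw [Submodule.disjoint_def]
    intro x hxS hxT
    obtain ⟨y, rfl⟩ := hTmem x hxT
    by_contra hne
    have hy : y ≠ 0 := fun h => hne (by rw [h, zero_smul])
    refine hcS ?_
    have := S.smul_mem y⁻¹ hxS
    rwa [smul_smul, inv_mul_cancel₀ hy, one_smul] at this
  have hTrank : finrank F T = t - 2 := by
    have hli : LinearIndependent F (fun i : Fin (t - 2) => c * b ^ (i : ℕ)) := by
      have h1 := linearIndependent_pow (K := F) b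
      have h2 : t - 2 ≤ (minpoly F b).natDegree := by
        rw [← adjoin.finrank (Algebra.IsIntegral.isIntegral b)]
        omega
      have h3 := h1.comp (Fin.castLE h2) (Fin.castLE_injective h2)
      exact h3.map' (LinearMap.mulLeft F c) (LinearMap.ker_eq_bot.2 (mul_right_injective₀ hc0))
    have hrange : (fun i : ℕ => c * b ^ i) '' Set.Iio (t - 2) =
        Set.range (fun i : Fin (t - 2) => c * b ^ (i : ℕ)) := by
      ext x
      constructor
      · rintro ⟨i, hi, rfl⟩
        exact ⟨⟨i, hi⟩, rfl⟩
      · rintro ⟨i, rfl⟩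
        exact ⟨i, i.2, rfl⟩
    rw [hT, hrange, finrank_span_eq_card hli, Fintype.card_fin]
  refine ⟨c, S, hc0, hdim, hdis, (Submodule.eq_of_le_of_finrank_eq ?_ ?_).symm⟩
  · refine sup_le ?_ ?_
    · intro x hx
      have hx0 : g x = 0 := hx
      rw [hle, ← hgt, ← hgt, hx0, map_zero]
      have h1 := hb' 1 x
      rw [pow_one, pow_one] at h1
      rw [h1, map_smul, hx0, smul_zero, map_zero]
      exact ⟨rfl, rfl⟩
    · rw [Submodule.span_le]
      rintro _ ⟨i, hi, rfl⟩
      have hi' : i < t - 2 := hi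
      have h1 : ∀ j, g (b ^ j * c) = b' ^ j * l := fun j => by
        rw [hb', map_smul, hc, smul_eq_mul]
      show c * b ^ i ∈ S₀
      rw [hle, ← hgt, ← hgt, mul_comm c, ← mul_assoc, ← pow_succ', h1, h1]
      exact ⟨hl i (by omega), hl (i + 1) (by omega)⟩
  · have h1 := Submodule.finrank_sup_add_finrank_inf_eq (S.restrictScalars F) T
    have h2 : finrank F (S.restrictScalars F) = t * finrank F⟮b⟯ S :=
      (finrank_mul_finrank F F⟮b⟯ S).symm
    rw [disjoint_iff.1 hdis, finrank_bot, hTrank, h2] at h1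
    rw [mul_add] at hdim
    rw [← hT]
    omega

lemma two_le_finrank_adjoin {b : K} (hb : b ∉ Set.range (algebraMap F K)) :
    2 ≤ finrank F F⟮b⟯ := by
  have h0 : 0 < finrank F F⟮b⟯ := finrank_pos
  have h1 : finrank F F⟮b⟯ ≠ 1 := by
    rw [Ne, finrank_adjoin_simple_eq_one_iff, mem_bot]
    exact hb
  omega

variable {f : K →ₗ[F] K} {b : K}

lemma exists_smul_of_comb_eq_zero {g : K →ₗ[F] K} (hg : finrank F (LinearMap.ker g) ≤ 1) {x y : K}
    (hx0 : x ≠ 0) (hx : g x = 0) (hy : g y = 0) : ∃ s : F, y = s • x := by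
  have hx' : (⟨x, hx⟩ : LinearMap.ker g) ≠ 0 := fun h => hx0 (congrArg Subtype.val h)
  have h1 : finrank F (LinearMap.ker g) = 1 := by
    have : 0 < finrank F (LinearMap.ker g) := by
      have : Nontrivial (LinearMap.ker g) := ⟨_, _, hx'⟩
      exact finrank_pos
    omega
  obtain ⟨s, hs⟩ := (finrank_eq_one_iff_of_nonzero' _ hx').1 h1 ⟨y, hy⟩
  exact ⟨s, (congrArg Subtype.val hs).symm⟩

lemma isThinOutsideKer (h : ∀ c d : K, c ≠ 0 → finrank F K - 1 ≤ combRank f c d) :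
    IsThinOutsideKer f := by
  intro x y hx hxy
  have hx0 : x ≠ 0 := by
    rintro rfl
    exact hx (map_zero f)
  have h1 := combRank_add_finrank_ker f (f x) (-x)
  have h2 := h (f x) (-x) hx
  have h3 : 0 < finrank F K := finrank_pos
  refine exists_smul_of_comb_eq_zero (g := comb f (f x) (-x)) (by omega) hx0 ?_ ?_
  · rw [comb_apply]
    ring
  · rw [comb_apply]
    linear_combination -hxy

lemma finrank_ker_add_two (hb : LinearIndependent F ![1, b])
    (hr : LinearMap.range f = Submodule.span F (Set.range ![1, b])) :
    finrank F (LinearMap.ker f) + 2 = finrank F K := by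
  have := f.finrank_range_add_finrank_ker
  rw [hr, finrank_span_eq_card hb, Fintype.card_fin] at this
  omega

/-- The kernel of a map of rank two defining a club. -/
lemma exists_trace_of_isThinOutsideKer [Algebra.IsSeparable F K]
    (hb : LinearIndependent F ![1, b])
    (hr : LinearMap.range f = Submodule.span F (Set.range ![1, b])) (hf : IsThinOutsideKer f) :
    ∃ θ : K, θ ≠ 0 ∧ ∀ x, x ∈ LinearMap.ker f ↔
      Algebra.trace F K (θ * x) = 0 ∧ Algebra.trace F K (θ * (b * x)) = 0 := by
  obtain ⟨x₁, hx₁⟩ : ∃ x, f x = 1 := by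
    rw [← LinearMap.mem_range, hr]
    exact Submodule.subset_span ⟨0, rfl⟩
  obtain ⟨x₂, hx₂⟩ : ∃ x, f x = b := by
    rw [← LinearMap.mem_range, hr]
    exact Submodule.subset_span ⟨1, rfl⟩
  set S₀ := LinearMap.ker f with hS₀
  have hne : S₀ ⊔ S₀.map (LinearMap.mulLeft F b) ≠ ⊤ := by
    intro htop
    have hmem : x₂ - b * x₁ ∈ S₀ ⊔ S₀.map (LinearMap.mulLeft F b) := by
      rw [htop]
      trivial
    obtain ⟨s, hs, _, ⟨s', hs', rfl⟩, hss⟩ := Submodule.mem_sup.1 hmem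
    exact hf.sub_mul_ne hb hx₁ hx₂ hs hs' hss.symm
  obtain ⟨φ, hφ0, hφ⟩ := Submodule.exists_le_ker_of_lt_top _ (lt_top_iff_ne_top.2 hne)
  obtain ⟨θ, hθ⟩ := exists_eq_trace_mul φ
  have hθ0 : θ ≠ 0 := by
    rintro rfl
    exact hφ0 (LinearMap.ext fun x => by simp [hθ])
  refine ⟨θ, hθ0, ?_⟩
  let S₁ := (Algebra.traceForm F K).orthogonal (Submodule.span F {θ, θ * b})
  have hS₁ : ∀ x, x ∈ S₁ ↔
      Algebra.trace F K (θ * x) = 0 ∧ Algebra.trace F K (θ * (b * x)) = 0 := by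
    intro x
    rw [← mul_assoc, ← forall_mem_span_pair_trace_mul]
    rfl
  have hθb : LinearIndependent F ![θ, θ * b] := by
    have := hb.map' (LinearMap.mulLeft F θ) (LinearMap.ker_eq_bot.2 (mul_right_injective₀ hθ0))
    have hv : ![θ, θ * b] = LinearMap.mulLeft F θ ∘ ![1, b] := by
      ext i
      fin_cases i <;> simp
    rwa [hv]
  have hrank : finrank F (Submodule.span F {θ, θ * b}) = 2 := by
    have := finrank_span_eq_card hθb
    rwa [Matrix.range_cons_cons_empty, Fintype.card_fin] at this
  have hS₁rank : finrank F S₁ = finrank F K - 2 := by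
    rw [LinearMap.BilinForm.finrank_orthogonal (traceForm_nondegenerate F K), hrank]
  have heq : S₀ = S₁ := by
    refine Submodule.eq_of_le_of_finrank_eq (fun x hx => ?_) ?_
    · rw [hS₁, ← hθ, ← hθ]
      exact ⟨hφ (Submodule.mem_sup_left hx), hφ (Submodule.mem_sup_right ⟨x, hx, rfl⟩)⟩
    · have := finrank_ker_add_two hb hr
      rw [← hS₀] at this
      omega
  intro x
  rw [heq, hS₁]

lemma exists_eq_Tr_add_mul_Tr [Algebra.IsSeparable F K]
    (hb : LinearIndependent F ![1, b])
    (hr : LinearMap.range f = Submodule.span F (Set.range ![1, b])) :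
    ∃ ξ η : K, ∀ x, f x = Tr F (ξ * x) + b * Tr F (η * x) := by
  obtain ⟨ξ, hξ⟩ := exists_eq_sum_Tr_mul hb f fun x => by
    rw [← hr]
    exact LinearMap.mem_range_self f x
  refine ⟨ξ 0, ξ 1, fun x => ?_⟩
  rw [hξ, Fin.sum_univ_two]
  simp [mul_comm]

lemma isTraceClubForm_of_isThinOutsideKer [Algebra.IsSeparable F K]
    (hb : LinearIndependent F ![1, b])
    (hr : LinearMap.range f = Submodule.span F (Set.range ![1, b])) (hf : IsThinOutsideKer f) :
    IsTraceClubForm f := by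
  have hbF := notMem_range_of_linearIndependent hb
  obtain ⟨θ, hθ0, hθ⟩ := exists_trace_of_isThinOutsideKer hb hr hf
  obtain ⟨c, S, hc0, hdim, hdis, hS⟩ := exists_decomposition hθ0 (finrank_ker_add_two hb hr)
    (two_le_finrank_adjoin hbF) hθ
  obtain ⟨ξ, η, hξη⟩ := exists_eq_Tr_add_mul_Tr hb hr
  refine ⟨b, ξ, η, c, hbF, ?_, ?_, hc0, hξη, S, hdim, hdis, fun x => ?_⟩
  · rintro rfl
    obtain ⟨x, hx⟩ : (1 : K) ∈ LinearMap.range f := by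
      rw [hr]
      exact Submodule.subset_span ⟨0, rfl⟩
    rw [hξη, zero_mul, mul_comm b, Tr_mul, Tr, map_zero, map_zero, zero_add] at hx
    have := LinearIndependent.pair_iff.1 hb (-1) (Algebra.trace F K (η * x)) (by
      rw [hx]
      simp)
    simp at this
  · rintro rfl
    obtain ⟨x, hx⟩ : b ∈ LinearMap.range f := by
      rw [hr]
      exact Submodule.subset_span ⟨1, rfl⟩
    rw [hξη, zero_mul, Tr, Tr, map_zero, map_zero, mul_zero, add_zero] at hx
    exact hbF ⟨_, hx⟩
  · rw [← hS, forall_mem_span_pair_trace_mul, LinearMap.mem_ker, hξη,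
      Tr_add_mul_Tr_eq_zero_iff hb]

end Clubs

section Frobenius

variable (F : Type*) {K : Type*} [Field F] [Field K] [Algebra F K] [Finite F]

/-- The Frobenius map `x ↦ x ^ q` over `F`. -/
noncomputable def frob : K →ₐ[F] K :=
  letI := Fintype.ofFinite F
  FiniteField.frobeniusAlgHom F K

lemma frob_apply (x : K) : frob F x = x ^ Nat.card F := by
  let := Fintype.ofFinite F
  rw [← Fintype.card_eq_nat_card]
  rfl

lemma frob_iterate (k : ℕ) (x : K) : (frob F)^[k] x = x ^ (Nat.card F ^ k) := by
  induction k with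
  | zero => simp
  | succ k ih => rw [Function.iterate_succ_apply', ih, frob_apply, ← pow_mul, pow_succ]

lemma frob_injective : Function.Injective (frob F : K →ₐ[F] K) :=
  RingHom.injective (frob F : K →ₐ[F] K).toRingHom

lemma pow_card_pow_finrank [FiniteDimensional F K] (x : K) :
    x ^ (Nat.card F ^ finrank F K) = x := by
  have : Finite K := Module.finite_of_finite F
  have := Fintype.ofFinite K
  rw [← Module.natCard_eq_pow_finrank, ← Fintype.card_eq_nat_card, FiniteField.pow_card]

variable {F}

/-- A subspace consisting of roots of a polynomial of degree at most `q ^ k` has dimension at most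
`k`. -/
lemma finrank_le_of_eval_eq_zero [FiniteDimensional F K] {M : Submodule F K} {P : Polynomial K}
    {k : ℕ} (hP : P ≠ 0) (hdeg : P.natDegree ≤ Nat.card F ^ k) (hM : ∀ x ∈ M, P.eval x = 0) :
    finrank F M ≤ k := by
  classical
  have hsub : (M : Set K) ⊆ P.roots.toFinset := by
    intro x hx
    simpa [hP] using hM x hx
  have h1 := Set.ncard_le_ncard hsub (Finset.finite_toSet _)
  rw [Set.ncard_coe_finset] at h1
  have h2 : (M : Set K).ncard = Nat.card F ^ finrank F M := by
    rw [← Module.natCard_eq_pow_finrank]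
    rfl
  have h3 : Nat.card F ^ finrank F M ≤ Nat.card F ^ k :=
    h2 ▸ h1.trans ((Multiset.toFinset_card_le _).trans ((Polynomial.card_roots' P).trans hdeg))
  exact (Nat.pow_le_pow_iff_right Finite.one_lt_card).1 h3

lemma mem_range_algebraMap_of_pow_card_eq [FiniteDimensional F K] {x : K}
    (hx : x ^ Nat.card F = x) : x ∈ Set.range (algebraMap F K) := by
  have hq : 1 < Nat.card F := Finite.one_lt_card
  let L : Submodule F K := LinearMap.ker ((frob F).toLinearMap - LinearMap.id : K →ₗ[F] K)
  have hL : ∀ x, x ∈ L ↔ x ^ Nat.card F = x := by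
    intro x
    rw [LinearMap.mem_ker, LinearMap.sub_apply, sub_eq_zero, ← frob_apply]
    rfl
  have hrank : finrank F L ≤ 1 := by
    refine finrank_le_of_eval_eq_zero (FiniteField.X_pow_card_sub_X_ne_zero K hq)
      ((FiniteField.X_pow_card_sub_X_natDegree_eq K hq).trans (pow_one _).symm).le fun x hx => ?_
    rw [Polynomial.eval_sub, Polynomial.eval_pow, Polynomial.eval_X, (hL x).1 hx, sub_self]
  have heq := Submodule.eq_of_le_of_finrank_le
    ((Submodule.span_singleton_le_iff_mem 1 L).2 ((hL 1).2 (one_pow _))) (by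
      rw [finrank_span_singleton one_ne_zero]
      exact hrank)
  obtain ⟨s, hs⟩ := Submodule.mem_span_singleton.1 (heq ▸ (hL x).2 hx)
  exact ⟨s, by rw [← hs, Algebra.algebraMap_eq_smul_one]⟩

/-- The subspace of the elements fixed by `x ↦ x ^ (q ^ 2)` is spanned by `1` and any other
element `a` that is not in `F`. -/
lemma mem_span_pair_iff_pow_eq [FiniteDimensional F K] {a : K} (ha : LinearIndependent F ![1, a])
    (haq : a ^ (Nat.card F ^ 2) = a) (x : K) :
    x ∈ Submodule.span F (Set.range ![1, a]) ↔ x ^ (Nat.card F ^ 2) = x := by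
  have hq : 1 < Nat.card F := Finite.one_lt_card
  let L : Submodule F K := LinearMap.ker
    ((frob F).toLinearMap ∘ₗ (frob F).toLinearMap - LinearMap.id : K →ₗ[F] K)
  have hL : ∀ x, x ∈ L ↔ x ^ (Nat.card F ^ 2) = x := by
    intro x
    rw [LinearMap.mem_ker, LinearMap.sub_apply, sub_eq_zero, ← frob_iterate]
    rfl
  have hle : Submodule.span F (Set.range ![1, a]) ≤ L := by
    rw [Submodule.span_le]
    rintro _ ⟨i, rfl⟩
    rw [SetLike.mem_coe, hL]
    fin_cases i
    · exact one_pow _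
    · exact haq
  have hrank : finrank F L ≤ 2 := by
    have hq2 : 1 < Nat.card F ^ 2 := Nat.one_lt_pow two_ne_zero hq
    refine finrank_le_of_eval_eq_zero (FiniteField.X_pow_card_sub_X_ne_zero K hq2)
      (FiniteField.X_pow_card_sub_X_natDegree_eq K hq2).le fun x hx => ?_
    rw [Polynomial.eval_sub, Polynomial.eval_pow, Polynomial.eval_X, (hL x).1 hx, sub_self]
  have heq := Submodule.eq_of_le_of_finrank_le hle (by
    rw [finrank_span_eq_card ha, Fintype.card_fin]
    exact hrank)
  rw [heq, hL]

end Frobenius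

section RankFour

variable {F K : Type*} [Field F] [Field K] [Algebra F K] [FiniteDimensional F K]

lemma isDualBasisForm_of_apply [Algebra.IsSeparable F K] (h4 : finrank F K = 4) {e : Fin 4 → K}
    (he : LinearIndependent F e) {b : K} {f : K →ₗ[F] K} (h0 : f (e 0) = 0) (h1 : f (e 1) = 0)
    (h2 : f (e 2) = 1) (h3 : f (e 3) = b) : IsDualBasisForm e b f := by
  have hspan : Submodule.span F (Set.range e) = ⊤ :=
    he.span_eq_top_of_card_eq_finrank (by rw [h4, Fintype.card_fin])
  obtain ⟨ξ, hξ⟩ := exists_eq_sum_Tr_mul he LinearMap.id fun x => by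
    rw [hspan]
    trivial
  simp only [LinearMap.id_apply, Tr_mul] at hξ
  refine ⟨he, ξ, fun i j => ?_, fun x => ?_⟩
  · have h := Fintype.linearIndependent_iff.1 he
      (fun k => Algebra.trace F K (ξ k * e i) - if i = k then 1 else 0) (by
        simp only [sub_smul, Finset.sum_sub_distrib, ite_smul, one_smul, zero_smul,
          Finset.sum_ite_eq, Finset.mem_univ, if_true]
        rw [← hξ, sub_self]) j
    rw [mul_comm]
    exact sub_eq_zero.1 h
  · have h := congrArg f (hξ x)
    rw [h, map_sum, Fin.sum_univ_four]
    simp only [map_smul, h0, h1, h2, h3, smul_zero, zero_add]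
    rw [mul_comm b, Tr_mul, ← Algebra.algebraMap_eq_smul_one]
    rfl

lemma exists_linearIndependent_of_pairs [Finite F] (h4 : finrank F K = 4) {a b : K}
    (ha : LinearIndependent F ![1, a]) (hb : LinearIndependent F ![1, b]) :
    ∃ ω : K, LinearIndependent F ![1, a, ω, ω * b] := by
  have : Finite K := Module.finite_of_finite F
  set A := Submodule.span F (Set.range ![1, a])
  set B := Submodule.span F (Set.range ![1, b])
  obtain ⟨ω, hω0, hω⟩ : ∃ ω : K, ω ≠ 0 ∧ ∀ s ∈ A, ∀ t ∈ B, s = ω * t → t = 0 := by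
    by_contra! hcon
    have hsub : ({0}ᶜ : Set K) ⊆
        (fun p : K × K => p.1 / p.2) '' (((A : Set K) \ {0}) ×ˢ ((B : Set K) \ {0})) := by
      intro ω hω
      obtain ⟨s, hs, t, ht, hst, ht0⟩ := hcon ω hω
      refine ⟨(s, t), ⟨⟨hs, ?_⟩, ht, ht0⟩, ?_⟩
      · rw [Set.mem_singleton_iff]
        show s ≠ 0
        rw [hst]
        exact mul_ne_zero hω ht0
      · show s / t = ω
        rw [hst, mul_div_cancel_right₀ _ ht0]
    have h1 := (Set.ncard_le_ncard hsub (Set.toFinite _)).trans Set.ncard_image_le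
    have hA : (A : Set K).ncard = Nat.card F ^ 2 := by
      have h : Nat.card A = Nat.card F ^ finrank F A := Module.natCard_eq_pow_finrank
      rwa [finrank_span_eq_card ha, Fintype.card_fin] at h
    have hB : (B : Set K).ncard = Nat.card F ^ 2 := by
      have h : Nat.card B = Nat.card F ^ finrank F B := Module.natCard_eq_pow_finrank
      rwa [finrank_span_eq_card hb, Fintype.card_fin] at h
    have hK : Nat.card K = Nat.card F ^ 4 := by
      rw [Module.natCard_eq_pow_finrank (K := F), h4]
    rw [Set.ncard_compl, Set.ncard_singleton, Set.ncard_prod,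
      Set.ncard_sdiff_singleton_of_mem A.zero_mem, Set.ncard_sdiff_singleton_of_mem B.zero_mem,
      hA, hB, hK] at h1
    have hq : 1 < Nat.card F ^ 2 := Nat.one_lt_pow two_ne_zero Finite.one_lt_card
    have h5 : Nat.card F ^ 4 = Nat.card F ^ 2 * Nat.card F ^ 2 := by ring
    rw [h5] at h1
    obtain ⟨m, hm⟩ := Nat.exists_eq_add_of_lt hq
    rw [hm] at h1
    have h6 : (1 + m + 1) * (1 + m + 1) - 1 = m * m + 4 * m + 3 := by
      have : (1 + m + 1) * (1 + m + 1) = m * m + 4 * m + 4 := by ring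
      omega
    have h7 : (1 + m + 1 - 1) * (1 + m + 1 - 1) = m * m + 2 * m + 1 := by
      have : 1 + m + 1 - 1 = m + 1 := by omega
      rw [this]
      ring
    rw [h6, h7] at h1
    omega
  refine ⟨ω, Fintype.linearIndependent_iff.2 fun g hg => ?_⟩
  rw [Fin.sum_univ_four] at hg
  replace hg : g 0 • (1 : K) + g 1 • a + g 2 • ω + g 3 • (ω * b) = 0 := hg
  have hmem : ∀ (v s t), s • (1 : K) + t • v ∈ Submodule.span F (Set.range ![1, v]) :=
    fun v s t => Submodule.add_mem _
      (Submodule.smul_mem _ _ (Submodule.subset_span ⟨0, rfl⟩))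
      (Submodule.smul_mem _ _ (Submodule.subset_span ⟨1, rfl⟩))
  have ht := hω _ (hmem a (g 0) (g 1)) _ (hmem b (-g 2) (-g 3)) (by
    simp only [Algebra.smul_def, map_neg] at hg ⊢
    linear_combination hg)
  obtain ⟨e2, e3⟩ := LinearIndependent.pair_iff.1 hb _ _ ht
  rw [neg_eq_zero] at e2 e3
  rw [e2, e3, zero_smul, zero_smul, add_zero, add_zero] at hg
  obtain ⟨e0, e1⟩ := LinearIndependent.pair_iff.1 ha _ _ hg
  intro i
  fin_cases i
  · exact e0
  · exact e1
  · exact e2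
  · exact e3

lemma exists_basis_vectors_of_finrank_eq_two {M : Submodule F K} (hM : finrank F M = 2) :
    ∃ u ∈ M, ∃ v ∈ M, (∀ s t : F, s • u + t • v = 0 → s = 0 ∧ t = 0) ∧
      ∀ x ∈ M, ∃ s t : F, x = s • u + t • v := by
  have B : Basis (Fin 2) F M := finBasisOfFinrankEq F M hM
  refine ⟨B 0, (B 0).2, B 1, (B 1).2, fun s t hst => ?_, fun x hx => ?_⟩
  · have h := Fintype.linearIndependent_iff.1 B.linearIndependent ![s, t] (by
      rw [Fin.sum_univ_two]
      exact Subtype.ext hst)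
    exact ⟨h 0, h 1⟩
  · have h := congrArg Subtype.val (B.sum_repr ⟨x, hx⟩)
    rw [Fin.sum_univ_two] at h
    exact ⟨_, _, h.symm⟩

variable [Finite F] {C : Submodule K (Fin (4 + 1) → K)} {f : K →ₗ[F] K}

/-- The case of two points of weight two. -/
lemma exists_isRankFourForm_of_two_points [Algebra.IsSeparable F K] (hC : IsRepresentedBy C f)
    (h4 : finrank F K = 4) {a b c d : K} (hdet : a * d - b * c ≠ 0) (hab : combRank f a b = 2)
    (hcd : combRank f c d = 2)
    (hone : ∃ x : K, x ≠ 0 ∧ ∀ y, x * f y = y * f x → ∃ s : F, y = s • x) :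
    ∃ g : K →ₗ[F] K, IsRankFourForm g ∧ IsRepresentedBy C g := by
  set k₁ := comb f a b with hk₁
  set k₂ := comb f c d with hk₂
  have hN₁ : finrank F (LinearMap.ker k₁) = 2 := by
    have := combRank_add_finrank_ker f a b
    rw [← hk₁] at this
    omega
  have hN₂ : finrank F (LinearMap.ker k₂) = 2 := by
    have := combRank_add_finrank_ker f c d
    rw [← hk₂] at this
    omega
  have hzero : ∀ x, k₁ x = 0 → k₂ x = 0 → x = 0 := by
    intro x h1 h2
    rw [hk₁, comb_apply] at h1
    rw [hk₂, comb_apply] at h2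
    have : (a * d - b * c) * x = 0 := by linear_combination d * h1 - b * h2
    exact (mul_eq_zero.1 this).resolve_left hdet
  have hsup : LinearMap.ker k₂ ⊔ LinearMap.ker k₁ = ⊤ := by
    apply Submodule.eq_top_of_finrank_eq
    have h1 := Submodule.finrank_sup_add_finrank_inf_eq (LinearMap.ker k₂) (LinearMap.ker k₁)
    have h2 : LinearMap.ker k₂ ⊓ LinearMap.ker k₁ = ⊥ := by
      rw [eq_bot_iff]
      rintro x ⟨hx2, hx1⟩
      exact hzero x hx1 hx2
    rw [h2, finrank_bot] at h1
    omega
  obtain ⟨p₁, hp₁, p₂, hp₂, hpli, hpspan⟩ := exists_basis_vectors_of_finrank_eq_two hN₁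
  obtain ⟨r₁, hr₁, r₂, hr₂, hrli, hrspan⟩ := exists_basis_vectors_of_finrank_eq_two hN₂
  rw [LinearMap.mem_ker] at hp₁ hp₂ hr₁ hr₂
  have hA : ∀ s t : F, s • k₁ r₁ + t • k₁ r₂ = 0 → s = 0 ∧ t = 0 := by
    intro s t hst
    refine hrli s t (hzero _ ?_ ?_)
    · rw [map_add, map_smul, map_smul, hst]
    · rw [map_add, map_smul, map_smul, hr₁, hr₂, smul_zero, smul_zero, add_zero]
  have hB : ∀ s t : F, s • k₂ p₁ + t • k₂ p₂ = 0 → s = 0 ∧ t = 0 := by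
    intro s t hst
    refine hpli s t (hzero _ ?_ ?_)
    · rw [map_add, map_smul, map_smul, hp₁, hp₂, smul_zero, smul_zero, add_zero]
    · rw [map_add, map_smul, map_smul, hst]
  have hA0 : k₁ r₁ ≠ 0 := fun h => one_ne_zero (hA 1 0 (by simp [h])).1
  have hB0 : k₂ p₁ ≠ 0 := fun h => one_ne_zero (hB 1 0 (by simp [h])).1
  set A₁ := k₁ r₁ with hA₁
  set B₁ := k₂ p₁ with hB₁
  set a' := k₁ r₂ / A₁ with ha'
  set b' := k₂ p₂ / B₁ with hb'
  have hA₂ : k₁ r₂ = a' * A₁ := (div_mul_cancel₀ _ hA0).symm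
  have hB₂ : k₂ p₂ = b' * B₁ := (div_mul_cancel₀ _ hB0).symm
  have hali : LinearIndependent F ![1, a'] := by
    rw [LinearIndependent.pair_iff]
    intro s t hst
    refine hA s t ?_
    rw [hA₂, ← one_mul A₁, ← mul_assoc, ← smul_mul_assoc, mul_one, ← smul_mul_assoc, ← add_mul,
      hst, zero_mul]
  have hbli : LinearIndependent F ![1, b'] := by
    rw [LinearIndependent.pair_iff]
    intro s t hst
    refine hB s t ?_
    rw [hB₂, ← one_mul B₁, ← mul_assoc, ← smul_mul_assoc, mul_one, ← smul_mul_assoc, ← add_mul,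
      hst, zero_mul]
  obtain ⟨ω, hω⟩ := exists_linearIndependent_of_pairs h4 hali hbli
  have hcoord : ∀ s₁ s₂ t₁ t₂ : F,
      k₁ (s₁ • r₁ + s₂ • r₂ + (t₁ • p₁ + t₂ • p₂)) = (s₁ • (1 : K) + s₂ • a') * A₁ ∧
      k₂ (s₁ • r₁ + s₂ • r₂ + (t₁ • p₁ + t₂ • p₂)) = (t₁ • (1 : K) + t₂ • b') * B₁ := by
    intro s₁ s₂ t₁ t₂
    simp only [map_add, map_smul, hp₁, hp₂, hr₁, hr₂, hA₂, hB₂, ← hA₁, ← hB₁, smul_zero, add_zero,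
      zero_add]
    simp only [Algebra.smul_def]
    constructor <;> ring
  have hexp : ∀ x, ∃ s₁ s₂ t₁ t₂ : F, x = s₁ • r₁ + s₂ • r₂ + (t₁ • p₁ + t₂ • p₂) := by
    intro x
    have hx : x ∈ LinearMap.ker k₂ ⊔ LinearMap.ker k₁ := by
      rw [hsup]
      trivial
    obtain ⟨y, hy, z, hz, rfl⟩ := Submodule.mem_sup.1 hx
    obtain ⟨s₁, s₂, rfl⟩ := hrspan y hy
    obtain ⟨t₁, t₂, rfl⟩ := hpspan z hz
    exact ⟨s₁, s₂, t₁, t₂, rfl⟩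
  set X := comb f (a / A₁ + ω * (c / B₁)) (b / A₁ + ω * (d / B₁)) with hX
  set Y := comb f (c / B₁) (d / B₁) with hY
  have hXk : ∀ x, X x = k₁ x / A₁ + ω * (k₂ x / B₁) := by
    intro x
    simp only [hX, hk₁, hk₂, comb_apply]
    ring
  have hYk : ∀ x, Y x = k₂ x / B₁ := by
    intro x
    simp only [hY, hk₂, comb_apply]
    ring
  have hinj : Function.Injective X := by
    rw [← LinearMap.ker_eq_bot, LinearMap.ker_eq_bot']
    intro x hx
    obtain ⟨s₁, s₂, t₁, t₂, rfl⟩ := hexp x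
    obtain ⟨e1, e2⟩ := hcoord s₁ s₂ t₁ t₂
    rw [hXk, e1, e2, mul_div_cancel_right₀ _ hA0, mul_div_cancel_right₀ _ hB0] at hx
    have h := Fintype.linearIndependent_iff.1 hω ![s₁, s₂, t₁, t₂] (by
      rw [Fin.sum_univ_four, ← hx]
      simp only [Matrix.cons_val, Algebra.smul_def]
      ring)
    have h0 : s₁ = 0 := h 0
    have h1 : s₂ = 0 := h 1
    have h2 : t₁ = 0 := h 2
    have h3 : t₂ = 0 := h 3
    simp [h0, h1, h2, h3]
  let e : K ≃ₗ[F] K := LinearEquiv.ofInjectiveEndo X hinj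
  let g : K →ₗ[F] K := Y ∘ₗ e.symm.toLinearMap
  have hg : ∀ x, g (X x) = Y x := by
    intro x
    show Y (e.symm (e x)) = Y x
    rw [LinearEquiv.symm_apply_apply]
  have hval : ∀ s₁ s₂ t₁ t₂ : F, g (s₁ • (1 : K) + s₂ • a' + ω * (t₁ • (1 : K) + t₂ • b')) =
      t₁ • (1 : K) + t₂ • b' := by
    intro s₁ s₂ t₁ t₂
    obtain ⟨e1, e2⟩ := hcoord s₁ s₂ t₁ t₂
    have h1 := hg (s₁ • r₁ + s₂ • r₂ + (t₁ • p₁ + t₂ • p₂))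
    rwa [hXk, hYk, e1, e2, mul_div_cancel_right₀ _ hA0, mul_div_cancel_right₀ _ hB0] at h1
  refine ⟨g, Or.inr (Or.inr (Or.inr (Or.inr ⟨a', b', ω, ?_, ?_⟩))), ?_⟩
  · rintro ⟨haq, hbq⟩
    obtain ⟨x, hx0, hx⟩ := hone
    have hLa := mem_span_pair_iff_pow_eq hali haq
    have hLb := mem_span_pair_iff_pow_eq hbli hbq
    have hmem : ∀ {v : K} {s t : F}, s • (1 : K) + t • v ∈ Submodule.span F (Set.range ![1, v]) :=
      fun {v s t} => Submodule.add_mem _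
        (Submodule.smul_mem _ _ (Submodule.subset_span ⟨0, rfl⟩))
        (Submodule.smul_mem _ _ (Submodule.subset_span ⟨1, rfl⟩))
    have hexists : ∀ {v l : K}, l ∈ Submodule.span F (Set.range ![1, v]) →
        ∃ s t : F, l = s • (1 : K) + t • v := by
      intro v l hl
      rw [Matrix.range_cons_cons_empty] at hl
      obtain ⟨s, t, hst⟩ := Submodule.mem_span_pair.1 hl
      exact ⟨s, t, hst.symm⟩
    obtain ⟨s₁, s₂, t₁, t₂, hxe⟩ := hexp x
    obtain ⟨e1, e2⟩ := hcoord s₁ s₂ t₁ t₂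
    rw [← hxe] at e1 e2
    obtain ⟨s₁', s₂', hs⟩ := hexists ((hLa (a' * (s₁ • (1 : K) + s₂ • a'))).2 (by
      rw [mul_pow, haq, (hLa _).1 hmem]))
    obtain ⟨t₁', t₂', ht⟩ := hexists ((hLb (a' * (t₁ • (1 : K) + t₂ • b'))).2 (by
      rw [mul_pow, haq, (hLb _).1 hmem]))
    obtain ⟨e1', e2'⟩ := hcoord s₁' s₂' t₁' t₂'
    set y := s₁' • r₁ + s₂' • r₂ + (t₁' • p₁ + t₂' • p₂)
    rw [← hs, mul_assoc, ← e1] at e1'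
    rw [← ht, mul_assoc, ← e2] at e2'
    obtain ⟨s, hs⟩ := hx y (by
      have hmul : (a * d - b * c) * (x * f y - y * f x) = k₁ x * k₂ y - k₁ y * k₂ x := by
        simp only [hk₁, hk₂, comb_apply]
        ring
      rw [e1', e2'] at hmul
      have : (a * d - b * c) * (x * f y - y * f x) = 0 := by
        rw [hmul]
        ring
      exact sub_eq_zero.1 ((mul_eq_zero.1 this).resolve_left hdet))
    rw [hs, map_smul, Algebra.smul_def] at e1' e2'
    have hne : algebraMap F K s - a' ≠ 0 := fun h =>
      notMem_range_of_linearIndependent hali ⟨s, sub_eq_zero.1 h⟩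
    refine hx0 (hzero x ?_ ?_)
    · exact (mul_eq_zero.1 (show (algebraMap F K s - a') * k₁ x = 0 by
        linear_combination e1')).resolve_left hne
    · exact (mul_eq_zero.1 (show (algebraMap F K s - a') * k₂ x = 0 by
        linear_combination e2')).resolve_left hne
  · refine isDualBasisForm_of_apply h4 hω ?_ ?_ ?_ ?_
    · simpa using hval 1 0 0 0
    · simpa using hval 0 1 0 0
    · simpa using hval 0 0 1 0
    · simpa using hval 0 0 0 1
  · refine hC.of_comb (f' := g) ?_ hinj hg
    have : (a / A₁ + ω * (c / B₁)) * (d / B₁) - (b / A₁ + ω * (d / B₁)) * (c / B₁) =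
        (a * d - b * c) / (A₁ * B₁) := by
      field_simp
      ring
    rw [this]
    exact div_ne_zero hdet (mul_ne_zero hA0 hB0)

end RankFour

section RankFourClubs

variable {F K : Type*} [Field F] [Field K] [Algebra F K] [FiniteDimensional F K]
  {C : Submodule K (Fin (4 + 1) → K)} {f : K →ₗ[F] K} {b : K}

/-- Clubs with `b` generating the field of order `q ^ 4`. -/
lemma exists_isDualBasisForm_of_club [Algebra.IsSeparable F K] (hC : IsRepresentedBy C f)
    (h4 : finrank F K = 4) (hb : LinearIndependent F ![1, b])
    (hr : LinearMap.range f = Submodule.span F (Set.range ![1, b])) (hf : IsThinOutsideKer f)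
    (hb4 : finrank F F⟮b⟯ = 4) {c : K} (hc0 : c ≠ 0) (hc : f c = 0) (hcb : f (c * b) = 0) :
    ∃ (g : K →ₗ[F] K) (ω : K), IsDualBasisForm ![1, b, b ^ 2 + ω, ω * b] b g ∧
      IsRepresentedBy C g := by
  obtain ⟨x₁, hx₁⟩ : ∃ x, f x = 1 := by
    rw [← LinearMap.mem_range, hr]
    exact Submodule.subset_span ⟨0, rfl⟩
  obtain ⟨x₂, hx₂⟩ : ∃ x, f x = b := by
    rw [← LinearMap.mem_range, hr]
    exact Submodule.subset_span ⟨1, rfl⟩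
  have hpow : LinearIndependent F (fun i : Fin 4 => b ^ (i : ℕ)) := by
    have h := linearIndependent_pow (K := F) b
    have h' : (minpoly F b).natDegree = 4 := by
      rw [← adjoin.finrank (Algebra.IsIntegral.isIntegral b), hb4]
    rw [h'] at h
    exact h
  have hspan := hpow.span_eq_top_of_card_eq_finrank (by rw [h4, Fintype.card_fin])
  obtain ⟨z, hz⟩ := Submodule.mem_span_range_iff_exists_fun F |>.1
    (show (x₂ - b * x₁) / c ∈ Submodule.span F (Set.range fun i : Fin 4 => b ^ (i : ℕ)) by
      rw [hspan]
      trivial)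
  rw [Fin.sum_univ_four, eq_div_iff hc0] at hz
  replace hz : (z 0 • b ^ 0 + z 1 • b ^ 1 + z 2 • b ^ 2 + z 3 • b ^ 3) * c = x₂ - b * x₁ := hz
  have hlin : ∀ s t : F, f (s • c + t • (c * b)) = 0 := by
    intro s t
    rw [map_add, map_smul, map_smul, hc, hcb, smul_zero, smul_zero, add_zero]
  have hz3 : z 3 ≠ 0 := by
    intro h
    refine hf.sub_mul_ne hb hx₁ hx₂ (hlin (z 0) (z 1)) (hlin 0 (z 2)) ?_
    rw [← hz, h]
    simp only [Algebra.smul_def, map_zero]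
    ring
  set y := algebraMap F K (z 3) with hy
  have hy0 : y ≠ 0 := by
    rw [hy, Ne, map_eq_zero]
    exact hz3
  set κ := -(1 / (c * y)) with hκ
  have hcy : c * y ≠ 0 := mul_ne_zero hc0 hy0
  have hκ0 : κ ≠ 0 := neg_ne_zero.2 (one_div_ne_zero hcy)
  have hκc : κ * (c * y) = -1 := by
    rw [hκ, neg_mul, one_div_mul_cancel hcy]
  set x₁' := x₁ + z 2 • (c * b) with hx₁'
  set x₂' := x₂ - (z 0 • c + z 1 • (c * b)) with hx₂'
  have hfx₁' : f x₁' = 1 := by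
    rw [hx₁', map_add, map_smul, hcb, smul_zero, add_zero, hx₁]
  have hfx₂' : f x₂' = b := by
    rw [hx₂', map_sub, hlin, sub_zero, hx₂]
  have hrel : x₂' - b * x₁' = c * y * b ^ 3 := by
    rw [hx₂', hx₁', hy]
    simp only [Algebra.smul_def] at hz ⊢
    linear_combination -hz
  set ω := κ * x₁' - b ^ 2 with hω
  let g : K →ₗ[F] K := f ∘ₗ LinearMap.mulLeft F κ⁻¹
  have hg : ∀ x, g (κ * x) = f x := by
    intro x
    show f (κ⁻¹ * (κ * x)) = f x
    rw [inv_mul_cancel_left₀ hκ0]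
  have hg0 : g 1 = 0 := by
    have h1 : (1 : K) = κ * (-(z 3) • c) := by
      rw [Algebra.smul_def, map_neg]
      linear_combination hκc
    rw [h1, hg, map_smul, hc, smul_zero]
  have hg1 : g b = 0 := by
    have h1 : b = κ * (-(z 3) • (c * b)) := by
      rw [Algebra.smul_def, map_neg]
      linear_combination b * hκc
    rw [h1, hg, map_smul, hcb, smul_zero]
  have hg2 : g (b ^ 2 + ω) = 1 := by
    rw [hω, add_sub_cancel, hg, hfx₁']
  have hg3 : g (ω * b) = b := by
    have h1 : ω * b = κ * x₂' := by
      rw [hω]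
      linear_combination -κ * hrel - b ^ 3 * hκc
    rw [h1, hg, hfx₂']
  refine ⟨g, ω, isDualBasisForm_of_apply h4 ?_ hg0 hg1 hg2 hg3, ?_⟩
  · refine Fintype.linearIndependent_iff.2 fun w hw => ?_
    rw [Fin.sum_univ_four] at hw
    replace hw : w 0 • (1 : K) + w 1 • b + w 2 • (b ^ 2 + ω) + w 3 • (ω * b) = 0 := hw
    have h1 := congrArg g hw
    simp only [map_add, map_smul, hg0, hg1] at h1
    rw [← map_add, hg2, hg3, smul_zero, smul_zero, zero_add, zero_add, map_zero] at h1
    obtain ⟨e2, e3⟩ := LinearIndependent.pair_iff.1 hb _ _ h1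
    rw [e2, e3, zero_smul, zero_smul, add_zero, add_zero] at hw
    obtain ⟨e0, e1⟩ := LinearIndependent.pair_iff.1 hb _ _ hw
    intro i
    fin_cases i
    · exact e0
    · exact e1
    · exact e2
    · exact e3
  · refine hC.of_comb (a := κ) (b := 0) (c := 0) (d := 1) ?_ ?_ ?_
    · rw [mul_one, mul_zero, sub_zero]
      exact hκ0
    · intro x y h
      simpa [hκ0] using h
    · intro x
      rw [comb_apply, zero_mul, add_zero, hg, comb_apply, zero_mul, zero_add, one_mul]

variable [Finite F]

lemma pow_card_sq_eq_of_finrank_adjoin_eq_two (hb : finrank F F⟮b⟯ = 2) :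
    b ^ (Nat.card F ^ 2) = b := by
  have h := pow_card_pow_finrank F (AdjoinSimple.gen F b)
  rw [hb] at h
  have := congrArg (algebraMap F⟮b⟯ K) h
  rwa [map_pow, AdjoinSimple.algebraMap_gen] at this

/-- Clubs with `b` in the field of order `q ^ 2`. -/
lemma isRepresentedBy_frob_sub (hC : IsRepresentedBy C f) (h4 : finrank F K = 4)
    (hb : LinearIndependent F ![1, b])
    (hr : LinearMap.range f = Submodule.span F (Set.range ![1, b])) (hf : IsThinOutsideKer f)
    (hbq : b ^ (Nat.card F ^ 2) = b) (hker : ∀ x, f x = 0 → f (b * x) = 0) :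
    IsRepresentedBy C ((frob F).toLinearMap -
      (frob F).toLinearMap ∘ₗ (frob F).toLinearMap ∘ₗ (frob F).toLinearMap : K →ₗ[F] K) := by
  set q := Nat.card F with hq
  set φ : K →ₗ[F] K := (frob F).toLinearMap -
      (frob F).toLinearMap ∘ₗ (frob F).toLinearMap ∘ₗ (frob F).toLinearMap with hφ
  have hφa : ∀ x, φ x = x ^ q - x ^ (q ^ 3) := by
    intro x
    rw [hφ, hq, ← frob_apply, ← frob_iterate]
    rfl
  have hbF := notMem_range_of_linearIndependent hb
  have hbq1 : b - b ^ q ≠ 0 := fun h =>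
    hbF (mem_range_algebraMap_of_pow_card_eq (sub_eq_zero.1 h).symm)
  have hL := mem_span_pair_iff_pow_eq hb hbq
  obtain ⟨x₁, hx₁⟩ : ∃ x, f x = 1 := by
    rw [← LinearMap.mem_range, hr]
    exact Submodule.subset_span ⟨0, rfl⟩
  obtain ⟨x₂, hx₂⟩ : ∃ x, f x = b := by
    rw [← LinearMap.mem_range, hr]
    exact Submodule.subset_span ⟨1, rfl⟩
  have hrank := finrank_ker_add_two hb hr
  obtain ⟨c, hc, hc0⟩ : ∃ c, f c = 0 ∧ c ≠ 0 := by
    have hne : LinearMap.ker f ≠ ⊥ := by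
      intro h
      rw [h, finrank_bot] at hrank
      omega
    obtain ⟨c, hc, hc0⟩ := Submodule.exists_mem_ne_zero_of_ne_bot hne
    exact ⟨c, hc, hc0⟩
  have hkerc : LinearMap.ker f =
      (Submodule.span F (Set.range ![1, b])).map (LinearMap.mulLeft F c) := by
    refine (Submodule.eq_of_le_of_finrank_eq ?_ ?_).symm
    · rw [Submodule.map_span, Submodule.span_le]
      rintro _ ⟨_, ⟨i, rfl⟩, rfl⟩
      fin_cases i
      · simpa using hc
      · simpa [mul_comm] using hker c hc
    · rw [← (Submodule.equivMapOfInjective _ (mul_right_injective₀ hc0) _).finrank_eq,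
        finrank_span_eq_card hb, Fintype.card_fin]
      omega
  have hmemker : ∀ x, f x = 0 ↔ (x / c) ^ (q ^ 2) = x / c := by
    intro x
    rw [← hL, ← LinearMap.mem_ker, hkerc]
    constructor
    · rintro ⟨y, hy, rfl⟩
      rwa [LinearMap.mulLeft_apply, mul_div_cancel_left₀ _ hc0]
    · intro h
      exact ⟨x / c, h, mul_div_cancel₀ _ hc0⟩
  set m := (b ^ q * x₁ - x₂) / (b - b ^ q) with hm
  set X₁ := (x₁ + m) / c with hX₁
  have hmul : m * (b - b ^ q) = b ^ q * x₁ - x₂ := div_mul_cancel₀ _ hbq1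
  have hX₂ : (x₂ + m * b) / c = b ^ q * X₁ := by
    rw [hX₁, ← mul_div_assoc]
    congr 1
    linear_combination hmul
  set κ := φ X₁ with hκ
  have hκ0 : κ ≠ 0 := by
    intro h
    rw [hκ, hφa, sub_eq_zero, pow_succ, pow_mul] at h
    have h1 : X₁ ^ (q ^ 2) = X₁ := by
      have h2 : frob F (X₁ ^ (q ^ 2)) = frob F X₁ := by
        rw [frob_apply, frob_apply, ← hq, h]
      exact (frob F).injective h2
    have h3 : (b - b ^ q) ^ (q ^ 2) = b - b ^ q := by
      rw [hq, ← frob_iterate, Function.iterate_succ_apply, Function.iterate_one, map_sub, map_sub]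
      have e : (b ^ q) ^ q = b := by rw [← pow_mul, ← pow_two, hbq]
      simp only [frob_apply, ← hq, e]
    have h5 : f (c * ((b - b ^ q) * X₁)) = 0 := by
      rw [hmemker, mul_div_cancel_left₀ _ hc0, mul_pow, h1, h3]
    refine hf.sub_mul_ne hb hx₁ hx₂ (s := -(c * ((b - b ^ q) * X₁))) (s' := 0)
      (by rw [map_neg, h5, neg_zero]) (map_zero f) ?_
    have h6 : c * X₁ = x₁ + m := mul_div_cancel₀ _ hc0
    linear_combination (b - b ^ q) * h6 + hmul
  have hfX : ∀ x, φ (comb f (1 / c) (m / c) x) = κ * f x := by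
    intro x
    have hfx : f x ∈ Submodule.span F (Set.range ![1, b]) := by
      rw [← hr]
      exact LinearMap.mem_range_self f x
    rw [Matrix.range_cons_cons_empty] at hfx
    obtain ⟨s, t, hst⟩ := Submodule.mem_span_pair.1 hfx
    have hker0 : f (x - s • x₁ - t • x₂) = 0 := by
      rw [map_sub, map_sub, map_smul, map_smul, hx₁, hx₂, ← hst]
      ring
    have hφker : ∀ y, f y = 0 → φ (comb f (1 / c) (m / c) y) = 0 := by
      intro y hy
      rw [comb_apply, hy, mul_zero, add_zero, one_div_mul_eq_div, hφa, pow_succ, pow_mul,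
        (hmemker y).1 hy, sub_self]
    have hφ1 : φ (comb f (1 / c) (m / c) x₁) = κ := by
      rw [comb_apply, hx₁, hκ, hX₁]
      congr 1
      ring
    have hφ2 : φ (comb f (1 / c) (m / c) x₂) = κ * b := by
      have : comb f (1 / c) (m / c) x₂ = b ^ q * X₁ := by
        rw [← hX₂, comb_apply, hx₂]
        ring
      have hb4 : b ^ (q ^ 4) = b := by
        have := pow_card_pow_finrank F b
        rwa [h4] at this
      rw [this, hφa, hκ, hφa, mul_pow, mul_pow, ← pow_mul, ← pow_mul, ← pow_two, ← pow_succ', hbq,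
        hb4]
      ring
    have hx : x = (x - s • x₁ - t • x₂) + s • x₁ + t • x₂ := by ring
    rw [hx, map_add, map_add, map_add, map_add, map_smul, map_smul, map_smul, map_smul, hφ1, hφ2,
      hφker _ hker0, ← hx, ← hst]
    simp only [Algebra.smul_def]
    ring
  refine hC.of_comb (a := 1 / c) (b := m / c) (c := 0) (d := κ) ?_ ?_ ?_
  · rw [mul_zero, sub_zero]
    exact mul_ne_zero (one_div_ne_zero hc0) hκ0
  · rw [← LinearMap.ker_eq_bot, LinearMap.ker_eq_bot']
    intro x hx
    have h1 := hfX x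
    rw [hx, map_zero, eq_comm, mul_eq_zero, or_iff_right hκ0] at h1
    rw [comb_apply, h1, mul_zero, add_zero, mul_eq_zero] at hx
    exact hx.resolve_left (one_div_ne_zero hc0)
  · intro x
    rw [hfX, comb_apply, zero_mul, zero_add]

/-- The case of a single point of weight two. -/
lemma exists_isRankFourForm_of_club [Algebra.IsSeparable F K] (hC : IsRepresentedBy C f)
    (h4 : finrank F K = 4) (hb : LinearIndependent F ![1, b])
    (hr : LinearMap.range f = Submodule.span F (Set.range ![1, b])) (hf : IsThinOutsideKer f) :
    ∃ g : K →ₗ[F] K, IsRankFourForm g ∧ IsRepresentedBy C g := by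
  obtain ⟨θ, hθ0, hθ⟩ := exists_trace_of_isThinOutsideKer hb hr hf
  have ht := two_le_finrank_adjoin (notMem_range_of_linearIndependent hb)
  obtain ⟨c, S, hc0, hdim, hdis, hS⟩ := exists_decomposition hθ0 (finrank_ker_add_two hb hr) ht hθ
  rw [h4] at hdim
  have htle : finrank F F⟮b⟯ ≤ 4 := Nat.le_of_dvd (by norm_num) (Dvd.intro _ hdim)
  have hcases : finrank F F⟮b⟯ = 2 ∨ finrank F F⟮b⟯ = 4 := by
    have h3 : finrank F F⟮b⟯ ≠ 3 := by
      intro h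
      rw [h] at hdim
      omega
    omega
  rcases hcases with h2 | hb4
  · refine ⟨_, Or.inr (Or.inr (Or.inl fun x => ?_)), isRepresentedBy_frob_sub hC h4 hb hr hf
      (pow_card_sq_eq_of_finrank_adjoin_eq_two h2) fun x hx => ?_⟩
    · rw [← frob_apply, ← frob_iterate]
      rfl
    · rw [← LinearMap.mem_ker, hS, h2] at hx ⊢
      have hI : Set.Iio (2 - 2) = ∅ := by simp
      rw [hI, Set.image_empty, Submodule.span_empty, sup_bot_eq] at hx ⊢
      have := S.smul_mem (AdjoinSimple.gen F b) hx
      rwa [Algebra.smul_def, AdjoinSimple.algebraMap_gen] at this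
  · have hmem : ∀ i < 2, f (c * b ^ i) = 0 := by
      intro i hi
      rw [← LinearMap.mem_ker, hS, hb4]
      exact Submodule.mem_sup_right (Submodule.subset_span ⟨i, hi, rfl⟩)
    obtain ⟨g, ω, hg, hgC⟩ := exists_isDualBasisForm_of_club hC h4 hb hr hf hb4 hc0
      (by simpa using hmem 0 (by norm_num)) (by simpa using hmem 1 (by norm_num))
    refine ⟨g, Or.inr (Or.inr (Or.inr (Or.inl ⟨b, ω, ?_, hg⟩))), hgC⟩
    exact eq_of_le_of_finrank_eq le_top (by rw [hb4, IntermediateField.finrank_top', h4])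

end RankFourClubs

section NormOne

variable {F K : Type*} [Field F] [Field K] [Algebra F K] [FiniteDimensional F K] [Finite F]

lemma exists_ne_zero_trace_mul_eq_zero (h4 : finrank F K = 4) (w : K) :
    ∃ x : K, x ≠ 0 ∧ Algebra.trace F K (w * (x * x ^ Nat.card F)) = 0 := by
  classical
  let := Fintype.ofFinite F
  have ξ : Basis (Fin 4) F K := finBasisOfFinrankEq F K h4
  let P : MvPolynomial (Fin 4) F := ∑ i, ∑ j,
    MvPolynomial.C (Algebra.trace F K (w * (ξ i * frob F (ξ j)))) *
      (MvPolynomial.X i * MvPolynomial.X j)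
  have hdeg : P.totalDegree < Fintype.card (Fin 4) := by
    have h : P.totalDegree ≤ 2 := by
      refine MvPolynomial.totalDegree_finsetSum_le fun i _ =>
        MvPolynomial.totalDegree_finsetSum_le fun j _ => ?_
      refine (MvPolynomial.totalDegree_mul _ _).trans ?_
      rw [MvPolynomial.totalDegree_C, zero_add]
      refine (MvPolynomial.totalDegree_mul _ _).trans ?_
      rw [MvPolynomial.totalDegree_X, MvPolynomial.totalDegree_X]
    rw [Fintype.card_fin]
    omega
  have heval : ∀ s : Fin 4 → F, MvPolynomial.eval s P =
      Algebra.trace F K (w * ((∑ i, s i • ξ i) * (∑ i, s i • ξ i) ^ Nat.card F)) := by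
    intro s
    rw [← frob_apply, map_sum (frob F), Finset.sum_mul_sum, Finset.mul_sum, map_sum, map_sum]
    refine Finset.sum_congr rfl fun i _ => ?_
    rw [Finset.mul_sum, map_sum, map_sum]
    refine Finset.sum_congr rfl fun j _ => ?_
    rw [map_smul, smul_mul_smul_comm, mul_smul_comm, map_smul]
    simp
    ring
  obtain ⟨p, hp⟩ := CharP.exists F
  have hp1 := CharP.char_is_prime F p
  have hdvd := char_dvd_card_solutions p hdeg
  by_contra! hcon
  have huniq : ∀ s : {s : Fin 4 → F // MvPolynomial.eval s P = 0}, s.1 = 0 := by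
    rintro ⟨s, hs⟩
    rw [heval] at hs
    have h0 : ∑ i, s i • ξ i = 0 := by
      by_contra hne
      exact hcon _ hne hs
    exact funext (Fintype.linearIndependent_iff.1 ξ.linearIndependent s h0)
  have hcard : Fintype.card {s : Fin 4 → F // MvPolynomial.eval s P = 0} = 1 := by
    rw [Fintype.card_eq_one_iff]
    refine ⟨⟨0, ?_⟩, fun s => Subtype.ext (huniq s)⟩
    rw [heval]
    simp
  rw [hcard] at hdvd
  exact hp1.one_lt.ne' (Nat.dvd_one.1 hdvd)

/-- The additive form of Hilbert's Theorem 90 for finite fields. -/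
lemma exists_pow_card_sub_eq {x : K} (hx : Algebra.trace F K x = 0) :
    ∃ z : K, z ^ Nat.card F - z = x := by
  have : Finite K := Module.finite_of_finite F
  let D : K →ₗ[F] K := (frob F).toLinearMap - LinearMap.id
  have hD : ∀ z, D z = z ^ Nat.card F - z := fun z => by rw [← frob_apply]; rfl
  have hinj : Function.Injective (frob F : K →ₐ[F] K) := (frob F : K →ₐ[F] K).toRingHom.injective
  let e : K ≃ₐ[F] K := AlgEquiv.ofBijective (frob F) (Finite.injective_iff_bijective.1 hinj)
  have hle : LinearMap.range D ≤ LinearMap.ker (Algebra.trace F K) := by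
    rintro _ ⟨z, rfl⟩
    have h : Algebra.trace F K (e z) = Algebra.trace F K z := Algebra.trace_eq_of_algEquiv e z
    rw [LinearMap.mem_ker, LinearMap.sub_apply, map_sub, sub_eq_zero]
    exact h
  have hkerD : LinearMap.ker D ≤ Submodule.span F {1} := by
    intro z hz
    rw [LinearMap.mem_ker, hD, sub_eq_zero] at hz
    obtain ⟨s, rfl⟩ := mem_range_algebraMap_of_pow_card_eq hz
    exact Submodule.mem_span_singleton.2 ⟨s, by rw [Algebra.algebraMap_eq_smul_one]⟩
  have h1 := Submodule.finrank_mono hkerD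
  rw [finrank_span_singleton (one_ne_zero (α := K))] at h1
  have h2 := D.finrank_range_add_finrank_ker
  have h3 := (Algebra.trace F K).finrank_range_add_finrank_ker
  rw [LinearMap.range_eq_top.2 (Algebra.trace_surjective F K), finrank_top, finrank_self] at h3
  have heq := Submodule.eq_of_le_of_finrank_le hle (by omega)
  have hmem : x ∈ LinearMap.range D := by
    rw [heq]
    exact hx
  obtain ⟨z, hz⟩ := hmem
  exact ⟨z, by rw [← hD, hz]⟩

/-- Hilbert's Theorem 90 for finite fields. -/
lemma exists_pow_card_eq_mul (h4 : finrank F K = 4) {δ : K} (hδ : Algebra.norm F δ = 1) :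
    ∃ y : K, y ≠ 0 ∧ y ^ Nat.card F = δ * y := by
  have : Finite K := Module.finite_of_finite F
  obtain ⟨m, hm⟩ : ∃ m, Nat.card F = m + 1 := Nat.exists_eq_succ_of_ne_zero Nat.card_pos.ne'
  set s := (m + 1) ^ 0 + (m + 1) ^ 1 + (m + 1) ^ 2 + (m + 1) ^ 3 with hs
  have hs0 : 0 < s := by positivity
  have hδs : δ ^ s = 1 := by
    have h := FiniteField.algebraMap_norm_eq_pow_sum F K δ
    rwa [hδ, map_one, h4, hm, Finset.sum_range_succ, Finset.sum_range_succ, Finset.sum_range_succ,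
      Finset.sum_range_one, ← hs, eq_comm] at h
  have hδ0 : δ ≠ 0 := by
    rintro rfl
    rw [zero_pow hs0.ne'] at hδs
    exact zero_ne_one hδs
  obtain ⟨g, hg⟩ := IsCyclic.exists_monoid_generator (α := Kˣ)
  obtain ⟨k, hk⟩ := hg (Units.mk0 δ hδ0)
  have hk' : (g : K) ^ k = δ := by
    have := congrArg Units.val hk
    simpa using this
  have hord : orderOf g = m * s := by
    rw [orderOf_eq_card_of_forall_mem_powers hg, Nat.card_units,
      Module.natCard_eq_pow_finrank (K := F), h4, hm, hs]
    have : (m + 1) ^ 4 = m * ((m + 1) ^ 0 + (m + 1) ^ 1 + (m + 1) ^ 2 + (m + 1) ^ 3) + 1 := by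
      ring
    omega
  have hdvd : m * s ∣ k * s := by
    rw [← hord]
    apply orderOf_dvd_of_pow_eq_one
    ext
    rw [Units.val_pow_eq_pow_val, pow_mul, hk', hδs, Units.val_one]
  obtain ⟨j, rfl⟩ := Nat.dvd_of_mul_dvd_mul_right hs0 hdvd
  refine ⟨(g : K) ^ j, pow_ne_zero _ g.ne_zero, ?_⟩
  rw [← hk', hm, ← pow_mul, ← pow_add]
  congr 1
  ring

/-- For `N(δ) = 1` the map `x ^ q + δ x ^ (q ^ 3)` is not scattered. -/
lemma exists_pair_of_norm_eq_one (h4 : finrank F K = 4) {δ : K} (hδ : Algebra.norm F δ = 1) :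
    ∃ x y : K, x ≠ 0 ∧ (∀ s : F, y ≠ s • x) ∧
      x * (y ^ Nat.card F + δ * y ^ (Nat.card F ^ 3)) =
        y * (x ^ Nat.card F + δ * x ^ (Nat.card F ^ 3)) := by
  have : Finite K := Module.finite_of_finite F
  set q := Nat.card F with hq
  have hK4 : ∀ x : K, x ^ (q ^ 4) = x := fun x => by
    have := pow_card_pow_finrank F x
    rwa [h4] at this
  obtain ⟨w, hw0, hw⟩ : ∃ w : K, w ≠ 0 ∧ w = δ * w ^ (q ^ 3) := by
    obtain ⟨y, hy0, hyq⟩ := exists_pow_card_eq_mul h4 hδ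
    rw [← hq] at hyq
    refine ⟨y ^ q, pow_ne_zero _ hy0, ?_⟩
    rw [← pow_mul, ← pow_succ', hK4]
    exact hyq
  obtain ⟨u, hu0, hu⟩ := exists_ne_zero_trace_mul_eq_zero h4 w
  obtain ⟨z, hz⟩ := exists_pow_card_sub_eq hu
  rw [← hq] at hz
  have hfr : ∀ a b : K, (a - b) ^ (q ^ 3) = a ^ (q ^ 3) - b ^ (q ^ 3) := fun a b => by
    simp only [hq, ← frob_iterate, ← AlgHom.coe_pow, map_sub]
  have hX : u⁻¹ * (u⁻¹ * z) ^ q - (u⁻¹) ^ q * (u⁻¹ * z) = w := by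
    have h1 : u⁻¹ * (u⁻¹ * z) ^ q - (u⁻¹) ^ q * (u⁻¹ * z) = u⁻¹ * (u⁻¹) ^ q * (z ^ q - z) := by
      rw [mul_pow]
      ring
    rw [h1, hz, inv_pow]
    have : u ^ q ≠ 0 := pow_ne_zero _ hu0
    field_simp
  refine ⟨u⁻¹, u⁻¹ * z, inv_ne_zero hu0, ?_, ?_⟩
  · intro s hs
    have hzs : z = algebraMap F K s := by
      rw [Algebra.smul_def, mul_comm] at hs
      exact mul_right_cancel₀ (inv_ne_zero hu0) hs
    have hzq : z ^ q - z = 0 := by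
      rw [hq, ← frob_apply, hzs, AlgHom.commutes, sub_self]
    rw [hz] at hzq
    exact mul_ne_zero hw0 (mul_ne_zero hu0 (pow_ne_zero _ hu0)) hzq
  · set x := u⁻¹
    set y := u⁻¹ * z
    have h3 : w ^ (q ^ 3) = x ^ (q ^ 3) * y - x * y ^ (q ^ 3) := by
      rw [← hX, hfr, mul_pow x, mul_pow (x ^ q), ← pow_mul, ← pow_mul, ← pow_succ', hK4, hK4]
    rw [h3] at hw
    linear_combination hX + hw

end NormOne

section Quadratic

variable {F K : Type*} [Field F] [Field K] [Algebra F K] [FiniteDimensional F K] [Finite F]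

open Polynomial in
lemma exists_aeval_eq_zero_of_natDegree_eq_two (h4 : finrank F K = 4) {P : F[X]}
    (hP : P.natDegree = 2) : ∃ x : K, aeval x P = 0 ∧ x ^ (Nat.card F ^ 2) = x := by
  have : Finite K := Module.finite_of_finite F
  obtain ⟨g, hg, hgP⟩ := exists_irreducible_of_natDegree_ne_zero (f := P) (by omega)
  have hP0 : P ≠ 0 := by
    rintro rfl
    simp at hP
  have hg2 : g.natDegree ≤ 2 := hP ▸ natDegree_le_of_dvd hgP hP0
  have hg0 : 0 < g.natDegree := hg.natDegree_pos
  have hd2 : g ∣ X ^ (Nat.card F) ^ 2 - X := by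
    rw [← hg.natDegree_dvd_iff_dvd_X_pow_card_pow_sub_X]
    interval_cases g.natDegree <;> norm_num
  have hd4 : g ∣ X ^ (Nat.card F) ^ 4 - X := by
    rw [← hg.natDegree_dvd_iff_dvd_X_pow_card_pow_sub_X]
    interval_cases g.natDegree <;> norm_num
  have hsplit : (g.map (algebraMap F K)).Splits := by
    let := Fintype.ofFinite K
    have h1 := (FiniteField.isSplittingField_sub K F).splits
    have hK : Nat.card K = Nat.card F ^ 4 := by
      rw [Module.natCard_eq_pow_finrank (K := F), h4]
    have h2 := Polynomial.map_dvd (algebraMap F K) hd4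
    rw [← hK, ← Fintype.card_eq_nat_card] at h2
    exact h1.of_dvd (Polynomial.map_ne_zero
      (FiniteField.X_pow_card_sub_X_ne_zero F Fintype.one_lt_card)) h2
  obtain ⟨x, hx⟩ := hsplit.exists_eval_eq_zero (by
    rw [degree_map]
    exact (natDegree_pos_iff_degree_pos.1 hg0).ne')
  have hgx : aeval x g = 0 := by rwa [aeval_def, ← eval_map]
  refine ⟨x, ?_, ?_⟩
  · obtain ⟨r, rfl⟩ := hgP
    rw [map_mul, hgx, zero_mul]
  · obtain ⟨r, hr⟩ := hd2
    have := congrArg (aeval x) hr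
    rw [map_mul, hgx, zero_mul, map_sub, map_pow, aeval_X, sub_eq_zero] at this
    exact this

end Quadratic

section Pencils

variable {F K : Type*} [Field F] [Field K] [Algebra F K]

/-- The Pfaffian of the alternating matrix with entries `t₀₁, t₀₂, t₀₃, t₁₂, t₁₃, t₂₃`. -/
def pfaffian (t : Fin 6 → K) : K := t 0 * t 5 - t 1 * t 4 + t 2 * t 3

/-- The alternating matrix with entries `t₀₁, t₀₂, t₀₃, t₁₂, t₁₃, t₂₃`. -/
def altMatrix (t : Fin 6 → K) : Matrix (Fin 4) (Fin 4) K :=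
  !![0, t 0, t 1, t 2; -t 0, 0, t 3, t 4; -t 1, -t 3, 0, t 5; -t 2, -t 4, -t 5, 0]

/-- The Plücker coordinates of the line through `x` and `y`. -/
def plucker (x y : Fin 4 → K) : Fin 6 → K :=
  ![x 0 * y 1 - x 1 * y 0, x 0 * y 2 - x 2 * y 0, x 0 * y 3 - x 3 * y 0,
    x 1 * y 2 - x 2 * y 1, x 1 * y 3 - x 3 * y 1, x 2 * y 3 - x 3 * y 2]

/-- An alternating form of rank two is the exterior product of two linear forms. -/
lemma exists_forms_of_pfaffian_eq_zero {t : Fin 6 → K} (ht : t ≠ 0) (hpf : pfaffian t = 0) :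
    ∃ i j : Fin 4, altMatrix t i j ≠ 0 ∧ altMatrix t i i = 0 ∧ altMatrix t j j = 0 ∧
      altMatrix t j i = -altMatrix t i j ∧ ∀ x y : Fin 4 → K,
      altMatrix t i j * (t ⬝ᵥ plucker x y) = (altMatrix t i ⬝ᵥ x) * (altMatrix t j ⬝ᵥ y) -
        (altMatrix t i ⬝ᵥ y) * (altMatrix t j ⬝ᵥ x) := by
  obtain ⟨l, hl⟩ := Function.ne_iff.1 ht
  rw [pfaffian] at hpf
  have hdot : ∀ x y : Fin 4 → K, x ⬝ᵥ y = x 0 * y 0 + x 1 * y 1 + x 2 * y 2 + x 3 * y 3 :=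
    fun x y => by simp [dotProduct, Fin.sum_univ_four]
  have hdot6 : ∀ x y : Fin 4 → K, t ⬝ᵥ plucker x y =
      t 0 * (x 0 * y 1 - x 1 * y 0) + t 1 * (x 0 * y 2 - x 2 * y 0) +
      t 2 * (x 0 * y 3 - x 3 * y 0) + t 3 * (x 1 * y 2 - x 2 * y 1) +
      t 4 * (x 1 * y 3 - x 3 * y 1) + t 5 * (x 2 * y 3 - x 3 * y 2) := fun x y => by
    simp [dotProduct, Fin.sum_univ_six, plucker]
  fin_cases l
  · refine ⟨0, 1, hl, rfl, rfl, by simp [altMatrix], fun x y => ?_⟩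
    rw [hdot6, hdot, hdot, hdot, hdot]
    simp only [altMatrix, Matrix.of_apply, Matrix.cons_val]
    linear_combination (x 2 * y 3 - x 3 * y 2) * hpf
  · refine ⟨0, 2, hl, rfl, rfl, by simp [altMatrix], fun x y => ?_⟩
    rw [hdot6, hdot, hdot, hdot, hdot]
    simp only [altMatrix, Matrix.of_apply, Matrix.cons_val]
    linear_combination -(x 1 * y 3 - x 3 * y 1) * hpf
  · refine ⟨0, 3, hl, rfl, rfl, by simp [altMatrix], fun x y => ?_⟩
    rw [hdot6, hdot, hdot, hdot, hdot]
    simp only [altMatrix, Matrix.of_apply, Matrix.cons_val]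
    linear_combination (x 1 * y 2 - x 2 * y 1) * hpf
  · refine ⟨1, 2, hl, rfl, rfl, by simp [altMatrix], fun x y => ?_⟩
    rw [hdot6, hdot, hdot, hdot, hdot]
    simp only [altMatrix, Matrix.of_apply, Matrix.cons_val]
    linear_combination (x 0 * y 3 - x 3 * y 0) * hpf
  · refine ⟨1, 3, hl, rfl, rfl, by simp [altMatrix], fun x y => ?_⟩
    rw [hdot6, hdot, hdot, hdot, hdot]
    simp only [altMatrix, Matrix.of_apply, Matrix.cons_val]
    linear_combination -(x 0 * y 2 - x 2 * y 0) * hpf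
  · refine ⟨2, 3, hl, rfl, rfl, by simp [altMatrix], fun x y => ?_⟩
    rw [hdot6, hdot, hdot, hdot, hdot]
    simp only [altMatrix, Matrix.of_apply, Matrix.cons_val]
    linear_combination (x 0 * y 1 - x 1 * y 0) * hpf

lemma exists_ne_zero_of_det_eq_zero {x y z w : K} (h : x * w - y * z = 0) :
    ∃ α β : K, (α ≠ 0 ∨ β ≠ 0) ∧ α * x + β * y = 0 ∧ α * z + β * w = 0 := by
  by_cases hxy : x = 0 ∧ y = 0
  · by_cases hzw : z = 0 ∧ w = 0
    · exact ⟨1, 0, Or.inl one_ne_zero, by simp [hxy.1], by simp [hzw.1]⟩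
    · refine ⟨w, -z, ?_, by simp [hxy.1, hxy.2], by ring⟩
      by_contra! hcon
      exact hzw ⟨neg_eq_zero.1 hcon.2, hcon.1⟩
  · refine ⟨y, -x, ?_, by ring, by linear_combination -h⟩
    by_contra! hcon
    exact hxy ⟨neg_eq_zero.1 hcon.2, hcon.1⟩

/-- Three vectors on which two independent linear forms on a four-dimensional space vanish are
linearly dependent. -/
lemma exists_relation_of_forms {u v : Fin 4 → K} {i j : Fin 4} (hui : u i = 0) (huj : u j ≠ 0)
    (hvi : v i ≠ 0) (hvj : v j = 0) {g : Fin 3 → Fin 4 → K} (hgu : ∀ l, u ⬝ᵥ g l = 0)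
    (hgv : ∀ l, v ⬝ᵥ g l = 0) :
    ∃ c : Fin 3 → K, c ≠ 0 ∧ ∑ l, c l • g l = 0 := by
  let D : (Fin 4 → K) →ₗ[K] (K × K) :=
    LinearMap.prod (dotProductBilin K K u) (dotProductBilin K K v)
  have hD : ∀ x, D x = (u ⬝ᵥ x, v ⬝ᵥ x) := fun _ => rfl
  have hsurj : Function.Surjective D := by
    rintro ⟨a, b⟩
    refine ⟨Pi.single j (a / u j) + Pi.single i (b / v i), ?_⟩
    rw [hD, dotProduct_add, dotProduct_add, dotProduct_single, dotProduct_single,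
      dotProduct_single, dotProduct_single, hui, hvj, mul_div_cancel₀ _ huj,
      mul_div_cancel₀ _ hvi]
    simp
  have hker : finrank K (LinearMap.ker D) = 2 := by
    have := D.finrank_range_add_finrank_ker
    rw [LinearMap.range_eq_top.2 hsurj, finrank_top, finrank_prod, finrank_self,
      finrank_fin_fun] at this
    omega
  have hnot : ¬ LinearIndependent K (fun l => (⟨g l, by
      rw [LinearMap.mem_ker, hD, hgu, hgv]
      rfl⟩ : LinearMap.ker D)) := by
    intro h
    have := h.fintype_card_le_finrank
    rw [hker, Fintype.card_fin] at this
    omega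
  rw [Fintype.not_linearIndependent_iff] at hnot
  obtain ⟨c, hc, l, hl⟩ := hnot
  refine ⟨c, fun h => hl (congrFun h l), ?_⟩
  have := congrArg Subtype.val hc
  simpa using this

/-- A pencil of alternating forms on `F ^ 4` contains a form of rank two over the extension of
degree two. -/
lemma exists_degenerate_form [FiniteDimensional F K] [Finite F] (h4 : finrank F K = 4)
    {t₁ t₂ : Fin 6 → F}
    (ht : LinearIndependent F ![t₁, t₂]) :
    ∃ (t : Fin 6 → K) (μ ν : K), t ≠ 0 ∧ (∀ i, t i ^ (Nat.card F ^ 2) = t i) ∧ pfaffian t = 0 ∧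
      ∀ i, t i = μ * algebraMap F K (t₁ i) + ν * algebraMap F K (t₂ i) := by
  rw [LinearIndependent.pair_iff] at ht
  have hF : ∀ s : F, algebraMap F K s ^ (Nat.card F ^ 2) = algebraMap F K s := by
    intro s
    rw [← frob_iterate, Function.iterate_succ_apply, Function.iterate_one, AlgHom.commutes,
      AlgHom.commutes]
  by_cases hc : pfaffian t₂ = 0
  · refine ⟨fun i => algebraMap F K (t₂ i), 0, 1, ?_, fun i => hF _, ?_, fun i => by simp⟩
    · intro h
      refine one_ne_zero (ht 0 1 ?_).2
      ext i
      simpa using congrFun h i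
    · have := congrArg (algebraMap F K) hc
      simpa [pfaffian] using this
  · let B : F := t₁ 0 * t₂ 5 + t₂ 0 * t₁ 5 - t₁ 1 * t₂ 4 - t₂ 1 * t₁ 4 + t₁ 2 * t₂ 3 + t₂ 2 * t₁ 3
    obtain ⟨x, hx, hxq⟩ := exists_aeval_eq_zero_of_natDegree_eq_two (K := K) h4
      (Polynomial.natDegree_quadratic (b := B) (c := pfaffian t₁) hc)
    refine ⟨fun i => algebraMap F K (t₁ i) + x * algebraMap F K (t₂ i), 1, x, ?_, ?_, ?_,
      fun i => by rw [one_mul]⟩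
    · intro h
      have ht2 : t₂ ≠ 0 := by
        rintro rfl
        simp [pfaffian] at hc
      obtain ⟨i, hi⟩ := Function.ne_iff.1 ht2
      have hi' : algebraMap F K (t₂ i) ≠ 0 := by
        rw [Ne, map_eq_zero]
        exact hi
      have hxF : x = algebraMap F K (-(t₁ i / t₂ i)) := by
        have h1 : algebraMap F K (t₁ i) + x * algebraMap F K (t₂ i) = 0 := congrFun h i
        rw [map_neg, map_div₀]
        field_simp
        linear_combination h1
      refine one_ne_zero (ht 1 (-(t₁ i / t₂ i)) ?_).1
      ext l
      apply (algebraMap F K).injective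
      have h1 : algebraMap F K (t₁ l) + x * algebraMap F K (t₂ l) = 0 := congrFun h l
      rw [hxF] at h1
      simpa using h1
    · intro i
      have hadd : ∀ a b : K, (a + b) ^ (Nat.card F ^ 2) =
          a ^ (Nat.card F ^ 2) + b ^ (Nat.card F ^ 2) := fun a b => by
        simp only [← frob_iterate, ← AlgHom.coe_pow, map_add]
      rw [hadd, mul_pow, hF, hF, hxq]
    · have : pfaffian (fun i => algebraMap F K (t₁ i) + x * algebraMap F K (t₂ i)) =
          Polynomial.aeval x (Polynomial.C (pfaffian t₂) * Polynomial.X ^ 2 +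
            Polynomial.C B * Polynomial.X + Polynomial.C (pfaffian t₁)) := by
        simp only [pfaffian, B, map_add, map_mul, map_pow, map_sub, Polynomial.aeval_X,
          Polynomial.aeval_C]
        ring
      rw [this, hx]

end Pencils

section Scattered

variable {F K : Type*} [Field F] [Field K] [Algebra F K] [FiniteDimensional F K]

/-- A linear map of `F ^ 6` into a four-dimensional space has two independent vectors in its
kernel. -/
lemma exists_linearIndependent_pair_ker (h4 : finrank F K = 4) (L : (Fin 6 → F) →ₗ[F] K) :
    ∃ t₁ t₂ : Fin 6 → F, LinearIndependent F ![t₁, t₂] ∧ L t₁ = 0 ∧ L t₂ = 0 := by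
  have h1 : 1 < finrank F (LinearMap.ker L) := by
    have h2 := L.finrank_range_add_finrank_ker
    have h3 := (LinearMap.range L).finrank_le
    rw [finrank_fin_fun] at h2
    omega
  have : Nontrivial (LinearMap.ker L) := Module.nontrivial_of_finrank_pos (zero_lt_one.trans h1)
  obtain ⟨x, hx⟩ := exists_ne (0 : LinearMap.ker L)
  obtain ⟨y, hy⟩ := exists_linearIndependent_pair_of_one_lt_finrank h1 hx
  refine ⟨x, y, ?_, x.2, y.2⟩
  have := hy.map' (LinearMap.ker L).subtype (Submodule.ker_subtype _)
  rwa [show (LinearMap.ker L).subtype ∘ ![x, y] = ![(x : Fin 6 → F), (y : Fin 6 → F)] from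
    funext fun i => by fin_cases i <;> rfl] at this

variable [Finite F]

lemma eq_zero_of_forall_mem_add_pow_eq_zero {M : Submodule F K} (hM : 3 ≤ finrank F M)
    {α β γ : K}
    (h : ∀ y ∈ M, α * y + β * y ^ Nat.card F + γ * y ^ (Nat.card F ^ 2) = 0) :
    α = 0 ∧ β = 0 ∧ γ = 0 := by
  have hq : 1 < Nat.card F := Finite.one_lt_card
  have hq2 : Nat.card F < Nat.card F ^ 2 := by nlinarith
  let P : Polynomial K := Polynomial.C α * Polynomial.X ^ 1 +
    Polynomial.C β * Polynomial.X ^ Nat.card F + Polynomial.C γ * Polynomial.X ^ (Nat.card F ^ 2)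
  have hP : P = 0 := by
    by_contra hne
    have hdeg : P.natDegree ≤ Nat.card F ^ 2 := by
      refine Polynomial.natDegree_add_le_of_degree_le
        (Polynomial.natDegree_add_le_of_degree_le ?_ ?_) ?_
      · exact (Polynomial.natDegree_C_mul_X_pow_le _ _).trans (by omega)
      · exact (Polynomial.natDegree_C_mul_X_pow_le _ _).trans hq2.le
      · exact Polynomial.natDegree_C_mul_X_pow_le _ _
    have := finrank_le_of_eval_eq_zero hne hdeg fun x hx => by
      simpa [P] using h x hx
    omega
  have hcoeff : ∀ i, P.coeff i = (if i = 1 then α else 0) + (if i = Nat.card F then β else 0) +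
      (if i = Nat.card F ^ 2 then γ else 0) := fun i => by
    simp only [P, Polynomial.coeff_add, Polynomial.coeff_C_mul_X_pow]
  refine ⟨?_, ?_, ?_⟩
  · have := hcoeff 1
    rwa [if_pos rfl, if_neg hq.ne, if_neg (hq.trans hq2).ne, hP, Polynomial.coeff_zero, add_zero,
      add_zero, eq_comm] at this
  · have := hcoeff (Nat.card F)
    rwa [if_neg hq.ne', if_pos rfl, if_neg hq2.ne, hP, Polynomial.coeff_zero, add_zero,
      zero_add, eq_comm] at this
  · have := hcoeff (Nat.card F ^ 2)
    rwa [if_neg (hq.trans hq2).ne', if_neg hq2.ne', if_pos rfl, hP, Polynomial.coeff_zero, add_zero,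
      zero_add, eq_comm] at this

lemma frob_surjective : Function.Surjective (frob F : K →ₐ[F] K) := by
  have : Finite K := Module.finite_of_finite F
  exact Finite.injective_iff_surjective.1 (frob_injective F)

/-- A scattered `f` for `n = 4` is equivalent to a binomial `α x ^ q + β x ^ (q ^ 3)`. -/
lemma exists_comb_eq_frob {f : K →ₗ[F] K} (h4 : finrank F K = 4)
    (hf : ∀ a b : K, a ≠ 0 ∨ b ≠ 0 → 3 ≤ combRank f a b) :
    ∃ a b c d α β : K, a * d - b * c ≠ 0 ∧ ∀ x, comb f c d x =
      α * comb f a b x ^ Nat.card F + β * comb f a b x ^ (Nat.card F ^ 3) := by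
  have ξ : Basis (Fin 4) F K := finBasisOfFinrankEq F K h4
  let p := plucker ξ (f ∘ ξ)
  obtain ⟨t₁, t₂, hLI, ht₁, ht₂⟩ :=
    exists_linearIndependent_pair_ker h4 (Fintype.linearCombination F p)
  obtain ⟨t, μ, ν, ht0, htq, hpf, ht⟩ := exists_degenerate_form (K := K) h4 hLI
  obtain ⟨i, j, hij, hii, hjj, hji, hforms⟩ := exists_forms_of_pfaffian_eq_zero ht0 hpf
  set u := altMatrix t i
  set v := altMatrix t j
  have hfix : ∀ i j, frob F (frob F (altMatrix t i j)) = altMatrix t i j := by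
    have h0 : ∀ l, frob F (frob F (t l)) = t l := fun l => by
      have := htq l
      rwa [← frob_iterate] at this
    intro i j
    fin_cases i <;> fin_cases j <;> simp [altMatrix, h0]
  have hR : ∀ (i : Fin 4) (w : Fin 4 → K), altMatrix t i ⬝ᵥ w = 0 →
      altMatrix t i ⬝ᵥ (fun l => frob F (frob F (w l))) = 0 := by
    intro i w hw
    have := congrArg (fun z => frob F (frob F z)) hw
    simp only [dotProduct, map_sum, map_mul, hfix, map_zero] at this
    exact this
  have hsum₁ : ∑ l, algebraMap F K (t₁ l) * p l = 0 := by
    rw [Fintype.linearCombination_apply] at ht₁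
    simpa only [Algebra.smul_def] using ht₁
  have hsum₂ : ∑ l, algebraMap F K (t₂ l) * p l = 0 := by
    rw [Fintype.linearCombination_apply] at ht₂
    simpa only [Algebra.smul_def] using ht₂
  have hsplit : ∀ w : Fin 6 → K, t ⬝ᵥ w =
      μ * ∑ l, algebraMap F K (t₁ l) * w l + ν * ∑ l, algebraMap F K (t₂ l) * w l := by
    intro w
    rw [dotProduct, Finset.mul_sum, Finset.mul_sum, ← Finset.sum_add_distrib]
    exact Finset.sum_congr rfl fun l _ => by rw [ht]; ring
  have hp : t ⬝ᵥ p = 0 := by rw [hsplit, hsum₁, hsum₂, mul_zero, mul_zero, add_zero]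
  have hpq : t ⬝ᵥ plucker (frob F ∘ ξ) (frob F ∘ f ∘ ξ) = 0 := by
    have h1 : plucker (frob F ∘ ξ) (frob F ∘ f ∘ ξ) = frob F ∘ p := by
      ext l
      fin_cases l <;> simp [p, plucker]
    have h2 : ∀ s : Fin 6 → F, ∑ l, algebraMap F K (s l) * p l = 0 →
        ∑ l, algebraMap F K (s l) * (frob F ∘ p) l = 0 := by
      intro s hs
      have := congrArg (frob F) hs
      simpa only [map_sum, map_mul, AlgHom.commutes, map_zero, Function.comp_apply] using this
    rw [h1, hsplit, h2 _ hsum₁, h2 _ hsum₂, mul_zero, mul_zero, add_zero]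
  obtain ⟨c, d, hcd, hcdu, hcdv⟩ := exists_ne_zero_of_det_eq_zero
    (x := u ⬝ᵥ ξ) (y := u ⬝ᵥ (f ∘ ξ)) (z := v ⬝ᵥ ξ) (w := v ⬝ᵥ (f ∘ ξ)) (by
      rw [← hforms, hp, mul_zero])
  obtain ⟨a', b', hab', habu, habv⟩ := exists_ne_zero_of_det_eq_zero
    (x := u ⬝ᵥ (frob F ∘ ξ)) (y := u ⬝ᵥ (frob F ∘ f ∘ ξ)) (z := v ⬝ᵥ (frob F ∘ ξ))
    (w := v ⬝ᵥ (frob F ∘ f ∘ ξ)) (by rw [← hforms, hpq, mul_zero])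
  obtain ⟨a, rfl⟩ := frob_surjective (F := F) a'
  obtain ⟨b, rfl⟩ := frob_surjective (F := F) b'
  have hab : a ≠ 0 ∨ b ≠ 0 := by
    refine hab'.imp ?_ ?_ <;> exact fun h h0 => h (by rw [h0, map_zero])
  have hcdw : ∀ w : Fin 4 → K, c * (w ⬝ᵥ ξ) + d * (w ⬝ᵥ (f ∘ ξ)) = w ⬝ᵥ (comb f c d ∘ ξ) := by
    intro w
    simp only [dotProduct, Finset.mul_sum, ← Finset.sum_add_distrib]
    refine Finset.sum_congr rfl fun l _ => ?_
    simp only [Function.comp_apply, comb_apply]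
    ring
  have habw : ∀ w : Fin 4 → K, frob F a * (w ⬝ᵥ (frob F ∘ ξ)) +
      frob F b * (w ⬝ᵥ (frob F ∘ f ∘ ξ)) = w ⬝ᵥ (fun l => frob F (comb f a b (ξ l))) := by
    intro w
    simp only [dotProduct, Finset.mul_sum, ← Finset.sum_add_distrib]
    refine Finset.sum_congr rfl fun l _ => ?_
    simp only [Function.comp_apply, comb_apply, map_add, map_mul]
    ring
  rw [hcdw] at hcdu hcdv
  rw [habw] at habu habv
  let φ : K →ₗ[F] K := (frob F).toLinearMap
  have hφ : ∀ x, φ x = frob F x := fun _ => rfl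
  have huj : u j ≠ 0 := hij
  have hvi : v i ≠ 0 := by
    rw [show v i = -altMatrix t i j from hji]
    exact neg_ne_zero.2 hij
  have hext : ∀ (c : Fin 3 → K) (g₀ g₁ g₂ : K →ₗ[F] K),
      ∑ l, c l • ![g₀ ∘ ξ, g₁ ∘ ξ, g₂ ∘ ξ] l = 0 →
      ∀ x, c 0 * g₀ x + c 1 * g₁ x + c 2 * g₂ x = 0 := by
    intro c g₀ g₁ g₂ h x
    have : c 0 • g₀ + c 1 • g₁ + c 2 • g₂ = (0 : K →ₗ[F] K) := by
      refine ξ.ext fun l => ?_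
      have := congrFun h l
      simpa [Fin.sum_univ_three] using this
    simpa using LinearMap.congr_fun this x
  have hdet : a * d - b * c ≠ 0 := by
    intro h0
    obtain ⟨m, hm⟩ : ∃ m : K, ∀ x, comb f a b x = m * comb f c d x := by
      rcases hcd with hc | hd
      · refine ⟨a / c, fun x => ?_⟩
        rw [comb_apply, comb_apply]
        field_simp
        linear_combination -f x * h0
      · refine ⟨b / d, fun x => ?_⟩
        rw [comb_apply, comb_apply]
        field_simp
        linear_combination x * h0
    have hm' : ∀ w : Fin 4 → K, w ⬝ᵥ (comb f c d ∘ ξ) = 0 → w ⬝ᵥ (comb f a b ∘ ξ) = 0 := by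
      intro w hw
      rw [show (comb f a b ∘ ξ : Fin 4 → K) = m • (comb f c d ∘ ξ) from funext fun l => hm _,
        dotProduct_smul, hw, smul_zero]
    obtain ⟨e, he0, he⟩ := exists_relation_of_forms (u := u) (v := v) hii huj hvi hjj
      (g := ![comb f a b ∘ ξ, (φ ∘ₗ comb f a b) ∘ ξ, (φ ∘ₗ φ ∘ₗ comb f a b) ∘ ξ])
      (by
        intro l
        fin_cases l
        · exact hm' _ hcdu
        · exact habu
        · exact hR i _ (hm' _ hcdu))
      (by
        intro l
        fin_cases l
        · exact hm' _ hcdv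
        · exact habv
        · exact hR j _ (hm' _ hcdv))
    have hrel := hext e _ _ _ he
    obtain ⟨h0, h1, h2⟩ := eq_zero_of_forall_mem_add_pow_eq_zero (hf a b hab)
      (α := e 0) (β := e 1) (γ := e 2) (by
        rintro _ ⟨x, rfl⟩
        rw [← frob_apply, ← frob_iterate]
        exact hrel x)
    refine he0 (funext fun l => ?_)
    fin_cases l
    · exact h0
    · exact h1
    · exact h2
  obtain ⟨e, he0, he⟩ := exists_relation_of_forms (u := u) (v := v) hii huj hvi hjj
    (g := ![(φ ∘ₗ comb f a b) ∘ ξ, (φ ∘ₗ φ ∘ₗ φ ∘ₗ comb f a b) ∘ ξ, comb f c d ∘ ξ])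
    (by
      intro l
      fin_cases l
      · exact habu
      · exact hR i _ habu
      · exact hcdu)
    (by
      intro l
      fin_cases l
      · exact habv
      · exact hR j _ habv
      · exact hcdv)
  have hrel := hext e _ _ _ he
  have he2 : e 2 ≠ 0 := by
    intro he2
    have hrange : 3 ≤ finrank F (LinearMap.range (φ ∘ₗ comb f a b)) := by
      rw [LinearMap.range_comp,
        (Submodule.equivMapOfInjective φ (frob_injective F) _).finrank_eq.symm]
      exact hf a b hab
    obtain ⟨h0, -, h1⟩ := eq_zero_of_forall_mem_add_pow_eq_zero hrange
      (α := e 0) (β := 0) (γ := e 1) (by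
        rintro _ ⟨x, rfl⟩
        rw [← frob_iterate, zero_mul, add_zero]
        have := hrel x
        rw [he2, zero_mul, add_zero] at this
        exact this)
    refine he0 (funext fun l => ?_)
    fin_cases l
    · exact h0
    · exact h1
    · exact he2
  refine ⟨a, b, c, d, -e 0 / e 2, -e 1 / e 2, hdet, fun x => ?_⟩
  have h1 := hrel x
  have h2 : (φ ∘ₗ comb f a b) x = comb f a b x ^ Nat.card F := frob_apply F _
  have h3 : (φ ∘ₗ φ ∘ₗ φ ∘ₗ comb f a b) x = comb f a b x ^ (Nat.card F ^ 3) := by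
    rw [← frob_iterate]
    rfl
  rw [h2, h3] at h1
  field_simp
  linear_combination h1

/-- The case where all points have weight one. -/
lemma exists_isRankFourForm_of_scattered {C : Submodule K (Fin (4 + 1) → K)} {f : K →ₗ[F] K}
    (hC : IsRepresentedBy C f) (h4 : finrank F K = 4)
    (hf : ∀ a b : K, a ≠ 0 ∨ b ≠ 0 → 3 ≤ combRank f a b) :
    ∃ g : K →ₗ[F] K, IsRankFourForm g ∧ IsRepresentedBy C g := by
  obtain ⟨a, b, c, d, α, β, hdet, h⟩ := exists_comb_eq_frob h4 hf
  have hscat : ∀ x y : K, x ≠ 0 → x * f y = y * f x → ∃ s : F, y = s • x := by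
    intro x y hx hxy
    have hr := hf (f x) (-x) (Or.inr (neg_ne_zero.2 hx))
    have hk := combRank_add_finrank_ker f (f x) (-x)
    refine exists_smul_of_comb_eq_zero (g := comb f (f x) (-x)) (by omega) hx ?_ ?_
    · rw [comb_apply]
      ring
    · rw [comb_apply]
      linear_combination -hxy
  have hinj : Function.Injective (comb f a b) := by
    rw [injective_iff_map_eq_zero]
    intro x hx
    have h1 := h x
    have hq : Nat.card F ≠ 0 := Nat.card_pos.ne'
    rw [hx, zero_pow hq, zero_pow (pow_ne_zero _ hq), mul_zero, mul_zero, add_zero] at h1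
    rw [comb_apply] at hx h1
    exact (mul_eq_zero.1 (show (a * d - b * c) * x = 0 by
      linear_combination d * hx - b * h1)).resolve_left hdet
  have hsurj : Function.Surjective (comb f a b) := LinearMap.surjective_of_injective hinj
  let φ : K →ₗ[F] K := (frob F).toLinearMap
  have hφ : ∀ x, φ x = x ^ Nat.card F := frob_apply F
  let g : K →ₗ[F] K := α • φ + β • (φ ∘ₗ φ ∘ₗ φ)
  have hg : ∀ x, g x = α * x ^ Nat.card F + β * x ^ (Nat.card F ^ 3) := fun x => by
    rw [← frob_apply, ← frob_iterate]
    rfl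
  have hCg : IsRepresentedBy C g := hC.of_comb hdet hinj fun x => by rw [hg, h]
  have hgscat : ∀ x y : K, x ≠ 0 → x * g y = y * g x → ∃ s : F, y = s • x := by
    intro x y hx hxy
    obtain ⟨x, rfl⟩ := hsurj x
    obtain ⟨y, rfl⟩ := hsurj y
    have hx0 : x ≠ 0 := by
      rintro rfl
      exact hx (map_zero _)
    rw [hg, ← h, hg, ← h] at hxy
    simp only [comb_apply] at hxy
    have h1 : (a * d - b * c) * (x * f y - y * f x) = 0 := by linear_combination hxy
    obtain ⟨s, hs⟩ := hscat x y hx0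
      (sub_eq_zero.1 ((mul_eq_zero.1 h1).resolve_left hdet))
    exact ⟨s, by rw [hs, map_smul]⟩
  by_cases hα : α = 0
  · have hβ : β ≠ 0 := by
      rintro rfl
      obtain ⟨y, hy⟩ : ∃ y : K, ∀ s : F, y ≠ s • (1 : K) := by
        by_contra! hcon
        have := finrank_le_one (1 : K) fun w => (hcon w).imp fun s hs => hs.symm
        omega
      obtain ⟨s, hs⟩ := hgscat 1 y one_ne_zero (by simp [hg, hα])
      exact hy s hs
    refine ⟨φ, Or.inl ⟨0, by simp [Algebra.norm_zero], fun x => by rw [hφ, zero_mul, add_zero]⟩,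
      hCg.of_comb (a := 0) (b := β⁻¹) (c := 1) (d := 0) (by simp [hβ]) ?_ fun x => ?_⟩
    · rw [injective_iff_map_eq_zero]
      intro x hx
      simpa [hg, hα, hβ, Nat.card_pos.ne'] using hx
    · rw [comb_apply, comb_apply, hφ, hg, hα, zero_mul, zero_mul, zero_add, zero_add, zero_mul,
        add_zero, one_mul, inv_mul_cancel_left₀ hβ, ← pow_mul, ← pow_succ,
        show 3 + 1 = finrank F K from h4.symm,
        pow_card_pow_finrank]
  · have hCφ : IsRepresentedBy C (φ + (β / α) • (φ ∘ₗ φ ∘ₗ φ)) := by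
      refine hCg.of_comb (a := 1) (b := 0) (c := 0) (d := α⁻¹) (by simp [hα]) ?_ fun x => ?_
      · rw [injective_iff_map_eq_zero]
        intro x hx
        simpa using hx
      · rw [comb_apply, comb_apply, one_mul, zero_mul, add_zero, zero_mul, zero_add]
        simp only [g, LinearMap.add_apply, LinearMap.smul_apply, smul_eq_mul]
        field_simp
    refine ⟨_, Or.inl ⟨β / α, fun hδ => ?_, fun x => ?_⟩, hCφ⟩
    · obtain ⟨x, y, hx, hxy, hrel⟩ := exists_pair_of_norm_eq_one h4 hδ
      obtain ⟨s, hs⟩ := hgscat x y hx (by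
        rw [hg, hg]
        field_simp at hrel
        linear_combination hrel)
      exact hxy s hs
    · rw [← frob_apply, ← frob_iterate]
      rfl

end Scattered

section PointOfWeightOne

variable {F K : Type*} [Field F] [Field K] [Algebra F K] {n : ℕ}

lemma exists_ker_eq_of_finrank_eq_two {K : Type*} [Field K] {W : Submodule K (Fin 3 → K)}
    (hW : finrank K W = 2) :
    ∃ l : (Fin 3 → K) →ₗ[K] K, l ≠ 0 ∧ LinearMap.ker l = W := by
  have hlt : W < ⊤ := by
    refine lt_top_iff_ne_top.2 fun h => ?_
    rw [h, finrank_top, finrank_fin_fun] at hW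
    omega
  obtain ⟨l, hl, hle⟩ := W.exists_le_ker_of_lt_top hlt
  refine ⟨l, hl, (Submodule.eq_of_le_of_finrank_eq hle ?_).symm⟩
  have h := l.finrank_range_add_finrank_ker
  rw [LinearMap.range_eq_top.2 (LinearMap.surjective hl), finrank_top, finrank_self,
    finrank_fin_fun] at h
  omega

/-- A system of the code of `f` is the image of `{(x, f x, s)}` under a linear automorphism. -/
lemma exists_system_eq_range {ξ : Basis (Fin n) F K} {f : K →ₗ[F] K} {U : Submodule F (Fin 3 → K)}
    (hU : IsAssociatedSystem F (genCode ξ f) U) :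
    ∃ T : (K × F) →ₗ[F] (Fin 3 → K), LinearMap.range T = U ∧
      (∃ l : (Fin 3 → K) →ₗ[K] K, ∀ w, l (T w) = w.1) ∧
      (∃ l : (Fin 3 → K) →ₗ[K] K, ∀ w, l (T w) = algebraMap F K w.2) ∧
      ∀ l : (Fin 3 → K) →ₗ[K] K, ∃ α β γ : K, ∀ w, l (T w) = comb f α β w.1 + w.2 • γ := by
  obtain ⟨G, ⟨-, hG⟩, rfl⟩ := hU
  have hrow : ∀ i, ∃ a b z : K,
      G.row i = (Fin.snoc (fun j => a * ξ j + b * f (ξ j)) z : Fin (n + 1) → K) := by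
    intro i
    rw [← mem_genCode (f := f), ← hG]
    exact Submodule.subset_span ⟨i, rfl⟩
  choose a b z h using hrow
  have hcol : ∀ (i : Fin 3) (j : Fin n), G i j.castSucc = a i * ξ j + b i * f (ξ j) := by
    intro i j
    have := congrFun (h i) j.castSucc
    rwa [Fin.snoc_castSucc] at this
  have hlast : ∀ i : Fin 3, G i (Fin.last n) = z i := by
    intro i
    have := congrFun (h i) (Fin.last n)
    rwa [Fin.snoc_last] at this
  let T : (K × F) →ₗ[F] (Fin 3 → K) :=
    LinearMap.pi fun i => (comb f (a i) (b i)).coprod (LinearMap.toSpanSingleton F K (z i))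
  have hT : ∀ w i, T w i = comb f (a i) (b i) w.1 + w.2 • z i := fun w i => rfl
  have hTcol : ∀ j : Fin n, T (ξ j, 0) = G.col j.castSucc := by
    intro j
    ext i
    rw [hT, Matrix.col_apply, hcol, zero_smul, add_zero, comb_apply]
  have hTlast : T (0, 1) = G.col (Fin.last n) := by
    ext i
    rw [hT, Matrix.col_apply, hlast, map_zero, zero_add, one_smul]
  have hform : ∀ l : (Fin 3 → K) →ₗ[K] K, ∀ w, l (T w) =
      comb f (l a) (l b) w.1 + w.2 • l z := by
    intro l w
    have : T w = w.1 • a + f w.1 • b + algebraMap F K w.2 • z := by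
      ext i
      rw [hT, comb_apply]
      simp [Algebra.smul_def, mul_comm]
    rw [this, map_add, map_add, map_smul, map_smul, map_smul, comb_apply, Algebra.smul_def w.2]
    simp only [smul_eq_mul]
    ring
  have hword : ∀ (p r e : K), ∃ l : (Fin 3 → K) →ₗ[K] K,
      ∀ w, l (T w) = comb f p r w.1 + w.2 • e := by
    intro p r e
    have hmem : (Fin.snoc (fun j => p * ξ j + r * f (ξ j)) e : Fin (n + 1) → K) ∈
        Submodule.span K (Set.range G.row) := by
      rw [hG]
      exact mem_genCode.2 ⟨p, r, e, rfl⟩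
    obtain ⟨c, hc⟩ := (Submodule.mem_span_range_iff_exists_fun K).1 hmem
    let l : (Fin 3 → K) →ₗ[K] K := Fintype.linearCombination K c
    have hl : ∀ j, l (G.col j) =
        (Fin.snoc (fun j => p * ξ j + r * f (ξ j)) e : Fin (n + 1) → K) j := by
      intro j
      rw [← hc]
      simp [l, Fintype.linearCombination_apply, Finset.sum_apply, mul_comm]
    have hext : (l.restrictScalars F) ∘ₗ T =
        (comb f p r).coprod (LinearMap.toSpanSingleton F K e) := by
      refine LinearMap.prod_ext (ξ.ext fun j => ?_) (LinearMap.ext_ring ?_)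
      · have := hl j.castSucc
        rw [← hTcol, Fin.snoc_castSucc] at this
        simpa using this
      · have := hl (Fin.last n)
        rw [← hTlast, Fin.snoc_last] at this
        simpa using this
    exact ⟨l, fun w => LinearMap.congr_fun hext w⟩
  refine ⟨T, le_antisymm ?_ ?_, ?_, ?_, fun l => ⟨_, _, _, hform l⟩⟩
  · rintro _ ⟨⟨x, s⟩, rfl⟩
    have hx : ⊤ ≤ (Submodule.span F (Set.range G.col)).comap (T ∘ₗ LinearMap.inl F K F) := by
      rw [← ξ.span_eq, Submodule.span_le]
      rintro _ ⟨j, rfl⟩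
      exact Submodule.subset_span ⟨j.castSucc, (hTcol j).symm⟩
    rw [show (x, s) = (x, 0) + s • ((0, 1) : K × F) by simp, map_add, map_smul, hTlast]
    exact add_mem (hx (Submodule.mem_top (x := x)))
      (Submodule.smul_mem _ _ (Submodule.subset_span ⟨_, rfl⟩))
  · rw [Submodule.span_le]
    rintro _ ⟨j, rfl⟩
    induction j using Fin.lastCases with
    | last => exact ⟨_, hTlast⟩
    | cast j => exact ⟨_, hTcol j⟩
  · obtain ⟨l, hl⟩ := hword 1 0 0
    exact ⟨l, fun w => by rw [hl]; simp⟩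
  · obtain ⟨l, hl⟩ := hword 0 0 1
    exact ⟨l, fun w => by rw [hl]; simp [Algebra.smul_def]⟩

variable [FiniteDimensional F K]

lemma exists_finrank_ker_comb_eq_one {C : Submodule K (Fin (n + 1) → K)} {f : K →ₗ[F] K}
    (hn : finrank F K = n) (hn2 : 2 < n)
    (hC : IsRepresentedBy C f) (hnd : IsQNondegenerate F C) :
    ∃ α β : K, (α ≠ 0 ∨ β ≠ 0) ∧ finrank F (LinearMap.ker (comb f α β)) = 1 := by
  obtain ⟨-, U, hU, W, hW, hUW, hspan⟩ := hnd
  have ξ : Basis (Fin n) F K := finBasisOfFinrankEq F K hn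
  obtain ⟨T, rfl, ⟨l₁, hl₁⟩, ⟨l₂, hl₂⟩, hT⟩ :=
    exists_system_eq_range ((hC ξ).isAssociatedSystem hU)
  obtain ⟨l, hl0, rfl⟩ := exists_ker_eq_of_finrank_eq_two hW
  obtain ⟨α, β, γ, hl⟩ := hT l
  have hTinj : Function.Injective T := by
    rw [injective_iff_map_eq_zero]
    rintro ⟨x, s⟩ h
    have h1 := hl₁ (x, s)
    have h2 := hl₂ (x, s)
    rw [h, map_zero] at h1 h2
    exact Prod.ext h1.symm ((map_eq_zero (algebraMap F K)).1 h2.symm)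
  set N : Submodule F (K × F) := ((LinearMap.ker l).restrictScalars F).comap T with hN
  have hmemN : ∀ w, w ∈ N ↔ comb f α β w.1 + w.2 • γ = 0 := fun w => by
    rw [← hl]
    rfl
  have hmap : N.map T = LinearMap.range T ⊓ (LinearMap.ker l).restrictScalars F :=
    Submodule.map_comap_eq _ _
  have hNrank : finrank F N = 2 := by
    rw [(Submodule.equivMapOfInjective T hTinj N).finrank_eq, hmap, hUW]
  set k := comb f α β with hk
  have hinl : Function.Injective (LinearMap.inl F K F) := LinearMap.inl_injective
  have hsub : (LinearMap.ker k).map (LinearMap.inl F K F) ≤ N := by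
    rintro _ ⟨x, hx, rfl⟩
    rw [hmemN]
    simpa using hx
  have hrank : finrank F ((LinearMap.ker k).map (LinearMap.inl F K F)) =
      finrank F (LinearMap.ker k) :=
    (Submodule.equivMapOfInjective _ hinl _).finrank_eq.symm
  have hle := Submodule.finrank_mono hsub
  have hge : 1 ≤ finrank F (LinearMap.ker k) := by
    have h1 := finrank_inf_ker_add N (LinearMap.snd F K F)
    have h2 : finrank F (N.map (LinearMap.snd F K F)) ≤ 1 := by
      simpa using (N.map (LinearMap.snd F K F)).finrank_le
    have h3 : N ⊓ LinearMap.ker (LinearMap.snd F K F) ≤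
        (LinearMap.ker k).map (LinearMap.inl F K F) := by
      rintro ⟨x, s⟩ ⟨hw, hs⟩
      obtain rfl : s = 0 := hs
      have := (hmemN _).1 hw
      exact ⟨x, by simpa using this, rfl⟩
    have h4 := Submodule.finrank_mono h3
    omega
  have hkerzero : k = 0 → finrank F (LinearMap.ker k) = n := by
    intro h
    rw [h, LinearMap.ker_zero, finrank_top, hn]
  have hne : finrank F (LinearMap.ker k) ≠ 2 := by
    intro h2
    have heq := Submodule.eq_of_le_of_finrank_eq hsub (by rw [hrank, h2, hNrank])
    have hW2 : LinearMap.ker l ≤ LinearMap.ker l₂ := by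
      have hle : Submodule.span K ((LinearMap.range T ⊓ (LinearMap.ker l).restrictScalars F :
          Submodule F (Fin 3 → K)) : Set (Fin 3 → K)) ≤ LinearMap.ker l :=
        Submodule.span_le.2 fun u hu => hu.2
      rw [← Submodule.eq_of_le_of_finrank_eq hle (by rw [hspan, hW]), Submodule.span_le, ← hmap,
        ← heq]
      rintro _ ⟨_, ⟨x, hx, rfl⟩, rfl⟩
      rw [SetLike.mem_coe, LinearMap.mem_ker, hl₂]
      simp
    obtain ⟨u₀, hu₀⟩ : ∃ u, l u ≠ 0 := by
      by_contra! h
      exact hl0 (LinearMap.ext h)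
    have hprop : ∀ u, l₂ u * l u₀ = l u * l₂ u₀ := by
      intro u
      have : l u₀ • u - l u • u₀ ∈ LinearMap.ker l := by
        rw [LinearMap.mem_ker, map_sub, map_smul, map_smul, smul_eq_mul, smul_eq_mul, mul_comm,
          sub_self]
      have h := hW2 this
      rw [LinearMap.mem_ker, map_sub, map_smul, map_smul, smul_eq_mul, smul_eq_mul] at h
      linear_combination h
    have hu₂ : l₂ u₀ ≠ 0 := by
      intro h0
      have := hprop (T (0, 1))
      rw [hl₂, h0, map_one, one_mul, mul_zero] at this
      exact hu₀ this
    have hk0 : k = 0 := by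
      ext x
      have := hprop (T (x, 0))
      rw [hl₂, hl, map_zero, zero_mul, zero_smul, add_zero, eq_comm] at this
      exact (mul_eq_zero.1 this).resolve_right hu₂
    have := hkerzero hk0
    omega
  have h1 : finrank F (LinearMap.ker k) = 1 := by omega
  refine ⟨α, β, ?_, h1⟩
  by_contra! h
  have := hkerzero (by rw [hk, h.1, h.2, comb_zero_zero])
  omega

/-- The linear set of a `q`-non-degenerate code has a point of weight one. -/
lemma exists_point_of_weight_one {C : Submodule K (Fin (n + 1) → K)} {f : K →ₗ[F] K}
    (hn : finrank F K = n) (hn2 : 2 < n)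
    (hC : IsRepresentedBy C f) (hnd : IsQNondegenerate F C) :
    ∃ x : K, x ≠ 0 ∧ ∀ y, x * f y = y * f x → ∃ s : F, y = s • x := by
  obtain ⟨α, β, hαβ, hker⟩ := exists_finrank_ker_comb_eq_one hn hn2 hC hnd
  have hbot : LinearMap.ker (comb f α β) ≠ ⊥ := by
    intro h
    rw [h, finrank_bot] at hker
    omega
  obtain ⟨x, hx, hx0⟩ := Submodule.exists_mem_ne_zero_of_ne_bot hbot
  refine ⟨x, hx0, fun y hy => exists_smul_of_comb_eq_zero hker.le hx0 hx ?_⟩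
  rw [LinearMap.mem_ker, comb_apply] at hx
  rw [comb_apply]
  refine (mul_eq_zero.1 (show x * (α * y + β * f y) = 0 from ?_)).resolve_left hx0
  linear_combination y * hx + β * hy

end PointOfWeightOne

section Main

variable {F K : Type*} [Field F] [Field K] [Algebra F K] {n : ℕ}

lemma IsCode.exists_rankWeight_eq {N k d : ℕ} {C : Submodule K (Fin N → K)} (hC : IsCode F C k d) :
    ∃ v ∈ C, rankWeight F v = d := by
  obtain ⟨x, hx, y, hy, -, hd⟩ := hC.2.1
  exact ⟨x - y, sub_mem hx hy, hd.symm⟩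

variable [FiniteDimensional F K] [Algebra.IsSeparable F K]

lemma exists_isRankFourForm [Finite F] {C : Submodule K (Fin (4 + 1) → K)} {f : K →ₗ[F] K}
    (hC : IsRepresentedBy C f) (h4 : finrank F K = 4)
    (hf : ∀ a b : K, comb f a b = 0 → a = 0 ∧ b = 0) (hnd : IsQNondegenerate F C) :
    ∃ g : K →ₗ[F] K, IsRankFourForm g ∧ IsRepresentedBy C g := by
  by_cases h1 : ∃ a b : K, combRank f a b = 1
  · obtain ⟨a, b, hab⟩ := h1
    exact ⟨traceMap F K, Or.inr (Or.inl fun x => traceMap_apply x),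
      isRepresentedBy_traceMap hC (by omega) hab⟩
  have h0 : ∀ a b : K, a ≠ 0 ∨ b ≠ 0 → 2 ≤ combRank f a b := by
    intro a b hab
    have h2 : combRank f a b ≠ 1 := fun h => h1 ⟨a, b, h⟩
    have h3 : combRank f a b ≠ 0 := fun h => by
      obtain ⟨ha, hb⟩ := hf a b (combRank_eq_zero h)
      exact hab.elim (· ha) (· hb)
    omega
  by_cases h2 : ∃ a b : K, combRank f a b = 2
  · obtain ⟨a, b, hab⟩ := h2
    by_cases h3 : ∃ c d : K, a * d - b * c ≠ 0 ∧ combRank f c d = 2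
    · obtain ⟨c, d, hdet, hcd⟩ := h3
      exact exists_isRankFourForm_of_two_points hC h4 hdet hab hcd
        (exists_point_of_weight_one h4 (by omega) hC hnd)
    · obtain ⟨g, β, hg, hβ, hr, hcomb⟩ := exists_normalized_of_combRank_eq_two hC (by omega) hab
      refine exists_isRankFourForm_of_club hg h4 hβ hr (isThinOutsideKer fun c d hc => ?_)
      obtain ⟨c', d', hdet, heq⟩ := hcomb c d hc
      have h4' : combRank f c' d' ≠ 2 := fun h => h3 ⟨c', d', hdet, h⟩
      have h5 := h0 c' d' (by
        by_contra! h
        rw [h.1, h.2] at hdet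
        simp at hdet)
      rw [combRank, heq, h4]
      change 4 - 1 ≤ combRank f c' d'
      omega
  · refine exists_isRankFourForm_of_scattered hC h4 fun a b hab => ?_
    have := h0 a b hab
    have h3 : combRank f a b ≠ 2 := fun h => h2 ⟨a, b, h⟩
    omega

/-- The code has a point of weight `n - 2` and all other points have weight one. -/
lemma exists_isTraceClubForm [Finite K] [Finite F] {C : Submodule K (Fin (n + 1) → K)}
    {f : K →ₗ[F] K}
    (hC : IsRepresentedBy C f) (hn : finrank F K = n) (hn2 : 2 ≤ n)
    (hf : ∀ a b : K, comb f a b = 0 → a = 0 ∧ b = 0)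
    (h1 : numCodewords F C (fun w => w = 1) = Nat.card K - 1)
    (h2 : numCodewords F C (fun w => w = 2) = (Nat.card K - 1) * Nat.card F ^ 2)
    (h3 : numCodewords F C (fun w => 3 ≤ w ∧ w < n - 1) ≤
      (Nat.card K - 1) * (Nat.card K - Nat.card F ^ 2)) :
    ∃ g : K →ₗ[F] K, IsTraceClubForm g ∧ IsClubPolynomial (n - 2) g ∧ IsRepresentedBy C g := by
  have hn3 : 3 ≤ n := by
    by_contra! hlt
    have hk := combRank_add_finrank_ker f (f 1) (-1)
    have hr1 := combRank_ne_one hC hn hf h1 (f 1) (-1)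
    have hr0 : combRank f (f 1) (-1) ≠ 0 := fun h => by
      simpa using (hf _ _ (combRank_eq_zero h)).2
    have hker : 0 < finrank F (LinearMap.ker (comb f (f 1) (-1))) :=
      Submodule.one_le_finrank_iff.2 ((Submodule.ne_bot_iff _).2 ⟨1, by simp, one_ne_zero⟩)
    omega
  obtain ⟨a, b, hab, hcd⟩ := exists_combRank_eq_two hC hn hf h1 h2 h3
  obtain ⟨g, β, hg, hβ, hr, hcomb⟩ := exists_normalized_of_combRank_eq_two hC (by omega) hab
  have hthin : IsThinOutsideKer g := isThinOutsideKer fun c d hc => by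
    obtain ⟨c', d', hdet, heq⟩ := hcomb c d hc
    rw [combRank, heq, hn]
    exact hcd c' d' hdet
  have hker := finrank_ker_add_two hβ hr
  refine ⟨g, isTraceClubForm_of_isThinOutsideKer hβ hr hthin, ?_, hg⟩
  have hclub := isClubPolynomial_of_isThinOutsideKer hthin (fun h => by
    rw [h, finrank_bot] at hker
    omega)
  rwa [show finrank F (LinearMap.ker g) = n - 2 by omega] at hclub

end Main

end RankMetric

open RankMetric in
theorem mainTheorem12 {F K : Type*} [Field F] [Field K] [Algebra F K] [Finite F] [Finite K]
    (q n : ℕ) (hq : Nat.card F = q) (hn : Module.finrank F K = n)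
    (C : Submodule K (Fin (n + 1) → K))
    (hC : IsCode F C 3 1) (hnd : IsQNondegenerate F C) :
    (∀ U : Submodule F (Fin 3 → K), IsAssociatedSystem F C U → IsLinearRedeiBlockingSet U) ∧
    (q ^ n - 1 < numCodewords F C (fun w => w = 1) →
      ∀ ξ : Module.Basis (Fin n) F K, SemilinearlyEquivalent F C (genCode ξ (Tr F))) ∧
    (n = 4 → ∃ f : K →ₗ[F] K, IsRankFourForm f ∧
      ∀ ξ : Module.Basis (Fin n) F K, SemilinearlyEquivalent F C (genCode ξ f)) ∧
    (numCodewords F C (fun w => w = 1) = q ^ n - 1 →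
      numCodewords F C (fun w => w = 2) = (q ^ n - 1) * q ^ 2 →
      numCodewords F C (fun w => 3 ≤ w ∧ w < n - 1) ≤ (q ^ n - 1) * (q ^ n - q ^ 2) →
      ∃ f : K →ₗ[F] K, IsTraceClubForm f ∧ IsClubPolynomial (n - 2) f ∧
        ∀ ξ : Module.Basis (Fin n) F K, SemilinearlyEquivalent F C (genCode ξ f)) := by
  have : FiniteDimensional F K := Module.Finite.of_finite
  have hcard : q ^ n = Nat.card K := by
    rw [← hq, ← hn, Module.natCard_eq_pow_finrank (K := F) (V := K)]
  obtain ⟨v, hvC, hv⟩ := hC.exists_rankWeight_eq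
  have hn2 : 2 ≤ n := by
    have := C.finrank_le
    rw [hC.1, finrank_fin_fun] at this
    omega
  obtain ⟨f, hf, hCf⟩ := exists_isRepresentedBy hn hC.1 hnd.1 hvC hv
  rw [hcard]
  subst hq
  refine ⟨fun U hU => isLinearRedeiBlockingSet hn hnd.1 hvC hv hU, fun h ξ => ?_, ?_,
    fun h1 h2 h3 => ?_⟩
  · obtain ⟨a, b, hab⟩ := exists_combRank_eq_one hCf hn hf h
    exact (isRepresentedBy_traceMap hCf (by omega) hab ξ).semilinearlyEquivalent
  · rintro rfl
    obtain ⟨g, hg, hCg⟩ := exists_isRankFourForm hCf hn hf hnd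
    exact ⟨g, hg, fun ξ => (hCg ξ).semilinearlyEquivalent⟩
  · obtain ⟨g, hg, hclub, hCg⟩ := exists_isTraceClubForm hCf hn hn2 hf h1 h2 h3
    exact ⟨g, hg, hclub, fun ξ => (hCg ξ).semilinearlyEquivalent⟩
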